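/- For $r,k\ge 0$ let $\mathcal P_{s^+}(r,k)$ be the set of all noncrossing partitions between an upper row of $r$ points and a lower row of $k$ points (the category associated with $S_n^+$). Let $\mathcal P_{b^+}(r,k)$ be the subset of those whose blocks are all singletons or pairs (for $B_n^+$), and $\mathcal P_{o^+}(r,k)$ the subset of those whose blocks are all pairs (for $O_n^+$). Let $\mathcal P$ be one of these three families, and write $\mathcal P(k)=\mathcal P(0,k)$. Let $|\pi|$ be the number of blocks of $\pi$, and let $G_{kn}$ be the Gram matrix with entries $G_{kn}(\pi,\sigma)=n^{|\pi\vee\sigma|}$ for $\pi,\sigma\in\mathcal P(k)$, where $\vee$ is the supremum in the lattice of all partitions. Set $a_k=\sum_{\pi\in\mathcal P(k)}(2|\pi|-k)$. Let $\mathcal P^+(k)$ be the set of "epi" partitions: those $\sigma\in\mathcal P(r,k)$, $0\le r\le k$, in which every upper point is connected to no other upper point and to at least one lower point; write $r(\sigma)=r$ for the number of upper points. Define polynomials in $n$ by - $P_0=1,\ P_1=n,\ P_{r+1}=nP_r-P_{r-1}$; - $Q_0=1,\ Q_1=n-1,\ Q_{r+1}=(n-1)Q_r-Q_{r-1}$;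 - $R_0=R_1=1,\ R_2=n-1,\ R_3=n-2,\ R_{r+2}=(n-2)R_r-R_{r-2}$ for $r\ge 2$, with the convention $P_{-1}=Q_{-1}=R_{-1}=1$. Let $k\ge 0$. As identities in the field $\mathbb Q(n)$ of rational functions, and also for every real number $n$ at which none of the denominators vanishes, $$O_n^+:\quad \det(G_{kn})=n^{a_k}\prod_{\sigma\in\mathcal P_{o^+}^+(k),\ r(\sigma)\text{ even}}\frac{P_{r(\sigma)/2}(n)}{P_{r(\sigma)/2-1}(n)},$$ $$B_n^+:\quad \det(G_{kn})=n^{a_k}\prod_{\sigma\in\mathcal P_{b^+}^+(k),\ r(\sigma)\text{ even}}\frac{Q_{r(\sigma)/2}(n)}{Q_{r(\sigma)/2-1}(n)},$$ $$S_n^+:\quad \det(G_{kn})=n^{a_k}\prod_{\sigma\in\mathcal P_{s^+}^+(k)}\frac{R_{r(\sigma)}(n)}{R_{r(\sigma)-1}(n)}.$$ Moreover $(P_r)_{r\ge0}$, $(Q_r)_{r\ge0}$, $(R_{2r})_{r\ge0}$ are the (monic) orthogonal polynomials for $O_n^+,B_n^+,S_n^+$ respectively: in each case there is a probability measure on $\mathbb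 R$ whose $k$-th moment is $\#\mathcal P(k)$, the trace of $G_{k,1}$, for every $k\ge0$ (the asymptotic law of the main character), the $r$-th polynomial of the sequence is monic of degree $r$, and distinct members of the sequence are orthogonal with respect to this measure. -/

import Mathlib

open Polynomial MeasureTheory

namespace EasyGram

noncomputable section

/-- Partitions between an upper row of `k` points (`Sum.inl`) and a lower row of `l` points
(`Sum.inr`), encoded as equivalence relations whose classes are the blocks. -/
abbrev RowPartition (k l : ℕ) : Type := Setoid (Fin k ⊕ Fin l)

/-- A collection of sets `P k l` of partitions between `k` upper and `l` lower points. -/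
abbrev PartitionFamily : Type := ∀ k l : ℕ, Set (RowPartition k l)

instance finite_setoid (α : Type*) [Finite α] : Finite (Setoid α) :=
  Finite.of_injective (fun s : Setoid α => (fun x y => s x y : α → α → Prop)) <| by
    intro s t h
    ext x y
    exact iff_of_eq (congrFun (congrFun h x) y)

/-- Clockwise position of a point on the boundary of the strip: the upper row from left to right,
followed by the lower row from right to left. -/
def position {k l : ℕ} : Fin k ⊕ Fin l → ℕ
  | Sum.inl i => i
  | Sum.inr j => k + (l - 1 - j)

/-- The blocks can be drawn between the two rows without crossings. -/
def IsNoncrossing {k l : ℕ} (π : RowPartition k l) : Prop :=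
  ∀ a b c d : Fin k ⊕ Fin l,
    position a < position b → position b < position c → position c < position d →
      π a c → π b d → π a b

/-- `O_n^+`: all noncrossing pairings. -/
def ncPairings : PartitionFamily := fun _ _ =>
  {π | IsNoncrossing π ∧ ∀ x, Set.ncard {y | π x y} = 2}

/-- `B_n^+`: all noncrossing partitions into singletons and pairs. -/
def ncSingletonsPairings : PartitionFamily := fun _ _ =>
  {π | IsNoncrossing π ∧ ∀ x, Set.ncard {y | π x y} = 1 ∨ Set.ncard {y | π x y} = 2}

/-- `S_n^+`: all noncrossing partitions. -/
def ncPartitions : PartitionFamily := fun _ _ => {π | IsNoncrossing π}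

/-- The number of blocks `|π|`. -/
def numBlocks {k l : ℕ} (π : RowPartition k l) : ℕ := Nat.card (Quotient π)

/-- `P(k) = P(0, k)`. -/
abbrev Diagram (P : PartitionFamily) (k : ℕ) : Type := {π : RowPartition 0 k // π ∈ P 0 k}

instance (P : PartitionFamily) (k : ℕ) : Fintype (Diagram P k) := Fintype.ofFinite _

instance (P : PartitionFamily) (k : ℕ) : DecidableEq (Diagram P k) := Classical.decEq _

/-- The Gram matrix `G_{kn}(π, σ) = n ^ |π ∨ σ|`, with `π ∨ σ` the supremum among all
partitions. -/
def gramMatrix (P : PartitionFamily) (k : ℕ) {R : Type*} [CommRing R] (n : R) :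
    Matrix (Diagram P k) (Diagram P k) R :=
  Matrix.of fun π σ => n ^ numBlocks (π.1 ⊔ σ.1)

/-- `a_k = ∑_{π ∈ P(k)} (2|π| - k)`. -/
def gramExponent (P : PartitionFamily) (k : ℕ) : ℤ :=
  ∑ π : Diagram P k, (2 * (numBlocks π.1 : ℤ) - (k : ℤ))

/-- Each upper point is connected to lower points only, and to at least one of them. -/
def IsEpi {r k : ℕ} (σ : RowPartition r k) : Prop :=
  ∀ i : Fin r,
    (∀ j : Fin r, σ (Sum.inl i) (Sum.inl j) → j = i) ∧ ∃ j : Fin k, σ (Sum.inl i) (Sum.inr j)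

/-- `P^+(k)`: the epi partitions with `k` lower points and `0 ≤ r ≤ k` upper points. -/
abbrev EpiDiagram (P : PartitionFamily) (k : ℕ) : Type :=
  Σ r : Fin (k + 1), {σ : RowPartition r k // σ ∈ P r k ∧ IsEpi σ}

instance (P : PartitionFamily) (k : ℕ) : Fintype (EpiDiagram P k) := Fintype.ofFinite _

/-- The number `r(σ)` of upper legs. -/
def EpiDiagram.legs {P : PartitionFamily} {k : ℕ} (σ : EpiDiagram P k) : ℕ := σ.1

/-- `P_0 = 1`, `P_1 = n`, `P_{r+2} = n P_{r+1} - P_r`. -/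
def polyP : ℕ → ℤ[X]
  | 0 => 1
  | 1 => X
  | r + 2 => X * polyP (r + 1) - polyP r

/-- `Q_0 = 1`, `Q_1 = n - 1`, `Q_{r+2} = (n - 1) Q_{r+1} - Q_r`. -/
def polyQ : ℕ → ℤ[X]
  | 0 => 1
  | 1 => X - 1
  | r + 2 => (X - 1) * polyQ (r + 1) - polyQ r

/-- `R_0 = 1`, `R_1 = 1`, `R_2 = n - 1`, `R_3 = n - 2`, `R_{r+4} = (n - 2) R_{r+2} - R_r`. -/
def polyR : ℕ → ℤ[X]
  | 0 => 1
  | 1 => 1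
  | 2 => X - 1
  | 3 => X - 2
  | r + 4 => (X - 2) * polyR (r + 2) - polyR r

/-- The value at `n` of `F_m / F_{m-1}`, with the convention `F_{-1} = 1` (and `F_0 = 1` for all
the families used here). -/
def stepRatio (F : ℕ → ℤ[X]) {K : Type*} [Field K] (n : K) : ℕ → K
  | 0 => 1
  | m + 1 => aeval n (F (m + 1)) / aeval n (F m)

/-- `μ` is the asymptotic law of the main character: the probability measure on the real line
whose `k`-th moment is the Gram trace `T_k(t) = Tr(G_{kt})` at `t = 1`. -/
def IsMainCharacterLaw (P : PartitionFamily) (μ : Measure ℝ) : Prop :=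
  IsProbabilityMeasure μ ∧
    ∀ k : ℕ, Integrable (fun x => x ^ k) μ ∧ ∫ x, x ^ k ∂μ = (gramMatrix P k (1 : ℝ)).trace

/-- `F_0, F_1, F_2, …` are the orthogonal polynomials for `μ`: `F_r` is monic of degree `r`, and
distinct members of the sequence are orthogonal in `L²(μ)`. -/
def AreOrthogonalPolynomials (F : ℕ → ℤ[X]) (μ : Measure ℝ) : Prop :=
  (∀ r, (F r).Monic ∧ (F r).natDegree = r) ∧
    ∀ i j, i ≠ j → Integrable (fun x : ℝ => aeval x (F i) * aeval x (F j)) μ ∧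
      ∫ x : ℝ, aeval x (F i) * aeval x (F j) ∂μ = 0

end

end EasyGram

open EasyGram

open EasyGram

namespace EasyGram

/-! ### Sums over lists of given length -/

/-! One Gram matrix is computed in two models of the same Temperley-Lieb type relations. Every
diagram arises from the empty one by inserting cups and, when singletons are coded by flat steps,
dots. If insertion is adjoint to removal, every inner product of two such words follows from the
rules for a removal meeting an insertion (loop value, snake, dot rules). So it depends only on
`loop` and `z`, not on the model (`exists_delOp_eval`, `exists_form_eval`).

In the spin models a diagram becomes the indicator of the spin configurations constant on its
blocks, and the Gram entry is `n ^ |π ∨ σ|`. For all noncrossing partitions the blocks are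
thickened: each point has two sides, and the loop values alternate between `n` and 1. In the path
model the states are lattice paths, mutually orthogonal, whose squared norm is a product of `ρ h`
over the up-steps from height `h` and of a constant over the flat steps. Diagrams correspond
bijectively to paths (`CodedFamily`), and the vector of a diagram is its path plus lower paths. By
unitriangularity the determinant is the product of the path weights (`det_of_isLeading`,
`det_form`). The loop rule forces `ρ (h + 1) + (ρ h)⁻¹` to be the loop value, less 1 when flat steps
exist; ratios of consecutive `polyP`, `polyQ` or, up to alternating powers of `n`, `polyR` solve
this.

The up-steps from height `s` in all paths of length `m` number `ball fl m (2 * s + 2)`, by a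
convolution of ballot numbers (`sumLists_upCount_zero`). The same number counts the epi partitions
with `2 * s + 2` legs or, for thickened blocks, with `s + 1` legs. The remaining powers of `n` add
up to `a_k`, because the number of blocks can be read off the norm of a diagram for two spins. All
this is done for natural numbers `n ≥ 5`, where the polynomials are positive; clearing denominators
gives an identity in `ℤ[X]`, valid in every field.

Orthogonality is that of `sin ((r + 1) θ)` on `[0, π]`: the laws are the images of the semicircle
law under the identity, the shift by 1 and the square. Their moments obey the recurrence of the path
counts. -/

/-- The sum of `F l` over all lists `l` of length `m`. -/
def sumLists {A K : Type*} [Fintype A] [AddCommMonoid K] : ℕ → (List A → K) → K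
  | 0, F => F []
  | m + 1, F => ∑ a, sumLists m (fun l => F (a :: l))

section sumLists
variable {A K : Type*} [Fintype A]

theorem sumLists_congr [AddCommMonoid K] {m : ℕ} {F G : List A → K}
    (h : ∀ l, l.length = m → F l = G l) : sumLists m F = sumLists m G := by
  induction m generalizing F G with
  | zero => exact h [] rfl
  | succ m ih =>
    refine Finset.sum_congr rfl fun a _ => ih fun l hl => h _ (by simp [hl])

theorem sumLists_add [AddCommMonoid K] (i j : ℕ) (F : List A → K) :
    sumLists (i + j) F = sumLists i (fun l => sumLists j (fun l' => F (l ++ l'))) := by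
  induction i generalizing F with
  | zero => simp [sumLists]
  | succ i ih =>
    rw [show i + 1 + j = i + j + 1 by omega]
    simp [sumLists, ih]

theorem sumLists_mul_left [Semiring K] (m : ℕ) (c : K) (F : List A → K) :
    sumLists m (fun l => c * F l) = c * sumLists m F := by
  induction m generalizing F with
  | zero => rfl
  | succ m ih => simp [sumLists, ih, Finset.mul_sum]

theorem sumLists_sum [AddCommMonoid K] {ι : Type*} (s : Finset ι) (m : ℕ) (F : ι → List A → K) :
    sumLists m (fun l => ∑ i ∈ s, F i l) = ∑ i ∈ s, sumLists m (F i) := by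
  induction m generalizing F with
  | zero => rfl
  | succ m ih => simp only [sumLists, ih]; exact Finset.sum_comm

theorem sumLists_comm [AddCommMonoid K] (i j : ℕ) (F : List A → List A → K) :
    sumLists i (fun l => sumLists j (fun l' => F l l')) =
      sumLists j (fun l' => sumLists i (fun l => F l l')) := by
  induction i generalizing F with
  | zero => rfl
  | succ i ih => simp only [sumLists, ih, sumLists_sum]

theorem sumLists_zero [AddCommMonoid K] (m : ℕ) : sumLists m (fun _ : List A => (0 : K)) = 0 := by
  induction m with
  | zero => rfl
  | succ m ih => simp [sumLists, ih]

theorem sumLists_eq_sum [AddCommMonoid K] (m : ℕ) (F : List A → K) :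
    sumLists m F = ∑ f : Fin m → A, F (List.ofFn f) := by
  induction m generalizing F with
  | zero => simp [sumLists]
  | succ m ih =>
    rw [← (Fin.consEquiv fun _ => A).sum_comp, Fintype.sum_prod_type]
    simp [sumLists, ih, Fin.consEquiv, List.ofFn_succ]

end sumLists

/-! ### Models of the Temperley-Lieb relations -/

/-- The number of points inserted by a cup (`true`) or by a dot (`false`). -/
def arity : Bool → ℕ
  | true => 2
  | false => 1

/-- A state model in which cups and dots can be inserted into, and removed from, the states, which
are lists. The coefficients may depend on the part of the state to the left. -/
structure TLModel (K : Type) [Field K] (loop : ℕ → K) (z : K) where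
  A : Type
  [fin : Fintype A]
  [dec : DecidableEq A]
  ok : List A → Prop
  /-- coefficients of the insertions -/
  cre : Bool → List A → List A → K
  /-- coefficients of the removals -/
  ann : Bool → List A → List A → K
  /-- squared norms of the states -/
  wt : List A → K
  ok_nil : ok []
  wt_nil : wt [] = 1
  -- Detailed balance: this makes insertion and removal adjoint for the form weighted by `wt`.
  adj : ∀ g l₁ u l₂, u.length = arity g →
    wt (l₁ ++ (u ++ l₂)) * cre g l₁ u = ann g l₁ u * wt (l₁ ++ l₂)
  ok_cre : ∀ g l₁ u l₂, u.length = arity g → ok (l₁ ++ (u ++ l₂)) → cre g l₁ u ≠ 0 →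
    ok (l₁ ++ l₂)
  ok_ann : ∀ g l₁ u l₂, u.length = arity g → ok (l₁ ++ l₂) → ann g l₁ u ≠ 0 →
    ok (l₁ ++ (u ++ l₂))
  -- A block with a nonzero coefficient is invisible to all coefficients computed to its right, so
  -- operators at disjoint places commute up to a shift of position.
  far : ∀ g l₁ u l₂ g', u.length = arity g → (cre g l₁ u ≠ 0 ∨ ann g l₁ u ≠ 0) →
    cre g' (l₁ ++ (u ++ l₂)) = cre g' (l₁ ++ l₂) ∧ ann g' (l₁ ++ (u ++ l₂)) = ann g' (l₁ ++ l₂)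
  -- The value may depend on the position but not on the state; otherwise no model-independent
  -- evaluation would exist.
  ann_cre_cup : ∀ l₁ l₂, ok (l₁ ++ l₂) →
    ∑ a, ∑ b, ann true l₁ [a, b] * cre true l₁ [a, b] = loop l₁.length
  ann_cre_dot : ∀ l₁ l₂, ok (l₁ ++ l₂) → ∑ a, ann false l₁ [a] * cre false l₁ [a] = z
  -- Snake relations: a cap joined to a neighbouring cup is a straight strand.
  zig : ∀ l₁ x l₂, ok (l₁ ++ x :: l₂) → ∀ a,
    ∑ b, ann true l₁ [a, b] * cre true (l₁ ++ [a]) [b, x] = if a = x then 1 else 0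
  zag : ∀ l₁ x l₂, ok (l₁ ++ x :: l₂) → ∀ b,
    ∑ a, ann true (l₁ ++ [x]) [a, b] * cre true l₁ [x, a] = if b = x then 1 else 0
  -- A cap or a cup with one end closed by a dot is a dot.
  ann_cup_dot_left : ∀ l₁ b, ∑ a, ann true l₁ [a, b] * cre false l₁ [a] = ann false l₁ [b]
  ann_cup_dot_right : ∀ l₁ a,
    ∑ b, ann true l₁ [a, b] * cre false (l₁ ++ [a]) [b] = ann false l₁ [a]
  ann_dot_cup_left : ∀ l₁ b, ∑ a, ann false l₁ [a] * cre true l₁ [a, b] = cre false l₁ [b]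
  ann_dot_cup_right : ∀ l₁ a,
    ∑ b, ann false (l₁ ++ [a]) [b] * cre true l₁ [a, b] = cre false l₁ [a]

attribute [instance] TLModel.fin TLModel.dec

/-- Formal products of insertions, creating `m` points. -/
inductive CupWord : ℕ → Type
  | nil : CupWord 0
  | ins {m : ℕ} (g : Bool) (i : ℕ) (h : i ≤ m) (w : CupWord m) : CupWord (m + arity g)

/-! ### Insertion and removal operators, their commutation rules and adjointness. -/

namespace TLModel

variable {K : Type} [Field K] {loop : ℕ → K} {z : K} (M : TLModel K loop z)

/-- Insertion at position `i`, as an operator on functions of the state. -/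
def insOp (g : Bool) (i : ℕ) (v : List M.A → K) (l : List M.A) : K :=
  M.cre g (l.take i) ((l.drop i).take (arity g)) * v (l.take i ++ (l.drop i).drop (arity g))

/-- Removal at position `i`, as an operator on functions of the state. -/
def delOp (g : Bool) (i : ℕ) (v : List M.A → K) (l : List M.A) : K :=
  sumLists (arity g) fun u => M.ann g (l.take i) u * v (l.take i ++ (u ++ l.drop i))

/-- The vector of a word. -/
def eval : {m : ℕ} → CupWord m → List M.A → K
  | _, .nil => fun _ => 1
  | _, .ins g i _ w => M.insOp g i (eval w)

theorem eval_ins {m : ℕ} (g : Bool) (i : ℕ) (h : i ≤ m) (w : CupWord m) :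
    M.eval (.ins g i h w) = M.insOp g i (M.eval w) := rfl

/-- The bilinear form. -/
noncomputable def form (m : ℕ) (v v' : List M.A → K) : K := by
  classical exact sumLists m fun l => if M.ok l then M.wt l * v l * v' l else 0

theorem insOp_append {g : Bool} {i : ℕ} (v : List M.A → K) {l₁ u : List M.A} (l₂ : List M.A)
    (h₁ : l₁.length = i) (hu : u.length = arity g) :
    M.insOp g i v (l₁ ++ (u ++ l₂)) = M.cre g l₁ u * v (l₁ ++ l₂) := by
  subst h₁
  simp [insOp, ← hu]

theorem delOp_append {g : Bool} {i : ℕ} (v : List M.A → K) {l₁ : List M.A} (l₂ : List M.A)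
    (h₁ : l₁.length = i) :
    M.delOp g i v (l₁ ++ l₂) =
      sumLists (arity g) fun u => M.ann g l₁ u * v (l₁ ++ (u ++ l₂)) := by
  subst h₁
  simp [delOp]

theorem exists_append {A : Type*} {i : ℕ} {l : List A} (h : i ≤ l.length) :
    ∃ l₁ l₂, l = l₁ ++ l₂ ∧ l₁.length = i :=
  ⟨l.take i, l.drop i, (List.take_append_drop i l).symm, by simpa using h⟩

/-- A nonzero coefficient passes `ok` on to the shorter state, so values of the vectors at other
states never enter. -/
theorem insOp_congr {g : Bool} {i m : ℕ} (hi : i ≤ m) {v v' : List M.A → K}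
    (h : ∀ l, M.ok l → l.length = m → v l = v' l) {l : List M.A} (hl : M.ok l)
    (hm : l.length = m + arity g) : M.insOp g i v l = M.insOp g i v' l := by
  obtain ⟨l₁, l₂, rfl, h₁⟩ := exists_append (i := i) (l := l) (by omega)
  obtain ⟨u, l₂, rfl, hu⟩ := exists_append (i := arity g) (l := l₂) (by simp at hm; omega)
  rw [insOp_append M _ _ h₁ hu, insOp_append M _ _ h₁ hu]
  by_cases hz : M.cre g l₁ u = 0
  · simp [hz]
  · rw [h _ (M.ok_cre g l₁ u l₂ hu hl hz) (by simp at hm ⊢; omega)]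

theorem insOp_mul {g : Bool} {i : ℕ} (c : K) (v : List M.A → K) (l : List M.A) :
    M.insOp g i (fun l => c * v l) l = c * M.insOp g i v l := by
  simp only [insOp]; ring

/-- A removal to the left of an insertion. -/
theorem delOp_insOp_of_left {g g' : Bool} {i j : ℕ} (hij : i ≤ j) (v : List M.A → K)
    {l : List M.A} (hl : j + arity g' ≤ l.length) :
    M.delOp g i (M.insOp g' (j + arity g) v) l = M.insOp g' j (M.delOp g i v) l := by
  obtain ⟨l₁, l₂, rfl, h₁⟩ := exists_append (i := i) (l := l) (by omega)
  obtain ⟨l₂, l₃, rfl, h₂⟩ := exists_append (i := j - i) (l := l₂) (by simp at hl; omega)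
  obtain ⟨u', l₃, rfl, hu'⟩ := exists_append (i := arity g') (l := l₃) (by simp at hl; omega)
  rw [delOp_append M _ _ h₁, ← List.append_assoc l₁,
    insOp_append M _ _ (by simp; omega) hu', List.append_assoc, delOp_append M _ _ h₁,
    ← sumLists_mul_left]
  refine sumLists_congr fun u hu => ?_
  have e : l₁ ++ (u ++ (l₂ ++ (u' ++ l₃))) = (l₁ ++ (u ++ l₂)) ++ (u' ++ l₃) := by simp
  rw [e, insOp_append M _ _ (by simp; omega) hu']
  -- Only nonzero removal coefficients count, and for those `far` lets the insertion ignore `u`.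
  by_cases hz : M.ann g l₁ u = 0
  · simp [hz]
  · rw [(M.far g l₁ u l₂ g' hu (.inr hz)).1]
    simp only [List.append_assoc]
    ring

/-- A removal to the right of an insertion. -/
theorem delOp_insOp_of_right {g g' : Bool} {i j : ℕ} (hij : i ≤ j) (v : List M.A → K)
    {l : List M.A} (hl : j + arity g' ≤ l.length) :
    M.delOp g (j + arity g') (M.insOp g' i v) l = M.insOp g' i (M.delOp g j v) l := by
  obtain ⟨l₁, l₂, rfl, h₁⟩ := exists_append (i := i) (l := l) (by omega)
  obtain ⟨u', l₂, rfl, hu'⟩ := exists_append (i := arity g') (l := l₂) (by simp at hl; omega)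
  obtain ⟨l₂, l₃, rfl, h₂⟩ := exists_append (i := j - i) (l := l₂) (by simp at hl; omega)
  have e : l₁ ++ (u' ++ (l₂ ++ l₃)) = (l₁ ++ (u' ++ l₂)) ++ l₃ := by simp
  have e' : l₁ ++ (l₂ ++ l₃) = (l₁ ++ l₂) ++ l₃ := by simp
  rw [insOp_append M _ _ h₁ hu', e, delOp_append M _ _ (by simp; omega), e',
    delOp_append M _ _ (by simp; omega), ← sumLists_mul_left]
  refine sumLists_congr fun u hu => ?_
  have e : l₁ ++ (u' ++ l₂) ++ (u ++ l₃) = l₁ ++ (u' ++ (l₂ ++ (u ++ l₃))) := by simp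
  rw [e, insOp_append M _ _ h₁ hu']
  by_cases hz : M.cre g' l₁ u' = 0
  · simp [hz]
  · rw [(M.far g' l₁ u' l₂ g hu' (.inl hz)).2]
    simp only [List.append_assoc]
    ring

theorem delOp_true_append {i : ℕ} (v : List M.A → K) {l₁ : List M.A} (l₂ : List M.A)
    (h₁ : l₁.length = i) :
    M.delOp true i v (l₁ ++ l₂) = ∑ a, ∑ b, M.ann true l₁ [a, b] * v (l₁ ++ a :: b :: l₂) :=
  delOp_append M v l₂ h₁

theorem delOp_false_append {i : ℕ} (v : List M.A → K) {l₁ : List M.A} (l₂ : List M.A)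
    (h₁ : l₁.length = i) :
    M.delOp false i v (l₁ ++ l₂) = ∑ a, M.ann false l₁ [a] * v (l₁ ++ a :: l₂) :=
  delOp_append M v l₂ h₁

theorem insOp_true_append {i : ℕ} (v : List M.A → K) {l₁ : List M.A} (a b : M.A) (l₂ : List M.A)
    (h₁ : l₁.length = i) :
    M.insOp true i v (l₁ ++ a :: b :: l₂) = M.cre true l₁ [a, b] * v (l₁ ++ l₂) :=
  insOp_append M v (u := [a, b]) l₂ h₁ rfl

theorem insOp_false_append {i : ℕ} (v : List M.A → K) {l₁ : List M.A} (a : M.A) (l₂ : List M.A)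
    (h₁ : l₁.length = i) :
    M.insOp false i v (l₁ ++ a :: l₂) = M.cre false l₁ [a] * v (l₁ ++ l₂) :=
  insOp_append M v (u := [a]) l₂ h₁ rfl

theorem exists_append_cons {A : Type*} {i : ℕ} {l : List A} (h : i + 1 ≤ l.length) :
    ∃ l₁ x l₂, l = l₁ ++ x :: l₂ ∧ l₁.length = i := by
  obtain ⟨l₁, l₂, rfl, h₁⟩ := exists_append (i := i) (l := l) (by omega)
  cases l₂ with
  | nil => simp at h; omega
  | cons x l₂ => exact ⟨l₁, x, l₂, rfl, h₁⟩

theorem delOp_insOp_loop {i : ℕ} (v : List M.A → K) {l : List M.A} (hl : M.ok l)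
    (hi : i ≤ l.length) : M.delOp true i (M.insOp true i v) l = loop i * v l := by
  obtain ⟨l₁, l₂, rfl, h₁⟩ := exists_append hi
  rw [delOp_true_append M _ _ h₁, ← h₁, ← M.ann_cre_cup l₁ l₂ hl]
  simp only [insOp_true_append M _ _ _ _ rfl, Finset.sum_mul]
  exact Finset.sum_congr rfl fun a _ => Finset.sum_congr rfl fun b _ => by ring

theorem delOp_insOp_dot {i : ℕ} (v : List M.A → K) {l : List M.A} (hl : M.ok l)
    (hi : i ≤ l.length) : M.delOp false i (M.insOp false i v) l = z * v l := by
  obtain ⟨l₁, l₂, rfl, h₁⟩ := exists_append hi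
  have h := congrArg (· * v (l₁ ++ l₂)) (M.ann_cre_dot l₁ l₂ hl)
  simp only [Finset.sum_mul] at h
  rw [delOp_false_append M _ _ h₁, ← h]
  simp only [insOp_false_append M _ _ _ h₁]
  exact Finset.sum_congr rfl fun a _ => by ring

theorem delOp_insOp_zig {i : ℕ} (v : List M.A → K) {l : List M.A} (hl : M.ok l)
    (hi : i + 1 ≤ l.length) : M.delOp true i (M.insOp true (i + 1) v) l = v l := by
  obtain ⟨l₁, x, l₂, rfl, h₁⟩ := exists_append_cons hi
  rw [delOp_true_append M _ _ h₁]
  have h : ∀ a, ∑ b, M.ann true l₁ [a, b] * M.insOp true (i + 1) v (l₁ ++ a :: b :: x :: l₂) =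
      if a = x then v (l₁ ++ a :: l₂) else 0 := by
    intro a
    have := M.zig l₁ x l₂ hl a
    rw [← one_mul (v (l₁ ++ a :: l₂)), ← zero_mul (v (l₁ ++ a :: l₂)), ← ite_mul, ← this,
      Finset.sum_mul]
    refine Finset.sum_congr rfl fun b _ => ?_
    have e : l₁ ++ a :: b :: x :: l₂ = (l₁ ++ [a]) ++ b :: x :: l₂ := by simp
    rw [e, insOp_true_append M _ _ _ _ (by simp [h₁])]
    simp only [List.append_assoc, List.singleton_append]
    ring
  simp [h]

theorem delOp_insOp_zag {i : ℕ} (v : List M.A → K) {l : List M.A} (hl : M.ok l)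
    (hi : i + 1 ≤ l.length) : M.delOp true (i + 1) (M.insOp true i v) l = v l := by
  obtain ⟨l₁, x, l₂, rfl, h₁⟩ := exists_append_cons hi
  have e : l₁ ++ x :: l₂ = (l₁ ++ [x]) ++ l₂ := by simp
  rw [e, delOp_true_append M _ _ (by simp [h₁]), Finset.sum_comm]
  have h : ∀ b, ∑ a, M.ann true (l₁ ++ [x]) [a, b] *
      M.insOp true i v (l₁ ++ [x] ++ a :: b :: l₂) =
      if b = x then v (l₁ ++ b :: l₂) else 0 := by
    intro b
    have := M.zag l₁ x l₂ hl b
    rw [← one_mul (v (l₁ ++ b :: l₂)), ← zero_mul (v (l₁ ++ b :: l₂)), ← ite_mul, ← this,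
      Finset.sum_mul]
    refine Finset.sum_congr rfl fun a _ => ?_
    have e : l₁ ++ [x] ++ a :: b :: l₂ = l₁ ++ x :: a :: b :: l₂ := by simp
    rw [e, insOp_true_append M _ _ _ _ h₁]
    ring
  rw [Finset.sum_congr rfl fun b _ => h b]
  simp

theorem delOp_cup_insOp_dot_left {i : ℕ} (v : List M.A → K) {l : List M.A}
    (hi : i ≤ l.length) : M.delOp true i (M.insOp false i v) l = M.delOp false i v l := by
  obtain ⟨l₁, l₂, rfl, h₁⟩ := exists_append hi
  rw [delOp_true_append M _ _ h₁, delOp_false_append M _ _ h₁, Finset.sum_comm]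
  refine Finset.sum_congr rfl fun b _ => ?_
  rw [← M.ann_cup_dot_left, Finset.sum_mul]
  refine Finset.sum_congr rfl fun a _ => ?_
  rw [insOp_false_append M _ _ _ h₁]
  ring

theorem delOp_cup_insOp_dot_right {i : ℕ} (v : List M.A → K) {l : List M.A}
    (hi : i ≤ l.length) : M.delOp true i (M.insOp false (i + 1) v) l = M.delOp false i v l := by
  obtain ⟨l₁, l₂, rfl, h₁⟩ := exists_append hi
  rw [delOp_true_append M _ _ h₁, delOp_false_append M _ _ h₁]
  refine Finset.sum_congr rfl fun a _ => ?_
  rw [← M.ann_cup_dot_right, Finset.sum_mul]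
  refine Finset.sum_congr rfl fun b _ => ?_
  have e : l₁ ++ a :: b :: l₂ = (l₁ ++ [a]) ++ b :: l₂ := by simp
  rw [e, insOp_false_append M _ _ _ (by simp [h₁])]
  simp only [List.append_assoc, List.singleton_append]
  ring

theorem delOp_dot_insOp_cup_left {i : ℕ} (v : List M.A → K) {l : List M.A}
    (hi : i + 1 ≤ l.length) : M.delOp false i (M.insOp true i v) l = M.insOp false i v l := by
  obtain ⟨l₁, x, l₂, rfl, h₁⟩ := exists_append_cons hi
  rw [delOp_false_append M _ _ h₁, insOp_false_append M _ _ _ h₁, ← M.ann_dot_cup_left,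
    Finset.sum_mul]
  refine Finset.sum_congr rfl fun a _ => ?_
  rw [insOp_true_append M _ _ _ _ h₁]
  ring

theorem delOp_dot_insOp_cup_right {i : ℕ} (v : List M.A → K) {l : List M.A}
    (hi : i + 1 ≤ l.length) :
    M.delOp false (i + 1) (M.insOp true i v) l = M.insOp false i v l := by
  obtain ⟨l₁, x, l₂, rfl, h₁⟩ := exists_append_cons hi
  have e : l₁ ++ x :: l₂ = (l₁ ++ [x]) ++ l₂ := by simp
  rw [insOp_false_append M _ _ _ h₁, e, delOp_false_append M _ _ (by simp [h₁]),
    ← M.ann_dot_cup_right, Finset.sum_mul]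
  refine Finset.sum_congr rfl fun b _ => ?_
  have e : l₁ ++ [x] ++ b :: l₂ = l₁ ++ x :: b :: l₂ := by simp
  rw [e, insOp_true_append M _ _ _ _ h₁]
  ring

/-- Insertion and removal are adjoint. -/
theorem form_insOp {g : Bool} {i m : ℕ} (hi : i ≤ m) (v v' : List M.A → K) :
    M.form (m + arity g) (M.insOp g i v) v' = M.form m v (M.delOp g i v') := by
  classical
  obtain ⟨j, rfl⟩ := Nat.exists_eq_add_of_le hi
  rw [show i + j + arity g = i + (arity g + j) by omega]
  simp only [form, sumLists_add]
  refine sumLists_congr fun l₁ h₁ => ?_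
  rw [sumLists_comm]
  refine sumLists_congr fun l₂ _ => ?_
  have e : ∀ (p : Prop) [Decidable p] (x y : K),
      (if p then x * y else 0) = (if p then x else 0) * y := fun p _ x y => by
    split_ifs <;> simp
  rw [delOp_append M _ _ h₁, e, ← sumLists_mul_left]
  refine sumLists_congr fun u hu => ?_
  rw [insOp_append M _ _ h₁ hu]
  have hadj := M.adj g l₁ u l₂ hu
  -- If this weight vanishes, both terms are zero whichever states are `ok`. Otherwise both
  -- coefficients are nonzero, and `ok` passes between the longer and the shorter state in both
  -- directions.
  by_cases hz : M.ann g l₁ u * M.wt (l₁ ++ l₂) = 0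
  · have h1 : M.wt (l₁ ++ (u ++ l₂)) * (M.cre g l₁ u * v (l₁ ++ l₂)) = 0 := by
      rw [← mul_assoc, hadj, hz, zero_mul]
    have h2 : M.wt (l₁ ++ l₂) * v (l₁ ++ l₂) * (M.ann g l₁ u * v' (l₁ ++ (u ++ l₂))) = 0 := by
      linear_combination (v (l₁ ++ l₂) * v' (l₁ ++ (u ++ l₂))) * hz
    rw [h1]
    split_ifs <;> simp [h2]
  · have ha : M.ann g l₁ u ≠ 0 := left_ne_zero_of_mul hz
    have hc : M.cre g l₁ u ≠ 0 := right_ne_zero_of_mul (hadj ▸ hz)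
    by_cases hok : M.ok (l₁ ++ l₂)
    · rw [if_pos hok, if_pos (M.ok_ann g l₁ u l₂ hu hok ha)]
      linear_combination (v (l₁ ++ l₂) * v' (l₁ ++ (u ++ l₂))) * hadj
    · rw [if_neg hok, if_neg fun h => hok (M.ok_cre g l₁ u l₂ hu h hc), zero_mul]

theorem form_congr_right {m : ℕ} {v v₁ v₂ : List M.A → K}
    (h : ∀ l, M.ok l → l.length = m → v₁ l = v₂ l) : M.form m v v₁ = M.form m v v₂ := by
  refine sumLists_congr fun l hl => ?_
  split_ifs with hok
  · rw [h l hok hl]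
  · rfl

theorem form_congr_left {m : ℕ} {v v₁ v₂ : List M.A → K}
    (h : ∀ l, M.ok l → l.length = m → v₁ l = v₂ l) : M.form m v₁ v = M.form m v₂ v := by
  refine sumLists_congr fun l hl => ?_
  split_ifs with hok
  · rw [h l hok hl]
  · rfl

theorem form_mul_right {m : ℕ} (c : K) (v v' : List M.A → K) :
    M.form m v (fun l => c * v' l) = c * M.form m v v' := by
  classical
  simp only [form, ← sumLists_mul_left]
  exact sumLists_congr fun l _ => by split_ifs <;> ring

end TLModel

/-! ### Independence of Gram entries from the model. -/

section universality

variable {K : Type} [Field K] {loop : ℕ → K} {z : K}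

/-- A removal takes words to multiples of words, by a rule common to all models. -/
theorem exists_delOp_eval {m : ℕ} (w : CupWord m) :
    ∀ (g : Bool) (i m' : ℕ), m = m' + arity g → i ≤ m' → ∃ (c : K) (w' : CupWord m'),
      ∀ (M : TLModel K loop z) (l : List M.A), M.ok l → l.length = m' →
        M.delOp g i (M.eval w) l = c * M.eval w' l := by
  -- The scalar and the shorter word are fixed before the model is given. The removal is moved past
  -- the last insertion: at disjoint places the two commute and induction applies, at overlapping
  -- places a defining relation evaluates them.
  induction w with
  | nil =>
    intro g i m' h
    cases g <;> simp [arity] at h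
  | @ins m₁ g' j hj w ih =>
    intro g i m' hm hi
    by_cases hleft : i + arity g ≤ j
    · obtain ⟨j', rfl⟩ := Nat.exists_eq_add_of_le' hleft
      obtain ⟨m₂, rfl⟩ : ∃ m₂, m₁ = m₂ + arity g := ⟨m₁ - arity g, by omega⟩
      obtain rfl : m' = m₂ + arity g' := by omega
      obtain ⟨c, w', hw⟩ := ih g i m₂ rfl (by omega)
      refine ⟨c, .ins g' (j' + i) (by omega) w', fun M l hl hlen => ?_⟩
      rw [M.eval_ins, ← add_assoc, M.delOp_insOp_of_left (by omega) _ (by omega), M.eval_ins,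
        ← M.insOp_mul]
      exact M.insOp_congr (by omega) (fun l h h' => hw M l h h') hl hlen
    by_cases hright : j + arity g' ≤ i
    · obtain ⟨i', rfl⟩ := Nat.exists_eq_add_of_le' hright
      obtain ⟨m₂, rfl⟩ : ∃ m₂, m₁ = m₂ + arity g := ⟨m₁ - arity g, by omega⟩
      obtain rfl : m' = m₂ + arity g' := by omega
      obtain ⟨c, w', hw⟩ := ih g (i' + j) m₂ rfl (by omega)
      refine ⟨c, .ins g' j (by omega) w', fun M l hl hlen => ?_⟩
      rw [M.eval_ins, ← add_assoc, M.delOp_insOp_of_right (by omega) _ (by omega),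
        M.eval_ins, ← M.insOp_mul]
      exact M.insOp_congr (by omega) (fun l h h' => hw M l h h') hl hlen
    -- The places overlap. In order: dot on dot gives `z`; removing a dot from a cup leaves a dot; a
    -- cap on a dot becomes the removal of a dot, the only case that needs induction again; a cap on
    -- a cup is a loop or a straight strand.
    cases g <;> cases g' <;> simp only [arity] at hm hleft hright ih
    · obtain rfl : i = j := by omega
      obtain rfl : m' = m₁ := by omega
      exact ⟨z, w, fun M l hl hlen => M.delOp_insOp_dot _ hl (by omega)⟩
    · obtain rfl : m' = m₁ + 1 := by omega
      refine ⟨1, .ins false j hj w, fun M l hl hlen => ?_⟩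
      rw [one_mul, M.eval_ins]
      change _ = M.insOp false j (M.eval w) l
      obtain rfl | rfl : i = j ∨ i = j + 1 := by omega
      · exact M.delOp_dot_insOp_cup_left _ (by omega)
      · exact M.delOp_dot_insOp_cup_right _ (by omega)
    · obtain rfl : m₁ = m' + 1 := by omega
      obtain ⟨c, w', hw⟩ := ih false i m' rfl hi
      refine ⟨c, w', fun M l hl hlen => ?_⟩
      rw [← hw M l hl hlen, M.eval_ins]
      obtain rfl | rfl : j = i ∨ j = i + 1 := by omega
      · exact M.delOp_cup_insOp_dot_left _ (by omega)
      · exact M.delOp_cup_insOp_dot_right _ (by omega)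
    · obtain rfl : m' = m₁ := by omega
      by_cases hij : i = j
      · subst hij
        exact ⟨loop i, w, fun M l hl hlen => M.delOp_insOp_loop _ hl (by omega)⟩
      · refine ⟨1, w, fun M l hl hlen => ?_⟩
        rw [one_mul, M.eval_ins]
        obtain rfl | rfl : j = i + 1 ∨ i = j + 1 := by omega
        · exact M.delOp_insOp_zig _ hl (by omega)
        · exact M.delOp_insOp_zag _ hl (by omega)

/-- The Gram matrix of the words is the same in all models. -/
theorem exists_form_eval {m : ℕ} (w w' : CupWord m) :
    ∃ c : K, ∀ M : TLModel K loop z, M.form m (M.eval w) (M.eval w') = c := by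
  induction w with
  | nil =>
    refine ⟨1, fun M => ?_⟩
    have h : M.eval w' [] = 1 := by
      -- A word creating no points is empty, since every insertion has positive arity.
      generalize hm : 0 = m at w'
      cases w' with
      | nil => rfl
      | ins g => cases g <;> simp [arity] at hm
    simp [TLModel.form, sumLists, M.ok_nil, M.wt_nil, h, TLModel.eval]
  -- By adjointness the last insertion on the left becomes a removal on the right, and the left word
  -- gets shorter.
  | @ins m₁ g i hi w ih =>
    obtain ⟨c, w₂, hw⟩ := exists_delOp_eval (loop := loop) (z := z) w' g i m₁ rfl hi
    obtain ⟨c', hc⟩ := ih w₂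
    refine ⟨c * c', fun M => ?_⟩
    rw [M.eval_ins, M.form_insOp hi, M.form_congr_right (hw M), M.form_mul_right, hc]

end universality

/-! ### Lattice paths -/

/-- Steps of a lattice path. -/
inductive Step
  | up | down | flat
  deriving DecidableEq

open Step

instance : Fintype Step where
  elems := {up, down, flat}
  complete x := by cases x <;> simp

theorem Step.sum_univ {K : Type*} [AddCommMonoid K] (f : Step → K) :
    ∑ a, f a = f up + (f down + f flat) := by
  have : (Finset.univ : Finset Step) = {up, down, flat} := rfl
  rw [this, Finset.sum_insert (by simp), Finset.sum_insert (by simp), Finset.sum_singleton]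

/-- The final height of a path that starts at height `h`. -/
def level : ℕ → List Step → ℕ
  | h, [] => h
  | h, up :: l => level (h + 1) l
  | h, down :: l => level (h - 1) l
  | h, flat :: l => level h l

/-- The path from height `h` ends at height zero and never goes below; flat steps are allowed if
`fl` holds. -/
def IsPath (fl : Bool) : ℕ → List Step → Prop
  | h, [] => h = 0
  | h, up :: l => IsPath fl (h + 1) l
  | h, down :: l => 0 < h ∧ IsPath fl (h - 1) l
  | h, flat :: l => fl = true ∧ IsPath fl h l

/-- The product of `ρ k` over all up-steps from height `k`, times `w` for each flat step. -/
def pathWeight {K : Type*} [CommMonoid K] (ρ : ℕ → K) (w : K) : ℕ → List Step → K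
  | _, [] => 1
  | h, up :: l => ρ h * pathWeight ρ w (h + 1) l
  | h, down :: l => pathWeight ρ w (h - 1) l
  | h, flat :: l => w * pathWeight ρ w h l

theorem level_append (h : ℕ) (l₁ l₂ : List Step) :
    level h (l₁ ++ l₂) = level (level h l₁) l₂ := by
  induction l₁ generalizing h with
  | nil => rfl
  | cons a l ih => cases a <;> exact ih _

theorem IsPath.of_append {fl : Bool} {h : ℕ} {l₁ l₂ : List Step} (hp : IsPath fl h (l₁ ++ l₂)) :
    IsPath fl (level h l₁) l₂ := by
  induction l₁ generalizing h with
  | nil => exact hp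
  | cons a l ih =>
    cases a
    · exact ih (h := h + 1) hp
    · exact ih (h := h - 1) hp.2
    · exact ih (h := h) hp.2

theorem IsPath.append {fl : Bool} {h : ℕ} {l₁ l₂ l₃ : List Step} (hp : IsPath fl h (l₁ ++ l₂))
    (h₃ : IsPath fl (level h l₁) l₃) : IsPath fl h (l₁ ++ l₃) := by
  induction l₁ generalizing h with
  | nil => exact h₃
  | cons a l ih =>
    cases a
    · exact ih (h := h + 1) hp h₃
    · exact ⟨hp.1, ih (h := h - 1) hp.2 h₃⟩
    · exact ⟨hp.1, ih (h := h) hp.2 h₃⟩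

/-- Successive heights determine the steps. Truncated subtraction could confuse a down-step at
height zero with a flat step, but a path has no such down-step. -/
theorem IsPath.eq_of_level {fl : Bool} {h : ℕ} {p q : List Step} (hp : IsPath fl h p)
    (hq : IsPath fl h q) (hl : p.length = q.length)
    (hh : ∀ j, level h (p.take j) = level h (q.take j)) : p = q := by
  induction p generalizing h q with
  | nil => exact (List.length_eq_zero_iff.mp hl.symm).symm
  | cons a p ih =>
    obtain _ | ⟨b, q⟩ := q
    · simp at hl
    have h1 := hh 1
    have h2 := fun j => hh (j + 1)
    simp only [List.length_cons, add_left_inj] at hl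
    cases a <;> cases b <;> simp only [List.take_succ_cons, List.take_zero, level] at h1 h2
    · exact congrArg _ (ih hp hq hl h2)
    · omega
    · omega
    · omega
    · exact congrArg _ (ih hp.2 hq.2 hl h2)
    · have := hp.1
      omega
    · omega
    · have := hq.1
      omega
    · exact congrArg _ (ih hp.2 hq.2 hl h2)

/-! ### Lattice paths as an orthogonal basis. -/

section pathModel

variable {K : Type} [Field K]

theorem pathWeight_append (ρ : ℕ → K) (w : K) (h : ℕ) (l₁ l₂ : List Step) :
    pathWeight ρ w h (l₁ ++ l₂) =
      pathWeight ρ w h l₁ * pathWeight ρ w (level h l₁) l₂ := by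
  induction l₁ generalizing h with
  | nil => simp [pathWeight, level]
  | cons a l ih => cases a <;> simp [pathWeight, level, ih, mul_assoc]

/-- Coefficients of the insertions into paths, at height `h`. -/
def pathCre (fl : Bool) (ρ : ℕ → K) (w : K) : ℕ → Bool → List Step → K
  | _, true, [up, down] => 1
  -- At height zero a valley would leave the half-plane; there the coefficient is the default 0.
  | h + 1, true, [down, up] => (ρ h)⁻¹
  -- A flat step stands for the line spanned by the dot, of squared norm `w`; the cup contains the
  -- square of that vector divided by its norm.
  | _, true, [flat, flat] => if fl = true then w⁻¹ else 0
  | _, false, [flat] => if fl = true then 1 else 0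
  | _, _, _ => 0

/-- Coefficients of the removals from paths, at height `h`. -/
def pathAnn (fl : Bool) (ρ : ℕ → K) (w : K) : ℕ → Bool → List Step → K
  | h, true, [up, down] => ρ h
  | _ + 1, true, [down, up] => 1
  | _, true, [flat, flat] => if fl = true then w else 0
  | _, false, [flat] => if fl = true then w else 0
  | _, _, _ => 0

/-- Blocks that actually occur return to their starting height, so no height or coefficient to the
right changes: this is the source of `far`. -/
theorem level_of_pathCre {fl : Bool} {ρ : ℕ → K} {w : K} {h : ℕ} {g : Bool} {u : List Step}
    (hu : u.length = arity g) (hz : pathCre fl ρ w h g u ≠ 0 ∨ pathAnn fl ρ w h g u ≠ 0) :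
    level h u = h := by
  cases g
  · obtain ⟨a, rfl⟩ := List.length_eq_one_iff.mp hu
    cases a <;> cases h <;> simp_all [pathCre, pathAnn, level]
  · obtain ⟨a, b, rfl⟩ := List.length_eq_two.mp hu
    cases a <;> cases b <;> cases h <;> simp_all [pathCre, pathAnn, level]

theorem IsPath.insert {fl : Bool} {ρ : ℕ → K} {w : K} {h : ℕ} {g : Bool} {u l : List Step}
    (hu : u.length = arity g) (hz : pathCre fl ρ w h g u ≠ 0 ∨ pathAnn fl ρ w h g u ≠ 0)
    (hl : IsPath fl h l) : IsPath fl h (u ++ l) := by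
  cases g
  · obtain ⟨a, rfl⟩ := List.length_eq_one_iff.mp hu
    clear hu
    cases fl <;> cases a <;> cases h <;> simp_all [pathCre, pathAnn, IsPath]
  · obtain ⟨a, b, rfl⟩ := List.length_eq_two.mp hu
    clear hu
    cases fl <;> cases a <;> cases b <;> cases h <;> simp_all [pathCre, pathAnn, IsPath]

/-- Loop values are indexed by position, path coefficients by height. Without flat steps the two
have the same parity and `loop` has period 2; with flat steps parity is lost, so `loop` has to be
constant. -/
theorem loop_level {α : Type*} {loop : ℕ → α} {fl : Bool} (hper : fl = false → ∀ i, loop (i + 2) = loop i)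
    (hconst : fl = true → ∀ i, loop i = loop 0) {h : ℕ} {l₁ l₂ : List Step}
    (hp : IsPath fl h (l₁ ++ l₂)) : loop (level h l₁) = loop (h + l₁.length) := by
  cases fl
  · induction l₁ generalizing h with
    | nil => rfl
    | cons a l ih =>
      cases a
      · rw [level, ih (h := h + 1) hp, List.length_cons]
        congr 1; omega
      · obtain ⟨h, rfl⟩ := Nat.exists_eq_succ_of_ne_zero hp.1.ne'
        have := ih (h := h) hp.2
        refine (this.trans (hper rfl _).symm).trans (congrArg loop ?_)
        simp; omega
      · exact absurd hp.1 (by simp)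
  · rw [hconst rfl, hconst rfl (h + _)]

/-- The model whose states are lattice paths. The squared norm of a path is its weight. -/
def pathModel (fl : Bool) (ρ : ℕ → K) (w : K) (loop : ℕ → K) (z : K)
    (hρ : ∀ h, ρ h ≠ 0) (hw : w ≠ 0) (h0 : ρ 0 + (if fl = true then 1 else 0) = loop 0)
    (hloop : ∀ h, ρ (h + 1) + (ρ h)⁻¹ + (if fl = true then 1 else 0) = loop (h + 1))
    (hper : fl = false → ∀ i, loop (i + 2) = loop i)
    (hconst : fl = true → ∀ i, loop i = loop 0)
    (hz : z = if fl = true then w else 0) : TLModel K loop z where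
  A := Step
  ok := IsPath fl 0
  cre g l u := pathCre fl ρ w (level 0 l) g u
  ann g l u := pathAnn fl ρ w (level 0 l) g u
  wt := pathWeight ρ w 0
  ok_nil := rfl
  wt_nil := rfl
  adj g l₁ u l₂ hu := by
    simp only [pathWeight_append]
    generalize level 0 l₁ = h
    cases g
    · obtain ⟨a, rfl⟩ := List.length_eq_one_iff.mp hu
      cases a <;> cases h <;> cases fl <;> simp [pathCre, pathAnn, pathWeight, level] <;> ring
    · obtain ⟨a, b, rfl⟩ := List.length_eq_two.mp hu
      cases a <;> cases b <;> cases h <;> cases fl <;>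
        simp [pathCre, pathAnn, pathWeight, level] <;> field_simp [hρ, hw]
  ok_cre g l₁ u l₂ hu hl hne := by
    refine hl.append ?_
    have h := hl.of_append.of_append
    rwa [level_of_pathCre hu (.inl hne)] at h
  ok_ann g l₁ u l₂ hu hl hne := hl.append (hl.of_append.insert hu (.inr hne))
  far g l₁ u l₂ g' hu hne := by
    have h : level 0 (l₁ ++ (u ++ l₂)) = level 0 (l₁ ++ l₂) := by
      rw [level_append, level_append, level_of_pathCre hu hne, level_append]
    simp only [h, and_self]
  ann_cre_cup l₁ l₂ hl := by
    have := loop_level hper hconst hl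
    rw [zero_add] at this
    rw [← this]
    generalize level 0 l₁ = h
    simp only [Step.sum_univ]
    -- The peak contributes `ρ` at the current height, the valley the inverse of `ρ` one level
    -- below, the flat pair 1. At height zero there is no valley.
    cases h
    · rw [← h0]
      cases fl <;> simp [pathCre, pathAnn, hw]
    · rw [← hloop]
      cases fl <;> simp [pathCre, pathAnn, hw, add_assoc]
  ann_cre_dot l₁ l₂ hl := by
    subst hz
    simp only [Step.sum_univ]
    cases fl <;> simp [pathCre, pathAnn]
  zig l₁ x l₂ hl a := by
    -- That the state is a path excludes a down-step from height zero and forbidden flat steps, for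
    -- which the strand relation fails.
    have hx := hl.of_append
    simp only [Step.sum_univ, level_append]
    clear h0 hloop hper hconst hz
    generalize level 0 l₁ = h at hx ⊢
    cases h <;> cases a <;> cases x <;> cases fl <;>
      simp_all [pathCre, pathAnn, IsPath, level]
  zag l₁ x l₂ hl b := by
    have hx := hl.of_append
    simp only [Step.sum_univ, level_append]
    clear h0 hloop hper hconst hz
    generalize level 0 l₁ = h at hx ⊢
    cases h <;> cases b <;> cases x <;> cases fl <;>
      simp_all [pathCre, pathAnn, IsPath, level]
  ann_cup_dot_left l₁ b := by
    simp only [Step.sum_univ]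
    generalize level 0 l₁ = h
    cases h <;> cases b <;> cases fl <;> simp [pathCre, pathAnn]
  ann_cup_dot_right l₁ b := by
    simp only [Step.sum_univ, level_append]
    generalize level 0 l₁ = h
    cases h <;> cases b <;> cases fl <;> simp [pathCre, pathAnn]
  ann_dot_cup_left l₁ b := by
    simp only [Step.sum_univ]
    generalize level 0 l₁ = h
    cases h <;> cases b <;> cases fl <;> simp [pathCre, pathAnn, hw]
  ann_dot_cup_right l₁ b := by
    simp only [Step.sum_univ, level_append]
    generalize level 0 l₁ = h
    cases h <;> cases b <;> cases fl <;> simp [pathCre, pathAnn, hw]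

/-! ### Words and paths are related by a unitriangular matrix -/

/-- The vector `v` is the path `p`, plus a combination of lower paths. -/
structure IsLeading (fl : Bool) (v : List Step → K) (p : List Step) : Prop where
  isPath : IsPath fl 0 p
  apply_self : v p = 1
  level_le : ∀ q, IsPath fl 0 q → q.length = p.length → v q ≠ 0 →
    ∀ j, level 0 (q.take j) ≤ level 0 (p.take j)

variable {fl : Bool} {ρ : ℕ → K} {w : K} {loop : ℕ → K} {z : K}

/-- All blocks with nonzero coefficient return to their starting height, and `c` is pointwise the
highest of them. So the comparison of heights survives the insertion, whether a prefix ends before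
the block, inside it or after it. -/
theorem IsLeading.ins {v v' : List Step → K} {p₁ p₂ : List Step} (g : Bool) (c : List Step)
    (hv : IsLeading fl v (p₁ ++ p₂)) (hc : c.length = arity g)
    (hc1 : ∀ h, pathCre fl ρ w h g c = 1)
    (hmax : ∀ h h' u, u.length = arity g → pathCre fl ρ w h' g u ≠ 0 → h' ≤ h →
      ∀ j, level h' (u.take j) ≤ level h (c.take j))
    (hv' : ∀ q₁ u q₂, q₁.length = p₁.length → u.length = arity g →
      v' (q₁ ++ (u ++ q₂)) = pathCre fl ρ w (level 0 q₁) g u * v (q₁ ++ q₂)) :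
    IsLeading fl v' (p₁ ++ (c ++ p₂)) := by
  have hlc : ∀ h, level h c = h := fun h => level_of_pathCre hc (.inl (by rw [hc1 h]; exact one_ne_zero))
  refine ⟨?_, ?_, ?_⟩
  · exact hv.isPath.append (hv.isPath.of_append.insert hc (.inl (by rw [hc1]; exact one_ne_zero)))
  · rw [hv' _ _ _ rfl hc, hc1, hv.apply_self, one_mul]
  · intro q hq hlen hne j
    simp only [List.length_append] at hlen
    obtain ⟨q₁, q₂, rfl, h₁⟩ := TLModel.exists_append (i := p₁.length) (l := q) (by omega)
    obtain ⟨u, q₂, rfl, hu⟩ := TLModel.exists_append (i := arity g) (l := q₂)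
      (by simp at hlen; omega)
    rw [hv' _ _ _ h₁ hu] at hne
    have hcre := left_ne_zero_of_mul hne
    have hlu := level_of_pathCre hu (.inl hcre)
    have hok : IsPath fl 0 (q₁ ++ q₂) :=
      hq.append (by have := hq.of_append.of_append; rwa [hlu] at this)
    have H := hv.level_le _ hok (by simp at hlen ⊢; omega) (right_ne_zero_of_mul hne)
    have H1 : level 0 q₁ ≤ level 0 p₁ := by
      have := H p₁.length
      rw [List.take_left] at this
      rwa [← h₁, List.take_left] at this
    have e : ∀ (l₁ l₂ l₃ : List Step) (j : ℕ), l₁.length = p₁.length → l₂.length = arity g →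
        (l₁ ++ (l₂ ++ l₃)).take j =
          l₁.take j ++ (l₂.take (j - p₁.length) ++ l₃.take (j - p₁.length - arity g)) := by
      intro l₁ l₂ l₃ j h h'
      rw [List.take_append, List.take_append, h, h']
    have e' : ∀ (l₁ l₃ : List Step) (j : ℕ), l₁.length = p₁.length →
        (l₁ ++ l₃).take j = l₁.take j ++ l₃.take (j - p₁.length) := by
      intro l₁ l₂ j h
      rw [List.take_append, h]
    rw [e _ _ _ _ h₁ hu, e _ _ _ _ rfl hc]
    by_cases hj : j ≤ p₁.length
    · have := H j
      rw [e' _ _ _ h₁, e' _ _ _ rfl] at this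
      simpa [Nat.sub_eq_zero_of_le hj] using this
    · rw [List.take_of_length_le (l := q₁) (by omega), List.take_of_length_le (l := p₁) (by omega)]
      by_cases hj' : j ≤ p₁.length + arity g
      · rw [Nat.sub_eq_zero_of_le (show j - p₁.length ≤ arity g by omega), List.take_zero,
          List.take_zero, List.append_nil, List.append_nil, level_append, level_append]
        exact hmax _ _ _ hu hcre H1 _
      · have := H (j - arity g)
        rw [e' _ _ _ h₁, e' _ _ _ rfl, List.take_of_length_le (l := q₁) (by omega),
          List.take_of_length_le (l := p₁) (by omega), level_append, level_append,
          show j - arity g - p₁.length = j - p₁.length - arity g by omega] at this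
        rwa [List.take_of_length_le (l := u) (by omega),
          List.take_of_length_le (l := c) (by omega), level_append, level_append, hlu,
          level_append, level_append, hlc]

/-- A block of two steps rises at most one level before coming back, and the peak attains this. -/
theorem IsLeading.cup {v v' : List Step → K} {p₁ p₂ : List Step}
    (hv : IsLeading fl v (p₁ ++ p₂))
    (hv' : ∀ q₁ u q₂, q₁.length = p₁.length → u.length = arity true →
      v' (q₁ ++ (u ++ q₂)) = pathCre fl ρ w (level 0 q₁) true u * v (q₁ ++ q₂)) :
    IsLeading fl v' (p₁ ++ up :: down :: p₂) := by
  refine hv.ins true [up, down] rfl (fun h => by simp [pathCre]) ?_ hv'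
  intro h h' u hu hne hh j
  have := level_of_pathCre hu (.inl hne)
  obtain ⟨a, b, rfl⟩ := List.length_eq_two.mp hu
  match j with
  | 0 => simpa [level] using hh
  | 1 => cases a <;> simp [level] <;> omega
  | j + 2 => simpa [this, level] using hh

theorem IsLeading.dot {v v' : List Step → K} {p₁ p₂ : List Step}
    (hv : IsLeading true v (p₁ ++ p₂))
    (hv' : ∀ q₁ u q₂, q₁.length = p₁.length → u.length = arity false →
      v' (q₁ ++ (u ++ q₂)) = pathCre true ρ w (level 0 q₁) false u * v (q₁ ++ q₂)) :
    IsLeading true v' (p₁ ++ flat :: p₂) := by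
  refine hv.ins false [flat] rfl (fun h => by simp [pathCre]) ?_ hv'
  intro h h' u hu hne hh j
  have := level_of_pathCre hu (.inl hne)
  obtain ⟨a, rfl⟩ := List.length_eq_one_iff.mp hu
  match j with
  | 0 => simpa [level] using hh
  | j + 1 => simpa [this, level] using hh

end pathModel

/-- Summation over a set of labels of all the paths of length `m` from a given height. -/
theorem sumLists_isPath {K : Type*} [AddCommMonoid K] {fl : Bool} {h₀ : ℕ} {ι : Type*} [Fintype ι] {m : ℕ}
    {code : ι → List Step} (hinj : Function.Injective code)
    (hlen : ∀ i, (code i).length = m)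
    (hsurj : ∀ p, IsPath fl h₀ p → p.length = m → ∃ i, code i = p) (F : List Step → K)
    (hF : ∀ l, ¬ IsPath fl h₀ l → F l = 0) :
    sumLists m F = ∑ i, F (code i) := by
  rw [sumLists_eq_sum]
  have hof : ∀ i, List.ofFn (fun k : Fin m => (code i)[(k : ℕ)]'(by rw [hlen]; exact k.2)) =
      code i := fun i => List.ext_getElem (by simp [hlen]) (by simp)
  refine (Fintype.sum_of_injective
    (fun i (k : Fin m) => (code i)[(k : ℕ)]'(by rw [hlen]; exact k.2)) ?_ _ _ ?_ ?_).symm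
  · intro i j h
    apply hinj
    rw [← hof i, ← hof j]
    exact congrArg List.ofFn h
  · intro f hf
    apply hF
    intro hp
    obtain ⟨i, hi⟩ := hsurj _ hp (by simp)
    refine hf ⟨i, ?_⟩
    apply List.ofFn_injective
    exact (hof i).trans hi
  · intro i
    rw [hof]

/-- The Gram determinant of vectors which form a unitriangular matrix with respect to the paths. -/
theorem det_of_isLeading {K : Type} [Field K] {fl : Bool} {ι : Type*} [Fintype ι] [DecidableEq ι]
    {m : ℕ} {code : ι → List Step} (hinj : Function.Injective code)
    (hlen : ∀ i, (code i).length = m)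
    (wt : List Step → K) (v : ι → List Step → K) (hv : ∀ i, IsLeading fl (v i) (code i))
    (G : Matrix ι ι K)
    (hG : ∀ i j, G i j = ∑ k, wt (code k) * v i (code k) * v j (code k)) :
    G.det = ∏ i, wt (code i) := by
  -- Paths are orthogonal with squared norms `wt`, so the Gram matrix is a diagonal matrix between
  -- the coefficient matrix and its transpose.
  have hfac : G = Matrix.of (fun i k => v i (code k)) * Matrix.diagonal (fun k => wt (code k)) *
      (Matrix.of fun i k => v i (code k)).transpose := by
    ext i j
    rw [Matrix.mul_apply, hG]
    refine Finset.sum_congr rfl fun k _ => ?_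
    rw [Matrix.mul_diagonal, Matrix.transpose_apply, Matrix.of_apply, Matrix.of_apply]
    ring
  have htri : (Matrix.of fun i k => v i (code k)).det = 1 := by
    -- The area under the path refines the pointwise order: nonzero coefficients sit on paths of at
    -- most the same area, and equality of area forces equality of all heights.
    let area : ι → ℕ := fun i => ∑ j ∈ Finset.range (m + 1), level 0 ((code i).take j)
    have hle : ∀ i k, v i (code k) ≠ 0 → area k ≤ area i := fun i k h =>
      Finset.sum_le_sum fun j _ =>
        (hv i).level_le _ (hv k).isPath (by rw [hlen, hlen]) h j
    have heq : ∀ i k, v i (code k) ≠ 0 → area k = area i → i = k := by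
      intro i k h ha
      apply hinj
      refine ((hv k).isPath.eq_of_level (hv i).isPath (by rw [hlen, hlen]) fun j => ?_).symm
      have hj := (Finset.sum_eq_sum_iff_of_le fun j _ =>
        (hv i).level_le _ (hv k).isPath (by rw [hlen, hlen]) h j).mp ha
      -- Prefixes longer than `m` are the whole path, so the comparison at `m` covers them.
      by_cases hjm : j < m + 1
      · exact hj j (Finset.mem_range.mpr hjm)
      · have := hj m (Finset.mem_range.mpr (by omega))
        rw [List.take_of_length_le (by rw [hlen]), List.take_of_length_le (by rw [hlen])] at this
        rwa [List.take_of_length_le (by rw [hlen]; omega),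
          List.take_of_length_le (by rw [hlen]; omega)]
    have hblock : (Matrix.of fun i k => v i (code k)).transpose.BlockTriangular area := by
      intro k i hki
      by_contra h
      exact absurd (hle i k h) (by omega)
    rw [← Matrix.det_transpose, hblock.det]
    refine Finset.prod_eq_one fun a _ => ?_
    have : (Matrix.of fun i k => v i (code k)).transpose.toSquareBlock area a = 1 := by
      ext ⟨k, hk⟩ ⟨i, hi⟩
      simp only [Matrix.toSquareBlock_def, Matrix.of_apply, Matrix.transpose_apply,
        Matrix.one_apply, Subtype.mk.injEq]
      split_ifs with h
      · rw [h]
        exact (hv i).apply_self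
      · by_contra h'
        exact h (heq i k h' (hk.trans hi.symm)).symm
    rw [this, Matrix.det_one]
  rw [hfac, Matrix.det_mul, Matrix.det_mul, Matrix.det_transpose, htri, Matrix.det_diagonal]
  simp

open Step

/-! ### Families of objects coded by paths -/

/-- The initial run of up-steps must stop, since the last step is not up; the next step is flat or
completes a peak. -/
theorem exists_factor_of_up (l : List Step) (h : ∀ l', up :: l ≠ l' ++ [up]) :
    (∃ l₁ l₂, up :: l = l₁ ++ flat :: l₂) ∨ ∃ l₁ l₂, up :: l = l₁ ++ up :: down :: l₂ := by
  induction l with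
  | nil => exact absurd rfl (h [])
  | cons a l ih =>
    cases a
    · rcases ih fun l' hl' => h (up :: l') (by rw [hl']; rfl) with ⟨l₁, l₂, e⟩ | ⟨l₁, l₂, e⟩
      · exact .inl ⟨up :: l₁, l₂, by rw [e]; rfl⟩
      · exact .inr ⟨up :: l₁, l₂, by rw [e]; rfl⟩
    · exact .inr ⟨[], l, rfl⟩
    · exact .inl ⟨[up], l, rfl⟩

/-- Nonnegativity of the heights is not needed. This allows codes to be dismantled before they are
known to be paths. -/
theorem exists_factor {p : List Step} (h0 : p ≠ []) (h1 : ∀ l, p ≠ down :: l)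
    (h2 : ∀ l, p ≠ l ++ [up]) :
    (∃ l₁ l₂, p = l₁ ++ flat :: l₂) ∨ ∃ l₁ l₂, p = l₁ ++ up :: down :: l₂ := by
  obtain _ | ⟨a, l⟩ := p
  · exact absurd rfl h0
  cases a
  · exact exists_factor_of_up l h2
  · exact absurd rfl (h1 l)
  · exact .inl ⟨[], l, rfl⟩

theorem isPath_cup {fl : Bool} {l₁ l₂ : List Step} :
    IsPath fl 0 (l₁ ++ up :: down :: l₂) ↔ IsPath fl 0 (l₁ ++ l₂) :=
  ⟨fun h => h.append h.of_append.2, fun h => h.append ⟨Nat.succ_pos _, h.of_append⟩⟩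

theorem isPath_dot {fl : Bool} {l₁ l₂ : List Step} :
    IsPath fl 0 (l₁ ++ flat :: l₂) ↔ fl = true ∧ IsPath fl 0 (l₁ ++ l₂) :=
  ⟨fun h => ⟨h.of_append.1, h.append h.of_append.2⟩, fun h => h.2.append ⟨h.1, h.2.of_append⟩⟩

theorem IsLeading.congr {K : Type} [Field K] {fl : Bool} {v : List Step → K} {p q : List Step}
    (h : IsLeading fl v p) (hpq : p = q) : IsLeading fl v q := hpq ▸ h

/-- Objects coded by lists of steps, in which cups and dots can be inserted, and removed where the
code has a peak or a flat step. -/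
structure CodedFamily (fl : Bool) (X : Type*) where
  code : X → List Step
  ins : Bool → ℕ → X → X
  empty : X
  code_empty : code empty = []
  eq_empty : ∀ x, code x = [] → x = empty
  -- Together with `exists_factor`, this and the next condition give every nonempty code a peak or a
  -- flat step; that codes are paths is then a consequence.
  code_ne_down : ∀ x l, code x ≠ down :: l
  code_ne_up : ∀ x l, code x ≠ l ++ [up]
  code_cup : ∀ x l₁ l₂, code x = l₁ ++ l₂ →
    code (ins true l₁.length x) = l₁ ++ up :: down :: l₂
  exists_cup : ∀ y l₁ l₂, code y = l₁ ++ up :: down :: l₂ →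
    ∃ x, y = ins true l₁.length x ∧ code x = l₁ ++ l₂
  code_dot : fl = true → ∀ x l₁ l₂, code x = l₁ ++ l₂ →
    code (ins false l₁.length x) = l₁ ++ flat :: l₂
  exists_dot : ∀ y l₁ l₂, code y = l₁ ++ flat :: l₂ → fl = true ∧
    ∃ x, y = ins false l₁.length x ∧ code x = l₁ ++ l₂

namespace CodedFamily

variable {fl : Bool} {X : Type*} (F : CodedFamily fl X)

/-- Induction along the peaks and flat steps of the code. -/
theorem induction {motive : X → Prop} (empty : motive F.empty)
    (cup : ∀ x l₁ l₂, F.code x = l₁ ++ l₂ → motive x → motive (F.ins true l₁.length x))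
    (dot : fl = true → ∀ x l₁ l₂, F.code x = l₁ ++ l₂ → motive x →
      motive (F.ins false l₁.length x)) (x : X) : motive x := by
  induction hn : (F.code x).length using Nat.strong_induction_on generalizing x with
  | _ n ih =>
    subst hn
    by_cases h0 : F.code x = []
    · exact F.eq_empty x h0 ▸ empty
    rcases exists_factor h0 (F.code_ne_down x) (F.code_ne_up x) with ⟨l₁, l₂, e⟩ | ⟨l₁, l₂, e⟩
    · obtain ⟨hfl, y, rfl, hy⟩ := F.exists_dot x l₁ l₂ e
      refine dot hfl y l₁ l₂ hy (ih _ ?_ y rfl)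
      rw [e, hy]
      simp
    · obtain ⟨y, rfl, hy⟩ := F.exists_cup x l₁ l₂ e
      refine cup y l₁ l₂ hy (ih _ ?_ y rfl)
      rw [e, hy]
      simp

theorem isPath_code (x : X) : IsPath fl 0 (F.code x) := by
  induction x using F.induction with
  | empty => rw [F.code_empty]; rfl
  | cup x l₁ l₂ hx ih => rw [F.code_cup x l₁ l₂ hx, isPath_cup, ← hx]; exact ih
  | dot hfl x l₁ l₂ hx ih => rw [F.code_dot hfl x l₁ l₂ hx, isPath_dot, ← hx]; exact ⟨hfl, ih⟩

/-- Equal codes have a peak or flat step at the same place, so both objects arise by the same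
insertion from objects with equal shorter codes. -/
theorem code_injective : Function.Injective F.code := by
  intro x
  induction x using F.induction with
  | empty => exact fun y hy => (F.eq_empty y (hy.symm.trans F.code_empty)).symm
  | cup x l₁ l₂ hx ih =>
    intro y hy
    rw [F.code_cup x l₁ l₂ hx] at hy
    obtain ⟨y', rfl, hy'⟩ := F.exists_cup y l₁ l₂ hy.symm
    rw [ih (hx.trans hy'.symm)]
  | dot hfl x l₁ l₂ hx ih =>
    intro y hy
    rw [F.code_dot hfl x l₁ l₂ hx] at hy
    obtain ⟨-, y', rfl, hy'⟩ := F.exists_dot y l₁ l₂ hy.symm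
    rw [ih (hx.trans hy'.symm)]

theorem exists_code {p : List Step} (hp : IsPath fl 0 p) : ∃ x, F.code x = p := by
  induction hn : p.length using Nat.strong_induction_on generalizing p with
  | _ n ih =>
    subst hn
    by_cases h0 : p = []
    · exact ⟨F.empty, h0 ▸ F.code_empty⟩
    rcases exists_factor h0 (fun l hl => by rw [hl] at hp; exact absurd hp.1 (lt_irrefl 0))
      (fun l hl => by rw [hl] at hp; exact absurd hp.of_append (Nat.succ_ne_zero _))
      with ⟨l₁, l₂, rfl⟩ | ⟨l₁, l₂, rfl⟩
    · rw [isPath_dot] at hp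
      obtain ⟨x, hx⟩ := ih _ (by simp) hp.2 rfl
      exact ⟨_, F.code_dot hp.1 x l₁ l₂ hx⟩
    · rw [isPath_cup] at hp
      obtain ⟨x, hx⟩ := ih _ (by simp) hp rfl
      exact ⟨_, F.code_cup x l₁ l₂ hx⟩

/-! ### Gram determinants of coded families. -/

section gram

variable {K : Type} [Field K] {loop : ℕ → K} {z : K}

/-- The functions `δ x` on the states of a model are the vectors of the objects. -/
structure IsRealization (M : TLModel K loop z) (δ : X → List M.A → K) : Prop where
  empty : δ F.empty [] = 1
  ins : ∀ g x l₁ u l₂, (g = false → fl = true) → u.length = arity g →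
    (l₁ ++ l₂).length = (F.code x).length → M.ok (l₁ ++ (u ++ l₂)) →
    δ (F.ins g l₁.length x) (l₁ ++ (u ++ l₂)) = M.cre g l₁ u * δ x (l₁ ++ l₂)

variable {F}

/-- The same word serves both models: in `M` its vector is `δ x`, in the path model its leading path
is the code of `x`. -/
theorem IsRealization.exists_word {M : TLModel K loop z} {δ : X → List M.A → K}
    (hδ : F.IsRealization M δ) {ρ : ℕ → K} {w : K} (hρ hw h0 hloop hper hconst hz) (x : X) :
    ∀ m, (F.code x).length = m → ∃ W : CupWord m,
      (∀ l, M.ok l → l.length = m → M.eval W l = δ x l) ∧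
      IsLeading fl ((pathModel fl ρ w loop z hρ hw h0 hloop hper hconst hz).eval W) (F.code x) := by
  induction x using F.induction with
  | empty =>
    rintro m rfl
    rw [F.code_empty]
    refine ⟨.nil, ?_, rfl, rfl, fun q _ hq _ j => ?_⟩
    · intro l _ hl
      rw [List.length_eq_zero_iff.mp hl, hδ.empty]
      rfl
    · rw [List.length_eq_zero_iff.mp hq]
  | cup x l₁ l₂ hx ih =>
    rintro m rfl
    obtain ⟨W, hW, hlead⟩ := ih _ rfl
    have hlen := congrArg List.length hx
    have hm : (F.code (F.ins true l₁.length x)).length = (F.code x).length + arity true := by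
      rw [F.code_cup x l₁ l₂ hx, hx, arity]
      simp; omega
    rw [hm]
    refine ⟨.ins true l₁.length (by simp at hlen; omega) W, ?_, ?_⟩
    · intro l hl hl'
      obtain ⟨q, l', rfl, h₁⟩ := TLModel.exists_append (i := l₁.length) (l := l)
        (by simp at hlen; omega)
      obtain ⟨u, q', rfl, hu⟩ := TLModel.exists_append (i := arity true) (l := l')
        (by simp at hlen hl'; omega)
      rw [M.eval_ins, M.insOp_append _ _ h₁ hu]
      rw [← h₁, hδ.ins true x q u q' (by simp) hu (by simp at hl' ⊢; omega) hl]
      by_cases hc : M.cre true q u = 0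
      · rw [hc, zero_mul, zero_mul]
      · rw [hW _ (M.ok_cre _ _ _ _ hu hl hc) (by simp at hl' ⊢; omega)]
    · rw [F.code_cup x l₁ l₂ hx]
      exact (hlead.congr hx).cup fun q₁ u q₂ h hu => TLModel.insOp_append _ _ _ h hu
  | dot hfl x l₁ l₂ hx ih =>
    rintro m rfl
    obtain ⟨W, hW, hlead⟩ := ih _ rfl
    have hlen := congrArg List.length hx
    have hm : (F.code (F.ins false l₁.length x)).length = (F.code x).length + arity false := by
      rw [F.code_dot hfl x l₁ l₂ hx, hx, arity]
      simp; omega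
    rw [hm]
    refine ⟨.ins false l₁.length (by simp at hlen; omega) W, ?_, ?_⟩
    · intro l hl hl'
      obtain ⟨q, l', rfl, h₁⟩ := TLModel.exists_append (i := l₁.length) (l := l)
        (by simp at hlen; omega)
      obtain ⟨u, q', rfl, hu⟩ := TLModel.exists_append (i := arity false) (l := l')
        (by simp at hlen hl'; omega)
      rw [M.eval_ins, M.insOp_append _ _ h₁ hu]
      rw [← h₁, hδ.ins false x q u q' (fun _ => hfl) hu (by simp at hl' ⊢; omega) hl]
      by_cases hc : M.cre false q u = 0
      · rw [hc, zero_mul, zero_mul]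
      · rw [hW _ (M.ok_cre _ _ _ _ hu hl hc) (by simp at hl' ⊢; omega)]
    · rw [F.code_dot hfl x l₁ l₂ hx]
      subst hfl
      exact (hlead.congr hx).dot fun q₁ u q₂ h hu => TLModel.insOp_append _ _ _ h hu

/-- The Gram determinant of a realized family. -/
theorem IsRealization.det_form {M : TLModel K loop z} {δ : X → List M.A → K}
    (hδ : F.IsRealization M δ) {ρ : ℕ → K} {w : K} (hρ : ∀ h, ρ h ≠ 0) (hw : w ≠ 0)
    (h0 : ρ 0 + (if fl = true then 1 else 0) = loop 0)
    (hloop : ∀ h, ρ (h + 1) + (ρ h)⁻¹ + (if fl = true then 1 else 0) = loop (h + 1))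
    (hper : fl = false → ∀ i, loop (i + 2) = loop i)
    (hconst : fl = true → ∀ i, loop i = loop 0)
    (hz : z = if fl = true then w else 0)
    {ι : Type*} [Fintype ι] [DecidableEq ι] {m : ℕ} {e : ι → X} (he : Function.Injective e)
    (hrange : ∀ x, (∃ i, e i = x) ↔ (F.code x).length = m) :
    (Matrix.of fun i j => M.form m (δ (e i)) (δ (e j))).det =
      ∏ i, pathWeight ρ w 0 (F.code (e i)) := by
  classical
  have hlen : ∀ i, (F.code (e i)).length = m := fun i => (hrange _).mp ⟨i, rfl⟩
  choose W hW hlead using fun i =>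
    hδ.exists_word hρ hw h0 hloop hper hconst hz (e i) m (hlen i)
  refine det_of_isLeading (F.code_injective.comp he) hlen _ _ hlead _ fun i j => ?_
  -- The common constant transfers the Gram entry from `M` to the path model.
  obtain ⟨c, hc⟩ := exists_form_eval (loop := loop) (z := z) (W i) (W j)
  have h1 := hc M
  have h2 := hc (pathModel fl ρ w loop z hρ hw h0 hloop hper hconst hz)
  rw [M.form_congr_left (hW i), M.form_congr_right (hW j)] at h1
  rw [Matrix.of_apply, h1, ← h2]
  -- The codes of the labelled objects are exactly the paths of length `m`, so the form becomes a
  -- sum over labels.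
  have hs := sumLists_isPath (F.code_injective.comp he) hlen
    (fun p hp hpm => by
      obtain ⟨x, hx⟩ := F.exists_code hp
      obtain ⟨k, hk⟩ := (hrange x).mpr (by rw [hx, hpm])
      exact ⟨k, by simp [hk, hx]⟩)
    (fun l => if IsPath fl 0 l then pathWeight ρ w 0 l *
      (pathModel fl ρ w loop z hρ hw h0 hloop hper hconst hz).eval (W i) l *
      (pathModel fl ρ w loop z hρ hw h0 hloop hper hconst hz).eval (W j) l else 0)
    (fun l hl => if_neg hl)
  refine Eq.trans ?_ (hs.trans (Finset.sum_congr rfl fun k _ => ?_))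
  · refine sumLists_congr (A := Step) fun l _ => ?_
    by_cases h : IsPath fl 0 l
    · exact (if_pos h).trans (if_pos h).symm
    · exact (if_neg h).trans (if_neg h).symm
  · exact if_pos (F.isPath_code (e k))

end gram

end CodedFamily

open Step

/-! ### Noncrossing partitions of an initial segment of `ℕ` -/

/-- A noncrossing partition of `{0, …, size - 1}`, extended to `ℕ` by singletons. -/
@[ext] structure LinePartition where
  size : ℕ
  rel : Setoid ℕ
  lt_of_rel : ∀ x y, rel x y → x ≠ y → x < size
  noncrossing : ∀ a b c d, a < b → b < c → c < d → rel a c → rel b d → rel a b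

/-- The position of `x` after the insertion of `a` points at position `i`. -/
def shift (a i x : ℕ) : ℕ := if x < i then x else x + a

/-- The position of `x` after the removal of `a` points at position `i`. -/
def unshift (a i x : ℕ) : ℕ := if x < i then x else x - a

/-- The points inserted by `shift`. -/
def InBlock (a i x : ℕ) : Prop := i ≤ x ∧ x < i + a

theorem unshift_shift (a i x : ℕ) : unshift a i (shift a i x) = x := by
  simp only [unshift, shift]; split_ifs <;> omega

theorem shift_unshift {a i x : ℕ} (h : ¬ InBlock a i x) : shift a i (unshift a i x) = x := by
  simp only [unshift, shift, InBlock] at *; split_ifs <;> omega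

theorem not_inBlock_shift (a i x : ℕ) : ¬ InBlock a i (shift a i x) := by
  simp only [shift, InBlock]; split_ifs <;> omega

theorem shift_lt {a i x y : ℕ} : shift a i x < shift a i y ↔ x < y := by
  simp only [shift]; split_ifs <;> omega

theorem unshift_lt {a i x y : ℕ} (hx : ¬ InBlock a i x) (hy : ¬ InBlock a i y) (h : x < y) :
    unshift a i x < unshift a i y := by
  simp only [unshift, InBlock] at *; split_ifs <;> omega

/-- Insertion of a new block of `a` consecutive points. -/
def insRel (a i : ℕ) (r : Setoid ℕ) : Setoid ℕ where
  r x y := InBlock a i x ∧ InBlock a i y ∨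
    ¬ InBlock a i x ∧ ¬ InBlock a i y ∧ r (unshift a i x) (unshift a i y)
  iseqv := by
    refine ⟨fun x => ?_, ?_, ?_⟩
    · by_cases h : InBlock a i x
      · exact .inl ⟨h, h⟩
      · exact .inr ⟨h, h, r.refl' _⟩
    · rintro x y (⟨h, h'⟩ | ⟨h, h', h''⟩)
      · exact .inl ⟨h', h⟩
      · exact .inr ⟨h', h, r.symm' h''⟩
    · rintro x y z (⟨h, h'⟩ | ⟨h, h', h''⟩) (⟨k, k'⟩ | ⟨k, k', k''⟩)
      · exact .inl ⟨h, k'⟩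
      · exact absurd h' k
      · exact absurd k h'
      · exact .inr ⟨h, k', r.trans' h'' k''⟩

theorem insRel_iff {a i : ℕ} {r : Setoid ℕ} {x y : ℕ} : insRel a i r x y ↔
    InBlock a i x ∧ InBlock a i y ∨
    ¬ InBlock a i x ∧ ¬ InBlock a i y ∧ r (unshift a i x) (unshift a i y) := Iff.rfl

theorem insRel_shift {a i : ℕ} {r : Setoid ℕ} {x y : ℕ} :
    insRel a i r (shift a i x) (shift a i y) ↔ r x y := by
  simp [insRel_iff, not_inBlock_shift, unshift_shift]

theorem insRel_comap_shift {a i : ℕ} {r : Setoid ℕ} (h1 : ∀ x y, InBlock a i x → InBlock a i y → r x y)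
    (h2 : ∀ x y, InBlock a i x → r x y → InBlock a i y) :
    insRel a i (r.comap (shift a i)) = r := by
  ext x y
  rw [insRel_iff]
  constructor
  · rintro (⟨h, h'⟩ | ⟨h, h', h''⟩)
    · exact h1 _ _ h h'
    · rw [Setoid.comap_rel, shift_unshift h, shift_unshift h'] at h''
      exact h''
  · intro h
    by_cases hx : InBlock a i x
    · exact .inl ⟨hx, h2 _ _ hx h⟩
    · have hy : ¬ InBlock a i y := fun hy => hx (h2 _ _ hy (r.symm' h))
      refine .inr ⟨hx, hy, ?_⟩
      rw [Setoid.comap_rel, shift_unshift hx, shift_unshift hy]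
      exact h

namespace LinePartition

/-- Insertion of a new block of `a` consecutive points at position `i`. -/
def insBlock (π : LinePartition) (a i : ℕ) (hi : i ≤ π.size) : LinePartition where
  size := π.size + a
  rel := insRel a i π.rel
  lt_of_rel x y h hxy := by
    rcases insRel_iff.mp h with ⟨h, -⟩ | ⟨h, h', h''⟩
    · simp only [InBlock] at h; omega
    · have := π.lt_of_rel _ _ h'' fun e => hxy (by
        rw [← shift_unshift h, ← shift_unshift h', e])
      simp only [InBlock, unshift] at *
      split_ifs at this <;> omega
  noncrossing x y z t hxy hyz hzt h h' := by
    rw [insRel_iff] at *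
    rcases h with ⟨h1, h2⟩ | ⟨h1, h2, h3⟩
    · exact .inl ⟨h1, by simp only [InBlock] at *; omega⟩
    · rcases h' with ⟨k1, k2⟩ | ⟨k1, k2, k3⟩
      -- The new block is an interval: if it contains `y` and `t`, it contains `z` between them.
      · exact absurd (show InBlock a i z by simp only [InBlock] at *; omega) h2
      · exact .inr ⟨h1, k1, π.noncrossing _ _ _ _ (unshift_lt h1 k1 hxy) (unshift_lt k1 h2 hyz)
          (unshift_lt h2 k2 hzt) h3 k3⟩

/-- Removal of `a` consecutive points at position `i`. -/
def removeBlock (π : LinePartition) (a i : ℕ) (hi : i + a ≤ π.size) : LinePartition where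
  size := π.size - a
  rel := π.rel.comap (shift a i)
  lt_of_rel x y h hxy := by
    have := π.lt_of_rel _ _ h fun e => hxy (by rw [← unshift_shift a i x, e, unshift_shift])
    simp only [shift] at this
    split_ifs at this <;> omega
  noncrossing x y z t hxy hyz hzt h h' :=
    π.noncrossing _ _ _ _ (shift_lt.mpr hxy) (shift_lt.mpr hyz) (shift_lt.mpr hzt) h h'

theorem insBlock_removeBlock {π : LinePartition} {a i : ℕ} (hi : i + a ≤ π.size)
    (h1 : ∀ x y, InBlock a i x → InBlock a i y → π.rel x y)
    (h2 : ∀ x y, InBlock a i x → π.rel x y → InBlock a i y) :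
    (π.removeBlock a i hi).insBlock a i (Nat.le_sub_of_add_le hi) = π := by
  ext1
  · simp only [insBlock, removeBlock]; omega
  · exact insRel_comap_shift h1 h2

/-- Doubling of the point `j`. -/
def dup (π : LinePartition) (j : ℕ) (hj : j < π.size) : LinePartition where
  size := π.size + 1
  rel := π.rel.comap (unshift 1 (j + 1))
  lt_of_rel x y h hxy := by
    by_cases hxj : x ≤ j + 1
    · omega
    · have := π.lt_of_rel _ _ h (by simp only [unshift]; split_ifs <;> omega)
      simp only [unshift] at this
      split_ifs at this <;> omega
  noncrossing x y z t hxy hyz hzt h h' := by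
    rw [Setoid.comap_rel] at *
    -- Collapsing the double point is only weakly monotone; when two of the four points collide, the
    -- conclusion follows by reflexivity, the hypothesis or transitivity.
    have mono : ∀ {x y}, x < y → unshift 1 (j + 1) x ≤ unshift 1 (j + 1) y := by
      intro x y h
      simp only [unshift]; split_ifs <;> omega
    rcases (mono hxy).eq_or_lt with e | h1
    · rw [e]
    rcases (mono hyz).eq_or_lt with e | h2
    · rw [e]; exact h
    rcases (mono hzt).eq_or_lt with e | h3
    · rw [e] at h
      exact π.rel.trans' h (π.rel.symm' h')
    exact π.noncrossing _ _ _ _ h1 h2 h3 h h'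

theorem dup_removeBlock {π : LinePartition} {j : ℕ} (hj : j + 1 < π.size)
    (h : π.rel j (j + 1)) :
    (π.removeBlock 1 (j + 1) (by omega)).dup j (by simp only [removeBlock]; omega) = π := by
  ext1
  · simp only [dup, removeBlock]; omega
  · have key : ∀ x, π.rel x (shift 1 (j + 1) (unshift 1 (j + 1) x)) := by
      intro x
      by_cases hx : x = j + 1
      · subst hx
        convert π.rel.symm' h using 1
        simp [shift, unshift]
      · rw [shift_unshift (by simp only [InBlock]; omega)]
    ext x y
    change π.rel (shift _ _ (unshift _ _ x)) (shift _ _ (unshift _ _ y)) ↔ _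
    exact ⟨fun h => π.rel.trans' (key x) (π.rel.trans' h (π.rel.symm' (key y))),
      fun h => π.rel.trans' (π.rel.symm' (key x)) (π.rel.trans' h (key y))⟩

/-- The partition of the empty set. -/
def nil : LinePartition where
  size := 0
  rel := ⊥
  lt_of_rel x y h hxy := absurd h hxy
  noncrossing a b c d hab hbc _ h := absurd (show a = c from h) (by omega)

theorem eq_nil {π : LinePartition} (h : π.size = 0) : π = nil := by
  ext1
  · exact h
  · ext x y
    constructor
    · intro hxy
      by_contra hne
      have := π.lt_of_rel x y hxy hne
      omega
    · rintro (rfl : x = y)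
      exact π.rel.refl' _

end LinePartition

/-! ### Codes -/

/-- Insertion into a tabulated list. -/
theorem map_range_insert {α : Type*} {N a i : ℕ} {f f' : ℕ → α} (hi : i ≤ N)
    (h : ∀ x < N, f' (shift a i x) = f x) :
    (List.range (N + a)).map f' = ((List.range N).map f).take i ++
      ((List.range a).map (fun t => f' (i + t)) ++ ((List.range N).map f).drop i) := by
  obtain ⟨j, rfl⟩ := Nat.exists_eq_add_of_le hi
  rw [show i + j + a = i + (a + j) by omega, List.range_add, List.range_add, List.range_add]
  simp only [List.map_append, List.map_map]
  rw [List.take_left' (by simp), List.drop_left' (by simp)]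
  congr 1
  · refine List.map_congr_left fun x hx => ?_
    rw [List.mem_range] at hx
    rw [← h x (by omega), shift, if_pos hx]
  · congr 1
    refine List.map_congr_left fun x hx => ?_
    rw [List.mem_range] at hx
    simp only [Function.comp]
    rw [← h (i + x) (by omega), shift, if_neg (by omega)]
    congr 1; omega

open Classical in
/-- The step of a point in a partition into pairs and singletons. -/
noncomputable def pairStep (r : Setoid ℕ) (x : ℕ) : Step :=
  if ∃ y, x < y ∧ r x y then up else if ∃ y, y < x ∧ r x y then down else flat

open Classical in
/-- The step of the left side of a point. -/
noncomputable def leftStep (r : Setoid ℕ) (x : ℕ) : Step :=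
  if ∃ y, y < x ∧ r x y then down else up

open Classical in
/-- The step of the right side of a point. -/
noncomputable def rightStep (r : Setoid ℕ) (x : ℕ) : Step :=
  if ∃ y, x < y ∧ r x y then up else down

/-- The step of the left (even) or right (odd) side of a point. -/
noncomputable def sideStep (r : Setoid ℕ) (x : ℕ) : Step :=
  -- The boundary strands of thickened blocks pair these sides without crossings. The first point of
  -- a larger block reads up, up; an inner point down, up; the last down, down; a singleton up,
  -- down.
  if Even x then leftStep r (x / 2) else rightStep r (x / 2)

theorem insRel_exists_iff {a i : ℕ} {r : Setoid ℕ} {x : ℕ} {p : ℕ → Prop} :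
    (∃ y, p y ∧ insRel a i r (shift a i x) y) ↔ ∃ y, p (shift a i y) ∧ r x y := by
  constructor
  · rintro ⟨y, hp, h⟩
    rcases insRel_iff.mp h with ⟨h, -⟩ | ⟨-, h, h'⟩
    · exact absurd h (not_inBlock_shift _ _ _)
    · rw [unshift_shift] at h'
      exact ⟨_, by rwa [shift_unshift h], h'⟩
  · rintro ⟨y, hp, h⟩
    exact ⟨_, hp, insRel_shift.mpr h⟩

theorem pairStep_insRel_shift (a i : ℕ) (r : Setoid ℕ) (x : ℕ) :
    pairStep (insRel a i r) (shift a i x) = pairStep r x := by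
  have e1 := (insRel_exists_iff (a := a) (i := i) (r := r) (x := x)
    (p := fun y => shift a i x < y)).trans (by simp only [shift_lt]; exact Iff.rfl)
  have e2 := (insRel_exists_iff (a := a) (i := i) (r := r) (x := x)
    (p := fun y => y < shift a i x)).trans (by simp only [shift_lt]; exact Iff.rfl)
  classical
  unfold pairStep
  exact if_congr e1 rfl (if_congr e2 rfl rfl)

theorem pairStep_eq_up {r : Setoid ℕ} {x : ℕ} :
    pairStep r x = up ↔ ∃ y, x < y ∧ r x y := by
  unfold pairStep; split_ifs <;> simp_all

theorem pairStep_eq_down {r : Setoid ℕ} {x : ℕ} (h : pairStep r x = down) :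
    ∃ y, y < x ∧ r x y := by
  unfold pairStep at h; split_ifs at h; simp_all

theorem pairStep_eq_flat {r : Setoid ℕ} {x : ℕ} (h : pairStep r x = flat) :
    ∀ y, r x y → x = y := by
  unfold pairStep at h; split_ifs at h; simp_all
  rename_i h1 h2
  intro y hy
  by_contra hne
  rcases lt_or_gt_of_ne hne with h | h
  · exact h1 y h hy
  · exact h2 y h hy

theorem pairStep_insRel_one (i : ℕ) (r : Setoid ℕ) : pairStep (insRel 1 i r) i = flat := by
  have hb : InBlock 1 i i := ⟨le_rfl, by omega⟩
  have h : ∀ y, insRel 1 i r i y → y = i := by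
    intro y hy
    rcases insRel_iff.mp hy with ⟨-, h⟩ | ⟨h, -⟩
    · simp only [InBlock] at h; omega
    · exact absurd hb h
  unfold pairStep
  rw [if_neg, if_neg]
  · rintro ⟨y, hy, h'⟩
    have := h y h'; omega
  · rintro ⟨y, hy, h'⟩
    have := h y h'; omega

theorem pairStep_insRel_two (i : ℕ) (r : Setoid ℕ) :
    pairStep (insRel 2 i r) i = up ∧ pairStep (insRel 2 i r) (i + 1) = down := by
  have hb : InBlock 2 i i := ⟨le_rfl, by omega⟩
  have hb' : InBlock 2 i (i + 1) := ⟨by omega, by omega⟩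
  refine ⟨pairStep_eq_up.mpr ⟨i + 1, by omega, .inl ⟨hb, hb'⟩⟩, ?_⟩
  unfold pairStep
  rw [if_neg, if_pos ⟨i, by omega, .inl ⟨hb', hb⟩⟩]
  rintro ⟨y, hy, h⟩
  rcases insRel_iff.mp h with ⟨-, h⟩ | ⟨h, -⟩
  · simp only [InBlock] at h; omega
  · exact absurd hb' h

/-- The conditions on the block sizes: pairs, and also singletons if `fl` holds. -/
structure LinePartition.IsPairing (fl : Bool) (π : LinePartition) : Prop where
  eq_of_rel : ∀ x y z, π.rel x y → π.rel x z → x ≠ y → x ≠ z → y = z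
  exists_rel : fl = false → ∀ x < π.size, ∃ y, x ≠ y ∧ π.rel x y

theorem LinePartition.IsPairing.insBlock {fl : Bool} {π : LinePartition} (h : π.IsPairing fl)
    {a i : ℕ} (hi : i ≤ π.size) (ha : a ≤ 2) (ha' : fl = false → a = 2) :
    (π.insBlock a i hi).IsPairing fl := by
  constructor
  · intro x y z hxy hxz hy hz
    rcases insRel_iff.mp hxy with ⟨h1, h2⟩ | ⟨h1, h2, h3⟩
    · rcases insRel_iff.mp hxz with ⟨-, k2⟩ | ⟨k1, -⟩
      · simp only [InBlock] at *; omega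
      · exact absurd h1 k1
    · rcases insRel_iff.mp hxz with ⟨k1, -⟩ | ⟨-, k2, k3⟩
      · exact absurd k1 h1
      · have := h.eq_of_rel _ _ _ h3 k3
          (fun e => hy (by rw [← shift_unshift h1, e, shift_unshift h2]))
          (fun e => hz (by rw [← shift_unshift h1, e, shift_unshift k2]))
        rw [← shift_unshift h2, this, shift_unshift k2]
  · intro hfl x hx
    by_cases hb : InBlock a i x
    · obtain rfl := ha' hfl
      simp only [InBlock] at hb
      by_cases hxi : x = i
      · exact ⟨i + 1, by omega, .inl ⟨hb, by simp only [InBlock]; omega⟩⟩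
      · exact ⟨i, by omega, .inl ⟨hb, by simp only [InBlock]; omega⟩⟩
    · obtain ⟨y, hy, hxy⟩ := h.exists_rel hfl (unshift a i x) (by
        simp only [LinePartition.insBlock, unshift, InBlock] at *
        split_ifs <;> omega)
      refine ⟨shift a i y, fun e => hy ?_, ?_⟩
      · rw [e, unshift_shift]
      · have := insRel_shift (a := a) (i := i).mpr hxy
        rwa [shift_unshift hb] at this

theorem LinePartition.IsPairing.removeBlock {fl : Bool} {π : LinePartition} (h : π.IsPairing fl)
    {a i : ℕ} (hi : i + a ≤ π.size) (h2 : ∀ x y, InBlock a i x → π.rel x y → InBlock a i y) :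
    (π.removeBlock a i hi).IsPairing fl := by
  have inj : ∀ {x y}, shift a i x = shift a i y → x = y := fun {x y} e => by
    rw [← unshift_shift a i x, e, unshift_shift]
  constructor
  · intro x y z hxy hxz hy hz
    exact inj (h.eq_of_rel _ _ _ hxy hxz (fun e => hy (inj e)) (fun e => hz (inj e)))
  · intro hfl x hx
    obtain ⟨y, hy, hxy⟩ := h.exists_rel hfl (shift a i x) (by
      simp only [LinePartition.removeBlock, shift] at *
      split_ifs <;> omega)
    have hb : ¬ InBlock a i y := fun hb => not_inBlock_shift a i x (h2 _ _ hb (π.rel.symm' hxy))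
    refine ⟨unshift a i y, fun e => hy ?_, ?_⟩
    · rw [e, shift_unshift hb]
    · change π.rel _ _
      rwa [shift_unshift hb]

open Step

/-- Otherwise the partner of `i` to the right and that of `i + 1` to the left would give crossing
blocks. This turns an adjacent up, down in a code into two related neighbours. -/
theorem LinePartition.rel_succ (π : LinePartition) {i : ℕ} (h : ∃ y, i < y ∧ π.rel i y)
    (h' : ∃ y, y < i + 1 ∧ π.rel (i + 1) y) : π.rel i (i + 1) := by
  obtain ⟨y, hy, h⟩ := h
  obtain ⟨z, hz, h'⟩ := h'
  by_cases hyi : y = i + 1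
  · exact hyi ▸ h
  by_cases hzi : z = i
  · subst hzi
    exact π.rel.symm' h'
  have := π.noncrossing z i (i + 1) y (by omega) (by omega) (by omega) (π.rel.symm' h') h
  exact π.rel.trans' (π.rel.symm' this) (π.rel.symm' h')

theorem map_range_eq_append_cons {α : Type*} {N : ℕ} {f : ℕ → α} {l₁ l₂ : List α} {a : α}
    (h : (List.range N).map f = l₁ ++ a :: l₂) : f l₁.length = a ∧ l₁.length + l₂.length + 1 = N := by
  have hN := congrArg List.length h
  simp only [List.length_map, List.length_range, List.length_append, List.length_cons] at hN
  refine ⟨?_, by omega⟩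
  have := congrArg (fun l : List α => l[l₁.length]?) h
  simpa [List.getElem?_range (show l₁.length < N by omega)] using this

theorem map_range_eq_append_cons_cons {α : Type*} {N : ℕ} {f : ℕ → α} {l₁ l₂ : List α} {a b : α}
    (h : (List.range N).map f = l₁ ++ a :: b :: l₂) :
    f l₁.length = a ∧ f (l₁.length + 1) = b ∧ l₁.length + l₂.length + 2 = N := by
  have h1 := map_range_eq_append_cons h
  have h2 := map_range_eq_append_cons (l₁ := l₁ ++ [a]) (a := b) (l₂ := l₂) (by simpa using h)
  simp at h1 h2
  exact ⟨h1.1, h2.1, by omega⟩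

theorem append_inj_of_length {α : Type*} {l l₁ l₂ c : List α} {i : ℕ} (hi : i ≤ l.length)
    (h : l.take i ++ (c ++ l.drop i) = l₁ ++ (c ++ l₂)) (h₁ : i = l₁.length) : l = l₁ ++ l₂ := by
  obtain ⟨h2, h3⟩ := List.append_inj h (by simp; omega)
  rw [← List.take_append_drop i l, h2, List.append_cancel_left h3]

/-! ### Partitions into pairs and singletons -/

/-- The code of a partition into pairs and singletons. -/
noncomputable def LinePartition.pairCode (π : LinePartition) : List Step :=
  (List.range π.size).map (pairStep π.rel)

theorem LinePartition.length_pairCode (π : LinePartition) : π.pairCode.length = π.size := by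
  simp [pairCode]

theorem LinePartition.pairCode_insBlock (π : LinePartition) {a i : ℕ} (hi : i ≤ π.size) :
    (π.insBlock a i hi).pairCode = π.pairCode.take i ++
      ((List.range a).map (fun t => pairStep (insRel a i π.rel) (i + t)) ++ π.pairCode.drop i) :=
  map_range_insert hi fun x _ => pairStep_insRel_shift a i π.rel x

theorem LinePartition.pairCode_insBlock_two (π : LinePartition) {i : ℕ} (hi : i ≤ π.size) :
    (π.insBlock 2 i hi).pairCode = π.pairCode.take i ++ ([up, down] ++ π.pairCode.drop i) := by
  rw [pairCode_insBlock]
  have := pairStep_insRel_two i π.rel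
  simp [List.range_succ, this]

theorem LinePartition.pairCode_insBlock_one (π : LinePartition) {i : ℕ} (hi : i ≤ π.size) :
    (π.insBlock 1 i hi).pairCode = π.pairCode.take i ++ ([flat] ++ π.pairCode.drop i) := by
  rw [pairCode_insBlock]
  have := pairStep_insRel_one i π.rel
  simp [List.range_succ, this]

open Classical in
/-- Insertion of pairs and singletons. -/
noncomputable def pairIns (fl : Bool) (g : Bool) (i : ℕ)
    (x : {π : LinePartition // π.IsPairing fl}) : {π : LinePartition // π.IsPairing fl} :=
  if h : i ≤ x.1.size ∧ (g = false → fl = true) then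
    ⟨x.1.insBlock (arity g) i h.1, x.2.insBlock h.1 (by cases g <;> simp [arity])
      (fun hf => by cases g <;> simp_all [arity])⟩
  else x

theorem pairIns_of_le {fl g : Bool} {i : ℕ} {x : {π : LinePartition // π.IsPairing fl}}
    (h : i ≤ x.1.size) (h' : g = false → fl = true) :
    (pairIns fl g i x).1 = x.1.insBlock (arity g) i h := by
  rw [pairIns, dif_pos ⟨h, h'⟩]

/-- Noncrossing partitions into pairs and (if `fl` holds) singletons. -/
noncomputable def pairFamily (fl : Bool) :
    CodedFamily fl {π : LinePartition // π.IsPairing fl} where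
  code x := x.1.pairCode
  ins := pairIns fl
  empty := ⟨.nil, ⟨fun x y z h _ hxy => absurd h hxy, fun _ x hx => absurd hx (Nat.not_lt_zero x)⟩⟩
  code_empty := rfl
  eq_empty x hx := Subtype.ext (LinePartition.eq_nil (by
    rw [← LinePartition.length_pairCode, hx]; rfl))
  code_ne_down x l h := by
    have := (map_range_eq_append_cons (l₁ := []) h).1
    obtain ⟨y, hy, -⟩ := pairStep_eq_down this
    exact absurd hy (Nat.not_lt_zero _)
  code_ne_up x l h := by
    obtain ⟨h1, h2⟩ := map_range_eq_append_cons h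
    obtain ⟨y, hy, hxy⟩ := pairStep_eq_up.mp h1
    have := x.1.lt_of_rel y _ (x.1.rel.symm' hxy) hy.ne'
    simp at h2
    omega
  code_cup x l₁ l₂ hx := by
    have hi : l₁.length ≤ x.1.size := by
      rw [← LinePartition.length_pairCode, hx]; simp
    rw [pairIns_of_le hi (by simp)]
    refine (LinePartition.pairCode_insBlock_two _ hi).trans ?_
    rw [hx]
    simp
  code_dot hfl x l₁ l₂ hx := by
    have hi : l₁.length ≤ x.1.size := by
      rw [← LinePartition.length_pairCode, hx]; simp
    rw [pairIns_of_le hi (fun _ => hfl)]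
    refine (LinePartition.pairCode_insBlock_one _ hi).trans ?_
    rw [hx]
    simp
  exists_cup := by
    rintro ⟨π, hπ⟩ l₁ l₂ (h : π.pairCode = _)
    obtain ⟨h1, h2, h3⟩ := map_range_eq_append_cons_cons h
    have hrel := π.rel_succ (pairStep_eq_up.mp h1) (pairStep_eq_down h2)
    have hi : l₁.length + 2 ≤ π.size := by omega
    -- Partners are unique, so the two neighbours form a complete block.
    have hb : ∀ x y, InBlock 2 l₁.length x → π.rel x y → InBlock 2 l₁.length y := by
      intro x y hx hxy
      by_contra hy
      simp only [InBlock] at hx hy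
      obtain rfl | rfl : x = l₁.length ∨ x = l₁.length + 1 := by omega
      · have := hπ.eq_of_rel _ _ _ hrel hxy (by omega) (by omega)
        omega
      · have := hπ.eq_of_rel _ _ _ (π.rel.symm' hrel) hxy (by omega) (by omega)
        omega
    have hb' : ∀ x y, InBlock 2 l₁.length x → InBlock 2 l₁.length y → π.rel x y := by
      intro x y hx hy
      simp only [InBlock] at hx hy
      rcases (show x = l₁.length ∨ x = l₁.length + 1 by omega) with rfl | rfl <;>
        rcases (show y = l₁.length ∨ y = l₁.length + 1 by omega) with rfl | rfl
      · exact π.rel.refl' _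
      · exact hrel
      · exact π.rel.symm' hrel
      · exact π.rel.refl' _
    have he := LinePartition.insBlock_removeBlock hi hb' hb
    refine ⟨⟨π.removeBlock 2 l₁.length hi, hπ.removeBlock hi hb⟩, Subtype.ext ?_, ?_⟩
    · rw [pairIns_of_le (Nat.le_sub_of_add_le hi) (by simp)]
      exact he.symm
    · have hc := LinePartition.pairCode_insBlock_two (π.removeBlock 2 l₁.length hi)
        (Nat.le_sub_of_add_le hi)
      rw [he] at hc
      exact append_inj_of_length (c := [up, down]) (i := l₁.length)
        (by rw [LinePartition.length_pairCode]; exact Nat.le_sub_of_add_le hi)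
        (hc.symm.trans h) rfl
  exists_dot := by
    rintro ⟨π, hπ⟩ l₁ l₂ (h : π.pairCode = _)
    obtain ⟨h1, h3⟩ := map_range_eq_append_cons h
    have hflat := pairStep_eq_flat h1
    have hi : l₁.length + 1 ≤ π.size := by omega
    have hfl : fl = true := by
      by_contra hfl
      obtain ⟨y, hy, hxy⟩ := hπ.exists_rel (by simpa using hfl) l₁.length (by omega)
      exact hy (hflat y hxy)
    have hb : ∀ x y, InBlock 1 l₁.length x → π.rel x y → InBlock 1 l₁.length y := by
      intro x y hx hxy
      obtain rfl : x = l₁.length := by simp only [InBlock] at hx; omega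
      rwa [← hflat y hxy]
    have hb' : ∀ x y, InBlock 1 l₁.length x → InBlock 1 l₁.length y → π.rel x y := by
      intro x y hx hy
      obtain rfl : x = y := by simp only [InBlock] at hx hy; omega
      exact π.rel.refl' _
    have he := LinePartition.insBlock_removeBlock hi hb' hb
    refine ⟨hfl, ⟨π.removeBlock 1 l₁.length hi, hπ.removeBlock hi hb⟩, Subtype.ext ?_, ?_⟩
    · rw [pairIns_of_le (Nat.le_sub_of_add_le hi) (fun _ => hfl)]
      exact he.symm
    · have hc := LinePartition.pairCode_insBlock_one (π.removeBlock 1 l₁.length hi)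
        (Nat.le_sub_of_add_le hi)
      rw [he] at hc
      exact append_inj_of_length (c := [flat]) (i := l₁.length)
        (by rw [LinePartition.length_pairCode]; exact Nat.le_sub_of_add_le hi)
        (hc.symm.trans h) rfl

/-! ### All noncrossing partitions -/

theorem leftStep_eq_up {r : Setoid ℕ} {x : ℕ} : leftStep r x = up ↔ ∀ y, y < x → ¬ r x y := by
  unfold leftStep; split_ifs <;> simp_all

theorem leftStep_eq_down {r : Setoid ℕ} {x : ℕ} : leftStep r x = down ↔ ∃ y, y < x ∧ r x y := by
  unfold leftStep; split_ifs <;> simp_all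

theorem rightStep_eq_down {r : Setoid ℕ} {x : ℕ} :
    rightStep r x = down ↔ ∀ y, x < y → ¬ r x y := by
  unfold rightStep; split_ifs <;> simp_all

theorem rightStep_eq_up {r : Setoid ℕ} {x : ℕ} : rightStep r x = up ↔ ∃ y, x < y ∧ r x y := by
  unfold rightStep; split_ifs <;> simp_all

theorem leftStep_congr {r r' : Setoid ℕ} {x x' : ℕ}
    (h : (∃ y, y < x ∧ r x y) ↔ ∃ y, y < x' ∧ r' x' y) : leftStep r x = leftStep r' x' := by
  classical
  unfold leftStep
  exact if_congr h rfl rfl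

theorem rightStep_congr {r r' : Setoid ℕ} {x x' : ℕ}
    (h : (∃ y, x < y ∧ r x y) ↔ ∃ y, x' < y ∧ r' x' y) : rightStep r x = rightStep r' x' := by
  classical
  unfold rightStep
  exact if_congr h rfl rfl

theorem sideStep_even (r : Setoid ℕ) (x : ℕ) : sideStep r (2 * x) = leftStep r x := by
  simp [sideStep]

theorem sideStep_odd (r : Setoid ℕ) (x : ℕ) : sideStep r (2 * x + 1) = rightStep r x := by
  rw [sideStep, if_neg (by simp), show (2 * x + 1) / 2 = x by omega]

/-- A new singleton at `j` brings the two sides `2 * j` and `2 * j + 1`; old points gain no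
partners. -/
theorem sideStep_insRel_shift (j : ℕ) (r : Setoid ℕ) (x : ℕ) :
    sideStep (insRel 1 j r) (shift 2 (2 * j) x) = sideStep r x := by
  have e1 : ∀ q, leftStep (insRel 1 j r) (shift 1 j q) = leftStep r q := fun q =>
    leftStep_congr ((insRel_exists_iff (p := fun y => y < shift 1 j q)).trans
      (by simp only [shift_lt]))
  have e2 : ∀ q, rightStep (insRel 1 j r) (shift 1 j q) = rightStep r q := fun q =>
    rightStep_congr ((insRel_exists_iff (p := fun y => shift 1 j q < y)).trans
      (by simp only [shift_lt]))
  obtain ⟨q, rfl | rfl⟩ := Nat.even_or_odd' x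
  · rw [show shift 2 (2 * j) (2 * q) = 2 * shift 1 j q by
      simp only [shift]; split_ifs <;> omega, sideStep_even, sideStep_even, e1]
  · rw [show shift 2 (2 * j) (2 * q + 1) = 2 * shift 1 j q + 1 by
      simp only [shift]; split_ifs <;> omega, sideStep_odd, sideStep_odd, e2]

theorem insRel_one_self {j y : ℕ} {r : Setoid ℕ} (h : insRel 1 j r j y) : y = j := by
  have hb : InBlock 1 j j := ⟨le_rfl, by omega⟩
  rcases insRel_iff.mp h with ⟨-, h⟩ | ⟨h, -⟩
  · simp only [InBlock] at h; omega
  · exact absurd hb h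

/-- Doubling `j` brings the right side of `j` and the left side of `j + 1`, facing each other. The
former right side of `j` becomes that of `j + 1`. -/
theorem sideStep_dup_shift (j : ℕ) (r : Setoid ℕ) (x : ℕ) :
    sideStep (r.comap (unshift 1 (j + 1))) (shift 2 (2 * j + 1) x) = sideStep r x := by
  have u1 : ∀ y, y ≤ j → unshift 1 (j + 1) y = y := fun y h => by
    rw [unshift, if_pos (by omega)]
  have u2 : ∀ y, j ≤ y → unshift 1 (j + 1) (y + 1) = y := fun y h => by
    rw [unshift, if_neg (by omega)]; omega
  obtain ⟨q, rfl | rfl⟩ := Nat.even_or_odd' x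
  · by_cases hq : q ≤ j
    · rw [shift, if_pos (by omega), sideStep_even, sideStep_even]
      refine leftStep_congr (exists_congr fun y => and_congr_right fun hy => ?_)
      rw [Setoid.comap_rel, u1 q hq, u1 y (by omega)]
    · rw [shift, if_neg (by omega), show 2 * q + 2 = 2 * (q + 1) by ring, sideStep_even,
        sideStep_even]
      apply leftStep_congr
      simp only [Setoid.comap_rel, u2 q (by omega)]
      constructor
      · rintro ⟨y, hy, h⟩
        exact ⟨_, by simp only [unshift]; split_ifs <;> omega, h⟩
      · rintro ⟨y, hy, h⟩
        by_cases hyj : y ≤ j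
        · exact ⟨y, by omega, by rwa [u1 y hyj]⟩
        · exact ⟨y + 1, by omega, by rwa [u2 y (by omega)]⟩
  · by_cases hq : q < j
    · rw [shift, if_pos (by omega), sideStep_odd, sideStep_odd]
      apply rightStep_congr
      simp only [Setoid.comap_rel, u1 q hq.le]
      constructor
      · rintro ⟨y, hy, h⟩
        exact ⟨_, by simp only [unshift]; split_ifs <;> omega, h⟩
      · rintro ⟨y, hy, h⟩
        by_cases hyj : y ≤ j
        · exact ⟨y, by omega, by rwa [u1 y hyj]⟩
        · exact ⟨y + 1, by omega, by rwa [u2 y (by omega)]⟩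
    · rw [shift, if_neg (by omega), show 2 * q + 1 + 2 = 2 * (q + 1) + 1 by ring, sideStep_odd,
        sideStep_odd]
      apply rightStep_congr
      simp only [Setoid.comap_rel, u2 q (by omega)]
      constructor
      · rintro ⟨y, hy, h⟩
        exact ⟨_, by simp only [unshift]; split_ifs <;> omega, h⟩
      · rintro ⟨y, hy, h⟩
        exact ⟨y + 1, by omega, by rwa [u2 y (by omega)]⟩

/-- The code of a noncrossing partition. -/
noncomputable def LinePartition.sideCode (π : LinePartition) : List Step :=
  (List.range (2 * π.size)).map (sideStep π.rel)

theorem LinePartition.length_sideCode (π : LinePartition) :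
    π.sideCode.length = 2 * π.size := by
  simp [sideCode]

theorem LinePartition.sideCode_insBlock (π : LinePartition) {j : ℕ} (hj : j ≤ π.size) :
    (π.insBlock 1 j hj).sideCode =
      π.sideCode.take (2 * j) ++ ([up, down] ++ π.sideCode.drop (2 * j)) := by
  refine (map_range_insert (N := 2 * π.size) (a := 2) (i := 2 * j) (by omega)
    fun x _ => sideStep_insRel_shift j π.rel x).trans ?_
  have h1 : sideStep (insRel 1 j π.rel) (2 * j) = up := by
    rw [sideStep_even, leftStep_eq_up]
    intro y hy h
    exact absurd (insRel_one_self h) hy.ne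
  have h2 : sideStep (insRel 1 j π.rel) (2 * j + 1) = down := by
    rw [sideStep_odd, rightStep_eq_down]
    intro y hy h
    exact absurd (insRel_one_self h) hy.ne'
  simp [List.range_succ, h1, h2, sideCode]

theorem LinePartition.sideCode_dup (π : LinePartition) {j : ℕ} (hj : j < π.size) :
    (π.dup j hj).sideCode =
      π.sideCode.take (2 * j + 1) ++ ([up, down] ++ π.sideCode.drop (2 * j + 1)) := by
  refine (map_range_insert (N := 2 * π.size) (a := 2) (i := 2 * j + 1) (by omega)
    fun x _ => sideStep_dup_shift j π.rel x).trans ?_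
  have u1 : unshift 1 (j + 1) j = j := by simp [unshift]
  have u2 : unshift 1 (j + 1) (j + 1) = j := by simp [unshift]
  have h1 : sideStep (π.rel.comap (unshift 1 (j + 1))) (2 * j + 1) = up := by
    rw [sideStep_odd, rightStep_eq_up]
    refine ⟨j + 1, by omega, ?_⟩
    rw [Setoid.comap_rel, u1, u2]
  have h2 : sideStep (π.rel.comap (unshift 1 (j + 1))) (2 * j + 1 + 1) = down := by
    rw [show 2 * j + 1 + 1 = 2 * (j + 1) by ring, sideStep_even, leftStep_eq_down]
    refine ⟨j, by omega, ?_⟩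
    rw [Setoid.comap_rel, u1, u2]
  simp [List.range_succ, h1, h2, sideCode]

open Classical in
/-- Insertion of singletons (even positions) and doubling of points (odd positions). -/
noncomputable def sideIns (g : Bool) (i : ℕ) (π : LinePartition) : LinePartition :=
  if g = true then
    if Even i then if h : i / 2 ≤ π.size then π.insBlock 1 (i / 2) h else π
    else if h : i / 2 < π.size then π.dup (i / 2) h else π
  else π

theorem sideIns_even {π : LinePartition} {j : ℕ} (hj : j ≤ π.size) :
    sideIns true (2 * j) π = π.insBlock 1 j hj := by
  simp [sideIns, hj]

theorem sideIns_odd {π : LinePartition} {j : ℕ} (hj : j < π.size) :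
    sideIns true (2 * j + 1) π = π.dup j hj := by
  have : (2 * j + 1) / 2 = j := by omega
  simp [sideIns, this, hj]

theorem sideStep_ne_flat (r : Setoid ℕ) (x : ℕ) : sideStep r x ≠ flat := by
  unfold sideStep leftStep rightStep
  split_ifs <;> simp

/-- All noncrossing partitions. -/
noncomputable def sideFamily : CodedFamily false LinePartition where
  code x := x.sideCode
  ins := sideIns
  empty := .nil
  code_empty := rfl
  eq_empty x hx := LinePartition.eq_nil (by
    have := LinePartition.length_sideCode x
    rw [hx] at this
    simpa using this.symm)
  code_ne_down x l h := by
    have := (map_range_eq_append_cons (l₁ := []) h).1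
    rw [List.length_nil, ← mul_zero 2, sideStep_even, leftStep_eq_down] at this
    obtain ⟨y, hy, -⟩ := this
    exact absurd hy (Nat.not_lt_zero _)
  code_ne_up x l h := by
    obtain ⟨h1, h2⟩ := map_range_eq_append_cons h
    have h3 : l.length = 2 * (x.size - 1) + 1 := by simp at h2; omega
    rw [h3, sideStep_odd, rightStep_eq_up] at h1
    obtain ⟨y, hy, hxy⟩ := h1
    have := x.lt_of_rel y _ (x.rel.symm' hxy) hy.ne'
    omega
  code_cup x l₁ l₂ hx := by
    have hi : l₁.length + l₂.length = 2 * x.size := by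
      rw [← LinePartition.length_sideCode, hx]; simp
    obtain ⟨j, hj | hj⟩ := Nat.even_or_odd' l₁.length
    · rw [hj, sideIns_even (by omega), LinePartition.sideCode_insBlock, hx, ← hj]
      simp
    · rw [hj, sideIns_odd (by omega), LinePartition.sideCode_dup, hx, ← hj]
      simp
  code_dot h := by simp at h
  exists_cup π l₁ l₂ h := by
    obtain ⟨h1, h2, h3⟩ := map_range_eq_append_cons_cons h
    obtain ⟨j, hj | hj⟩ := Nat.even_or_odd' l₁.length
    -- A peak on the two sides of `j`: the point has no partner and is a removable singleton.
    · rw [hj, sideStep_even, leftStep_eq_up] at h1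
      rw [hj, sideStep_odd, rightStep_eq_down] at h2
      have hsing : ∀ y, π.rel j y → y = j := by
        intro y hy
        rcases lt_trichotomy y j with h | h | h
        · exact absurd hy (h1 y h)
        · exact h
        · exact absurd hy (h2 y h)
      have hi : j + 1 ≤ π.size := by omega
      have he := LinePartition.insBlock_removeBlock (π := π) hi
        (by
          intro x y hx hy
          obtain rfl : x = y := by simp only [InBlock] at hx hy; omega
          exact π.rel.refl' _)
        (by
          intro x y hx hxy
          obtain rfl : x = j := by simp only [InBlock] at hx; omega
          rwa [hsing y hxy])
      refine ⟨π.removeBlock 1 j hi, ?_, ?_⟩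
      · rw [hj, sideIns_even (Nat.le_sub_of_add_le hi), he]
      · have hc := LinePartition.sideCode_insBlock (π.removeBlock 1 j hi)
          (Nat.le_sub_of_add_le hi)
        rw [he] at hc
        refine append_inj_of_length (c := [up, down]) (i := 2 * j) ?_ (hc.symm.trans h) hj.symm
        rw [LinePartition.length_sideCode]
        simp only [LinePartition.removeBlock]; omega
    -- A peak between the facing sides of `j` and `j + 1`: they share a block and can be merged.
    · rw [hj, sideStep_odd, rightStep_eq_up] at h1
      rw [hj, show 2 * j + 1 + 1 = 2 * (j + 1) by ring, sideStep_even, leftStep_eq_down] at h2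
      have hrel := π.rel_succ h1 h2
      have hi : j + 1 < π.size := by omega
      have he := LinePartition.dup_removeBlock hi hrel
      refine ⟨π.removeBlock 1 (j + 1) (by omega), ?_, ?_⟩
      · rw [hj, sideIns_odd (by simp only [LinePartition.removeBlock]; omega), he]
      · have hc := LinePartition.sideCode_dup (π.removeBlock 1 (j + 1) (by omega)) (j := j)
          (by simp only [LinePartition.removeBlock]; omega)
        rw [he] at hc
        refine append_inj_of_length (c := [up, down]) (i := 2 * j + 1) ?_ (hc.symm.trans h)
          hj.symm
        rw [LinePartition.length_sideCode]
        simp only [LinePartition.removeBlock]; omega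
  exists_dot π l₁ l₂ h := absurd (map_range_eq_append_cons h).1 (sideStep_ne_flat _ _)

/-! ### The spin models -/

section spin

variable {K : Type} [Field K]

/-- Coefficients of the insertions in the vertex model. -/
def vertexCoef {n : ℕ} (fl : Bool) : Bool → List (Fin n) → K
  | true, [a, b] => if a = b then 1 else 0
  | false, [_] => if fl = true then 1 else 0
  | _, _ => 0

/-- The model whose states are arbitrary lists of spins. -/
def vertexModel (K : Type) [Field K] (fl : Bool) (n : ℕ) :
    TLModel K (fun _ => (n : K)) (if fl = true then (n : K) else 0) where
  A := Fin n
  ok _ := True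
  cre g _ u := vertexCoef fl g u
  ann g _ u := vertexCoef fl g u
  wt _ := 1
  ok_nil := trivial
  wt_nil := rfl
  adj _ _ _ _ _ := by ring
  ok_cre _ _ _ _ _ _ _ := trivial
  ok_ann _ _ _ _ _ _ _ := trivial
  far _ _ _ _ _ _ _ := ⟨rfl, rfl⟩
  ann_cre_cup _ _ _ := by simp [vertexCoef]
  ann_cre_dot _ _ _ := by cases fl <;> simp [vertexCoef]
  zig _ _ _ _ _ := by simp [vertexCoef]
  zag _ _ _ _ _ := by simp [vertexCoef, eq_comm]
  ann_cup_dot_left _ _ := by simp [vertexCoef]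
  ann_cup_dot_right _ _ := by simp [vertexCoef]
  ann_dot_cup_left _ _ := by simp [vertexCoef]
  ann_dot_cup_right _ _ := by simp [vertexCoef]

/-- Each spin occurs twice in succession. -/
def IsDoubled {A : Type*} : List A → Prop
  | [] => True
  | [_] => False
  | a :: b :: l => a = b ∧ IsDoubled l

theorem isDoubled_append {A : Type*} {l₁ l₂ : List A} (h : Even l₁.length) :
    IsDoubled (l₁ ++ l₂) ↔ IsDoubled l₁ ∧ IsDoubled l₂ := by
  induction l₁ using IsDoubled.induct with
  | case1 => simp [IsDoubled]
  | case2 => simp at h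
  | case3 a b l ih =>
    have : Even l.length := by simpa [Nat.even_add_one] using h
    simp [IsDoubled, ih this, and_assoc]

theorem exists_of_odd {A : Type*} {l : List A} (h : ¬ Even l.length) :
    ∃ l' x, l = l' ++ [x] ∧ Even l'.length := by
  rcases List.eq_nil_or_concat l with rfl | ⟨l', x, rfl⟩
  · simp at h
  · exact ⟨l', x, by simp, by simpa [Nat.even_add_one] using h⟩

open Classical in
/-- Coefficients of the insertions in the face model. -/
noncomputable def faceCoef {n : ℕ} : Bool → List (Fin n) → List (Fin n) → K
  | true, l, [a, b] => if a = b ∧ (Even l.length ∨ l.getLast? = some a) then 1 else 0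
  | _, _, _ => 0

theorem faceCoef_ne_zero {n : ℕ} {g : Bool} {l u : List (Fin n)} (h : (faceCoef g l u : K) ≠ 0) :
    g = true ∧ ∃ a, u = [a, a] ∧ (Even l.length ∨ l.getLast? = some a) := by
  unfold faceCoef at h
  split at h
  · split_ifs at h with h'
    · obtain ⟨rfl, h'⟩ := h'
      exact ⟨rfl, _, rfl, h'⟩
    · exact absurd rfl h
  · exact absurd rfl h

/-- At an even place a new doubled spin is inserted. At an odd place a doubled spin is split open,
and the new pair must copy it to keep the list doubled. -/
theorem isDoubled_insert {A : Type*} {l₁ l₂ : List A} {a : A}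
    (h : Even l₁.length ∨ l₁.getLast? = some a) :
    IsDoubled (l₁ ++ ([a, a] ++ l₂)) ↔ IsDoubled (l₁ ++ l₂) := by
  by_cases he : Even l₁.length
  · rw [isDoubled_append he, isDoubled_append he]
    simp [IsDoubled]
  · obtain ⟨l, x, rfl, hl⟩ := exists_of_odd he
    have hx : x = a := by simpa using h.resolve_left he
    subst hx
    rw [List.append_assoc, List.append_assoc, isDoubled_append hl, isDoubled_append hl]
    cases l₂ <;> simp [IsDoubled]

theorem eq_of_isDoubled {A : Type*} {l₁ l₂ : List A} {x y : A} (he : Even l₁.length)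
    (h : IsDoubled (l₁ ++ [x] ++ y :: l₂)) : x = y := by
  rw [List.append_assoc, isDoubled_append he] at h
  exact h.2.1

/-- The model whose states are lists of spins occurring in pairs. -/
noncomputable def faceModel (K : Type) [Field K] (n : ℕ) :
    TLModel K (fun i => if Even i then (n : K) else 1) 0 where
  A := Fin n
  ok := IsDoubled
  cre := faceCoef
  ann := faceCoef
  wt _ := 1
  ok_nil := trivial
  wt_nil := rfl
  adj _ _ _ _ _ := by ring
  ok_cre g l₁ u l₂ _ h h' := by
    obtain ⟨-, a, rfl, ha⟩ := faceCoef_ne_zero h'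
    exact (isDoubled_insert ha).mp h
  ok_ann g l₁ u l₂ _ h h' := by
    obtain ⟨-, a, rfl, ha⟩ := faceCoef_ne_zero h'
    exact (isDoubled_insert ha).mpr h
  far g l₁ u l₂ g' _ h' := by
    rw [or_self] at h'
    obtain ⟨-, a, rfl, ha⟩ := faceCoef_ne_zero h'
    have h : (faceCoef g' (l₁ ++ ([a, a] ++ l₂)) : List (Fin n) → K) =
        faceCoef g' (l₁ ++ l₂) := by
      have h1 : Even (l₁ ++ ([a, a] ++ l₂)).length ↔ Even (l₁ ++ l₂).length := by
        simp only [List.length_append, List.length_cons, List.length_nil]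
        rw [show l₁.length + (0 + 1 + 1 + l₂.length) = l₁.length + l₂.length + 2 by ring]
        simp [Nat.even_add]
      -- The last spin can change only if nothing stands to the right and `l₁` has even length, and
      -- then the condition on it is irrelevant.
      have h2 : ∀ c, (Even (l₁ ++ l₂).length ∨ (l₁ ++ ([a, a] ++ l₂)).getLast? = some c) ↔
          (Even (l₁ ++ l₂).length ∨ (l₁ ++ l₂).getLast? = some c) := by
        intro c
        rcases List.eq_nil_or_concat l₂ with rfl | ⟨l', x, rfl⟩
        · rcases ha with ha | ha
          · simp [ha]
          · rw [List.append_nil, List.append_nil, ha]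
            simp
        · rw [List.concat_eq_append]
          simp only [← List.append_assoc, List.getLast?_append, List.getLast?_singleton,
            Option.some_or]
      funext u
      unfold faceCoef
      split
      · rename_i b c
        simp only [h1, h2]
      · rfl
    exact ⟨h, h⟩
  ann_cre_cup l₁ l₂ h := by
    by_cases he : Even l₁.length
    · simp [faceCoef, he]
    · obtain ⟨l, x, rfl, hl⟩ := exists_of_odd he
      simp only [faceCoef, he, false_or, List.getLast?_append, List.getLast?_singleton,
        Option.some_or, Option.some.injEq]
      simp [ite_and]
  ann_cre_dot _ _ _ := by simp [faceCoef]
  zig l₁ x l₂ h a := by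
    by_cases he : Even l₁.length
    · have he' : ¬ Even (l₁ ++ [a]).length := by simpa [Nat.even_add_one] using he
      simp only [faceCoef, he, he', false_or, List.getLast?_append, List.getLast?_singleton,
        Option.some_or, Option.some.injEq]
      simp +contextual [ite_and]
    · obtain ⟨l, y, rfl, hl⟩ := exists_of_odd he
      have he' : Even (l ++ [y] ++ [a]).length := by simpa [Nat.even_add_one] using hl
      obtain rfl := eq_of_isDoubled hl h
      simp only [faceCoef, he, he', false_or, List.getLast?_append, List.getLast?_singleton,
        Option.some_or, Option.some.injEq]
      simp +contextual [ite_and, eq_comm]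
  zag l₁ x l₂ h b := by
    by_cases he : Even l₁.length
    · have he' : ¬ Even (l₁ ++ [x]).length := by simpa [Nat.even_add_one] using he
      simp only [faceCoef, he, he', false_or, List.getLast?_append, List.getLast?_singleton,
        Option.some_or, Option.some.injEq]
      simp +contextual [eq_comm]
    · obtain ⟨l, y, rfl, hl⟩ := exists_of_odd he
      have he' : Even (l ++ [y] ++ [x]).length := by simpa [Nat.even_add_one] using hl
      obtain rfl := eq_of_isDoubled hl h
      simp only [faceCoef, he, he', false_or, List.getLast?_append, List.getLast?_singleton,
        Option.some_or, Option.some.injEq]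
      simp +contextual [eq_comm]
  ann_cup_dot_left _ _ := by simp [faceCoef]
  ann_cup_dot_right _ _ := by simp [faceCoef]
  ann_dot_cup_left _ _ := by simp [faceCoef]
  ann_dot_cup_right _ _ := by simp [faceCoef]

end spin

/-! ### The vectors of the partitions -/

section delta

variable {K : Type} [Field K]

open Classical in
/-- The truth value of `p`, as an element of `K`. -/
noncomputable def ind (K : Type) [Field K] (p : Prop) : K := if p then 1 else 0

theorem ind_congr {p q : Prop} (h : p ↔ q) : ind K p = ind K q := by rw [propext h]

theorem ind_and (p q : Prop) : ind K (p ∧ q) = ind K p * ind K q := by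
  unfold ind; split_ifs <;> simp_all

theorem ind_of {p : Prop} (h : p) : ind K p = 1 := if_pos h

theorem ind_of_not {p : Prop} (h : ¬ p) : ind K p = 0 := if_neg h

theorem ite_eq_ind (p : Prop) [Decidable p] : (if p then 1 else 0 : K) = ind K p := by
  unfold ind; split_ifs <;> rfl

/-- The indicator function of the lists that are constant on the blocks. -/
noncomputable def pairDelta {A : Type*} (K : Type) [Field K] (π : LinePartition) (l : List A) : K :=
  ind K (∀ x y, π.rel x y → l[x]? = l[y]?)

/-- The indicator function of the doubled lists that are constant on the blocks. -/
noncomputable def sideDelta {A : Type*} (K : Type) [Field K] (π : LinePartition) (l : List A) : K :=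
  ind K (∀ x y, π.rel x y → l[2 * x]? = l[2 * y]?)

theorem getElem?_shift {A : Type*} (l₁ u l₂ : List A) (x : ℕ) :
    (l₁ ++ (u ++ l₂))[shift u.length l₁.length x]? = (l₁ ++ l₂)[x]? := by
  unfold shift
  split_ifs with h
  · rw [List.getElem?_append_left h, List.getElem?_append_left h]
  · rw [List.getElem?_append_right (by omega), List.getElem?_append_right (by omega),
      List.getElem?_append_right (by omega)]
    congr 1; omega

theorem forall_insRel {B : Type*} {a i : ℕ} {r : Setoid ℕ} {f f' : ℕ → B}
    (h : ∀ x, f' (shift a i x) = f x) :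
    (∀ x y, insRel a i r x y → f' x = f' y) ↔
      (∀ x y, InBlock a i x → InBlock a i y → f' x = f' y) ∧ ∀ x y, r x y → f x = f y := by
  constructor
  · intro H
    refine ⟨fun x y hx hy => H x y (.inl ⟨hx, hy⟩), fun x y hxy => ?_⟩
    rw [← h, ← h]
    exact H _ _ (insRel_shift.mpr hxy)
  · rintro ⟨H1, H2⟩ x y hxy
    rcases insRel_iff.mp hxy with ⟨hx, hy⟩ | ⟨hx, hy, hxy⟩
    · exact H1 x y hx hy
    · have := H2 _ _ hxy
      rwa [← h, ← h, shift_unshift hx, shift_unshift hy] at this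

theorem inBlock_one {i x y : ℕ} (hx : InBlock 1 i x) (hy : InBlock 1 i y) : x = y := by
  simp only [InBlock] at hx hy; omega

theorem pairDelta_insBlock_one {A : Type*} (π : LinePartition) (l₁ l₂ : List A) (a : A)
    (hi : l₁.length ≤ π.size) :
    pairDelta K (π.insBlock 1 l₁.length hi) (l₁ ++ ([a] ++ l₂)) = pairDelta K π (l₁ ++ l₂) :=
  ind_congr ((forall_insRel (r := π.rel) (f := fun x => (l₁ ++ l₂)[x]?)
    (f' := fun x => (l₁ ++ ([a] ++ l₂))[x]?) (fun x => getElem?_shift l₁ [a] l₂ x)).trans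
    (and_iff_right fun _ _ hx hy => by rw [inBlock_one hx hy]))

theorem pairDelta_insBlock_two {A : Type*} (π : LinePartition) (l₁ l₂ : List A) (a b : A)
    (hi : l₁.length ≤ π.size) :
    pairDelta K (π.insBlock 2 l₁.length hi) (l₁ ++ ([a, b] ++ l₂)) =
      ind K (a = b) * pairDelta K π (l₁ ++ l₂) := by
  have h1 : (l₁ ++ ([a, b] ++ l₂))[l₁.length]? = some a := by simp
  have h2 : (l₁ ++ ([a, b] ++ l₂))[l₁.length + 1]? = some b := by
    rw [List.getElem?_append_right (by omega)]; simp
  unfold pairDelta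
  rw [← ind_and]
  refine ind_congr ((forall_insRel (r := π.rel) (f := fun x => (l₁ ++ l₂)[x]?)
    (f' := fun x => (l₁ ++ ([a, b] ++ l₂))[x]?)
    (fun x => getElem?_shift l₁ [a, b] l₂ x)).trans (and_congr_left fun _ => ?_))
  constructor
  · intro h
    have := h l₁.length (l₁.length + 1) (by simp [InBlock]) (by simp [InBlock])
    simp only [h1, h2] at this
    exact Option.some.inj this
  · rintro rfl y z hy hz
    simp only [InBlock, List.length_cons, List.length_nil] at hy hz
    rcases (show y = l₁.length ∨ y = l₁.length + 1 by omega) with rfl | rfl <;>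
      rcases (show z = l₁.length ∨ z = l₁.length + 1 by omega) with rfl | rfl <;>
      simp only [h1, h2]

theorem sideDelta_insBlock {A : Type*} (π : LinePartition) (l₁ l₂ : List A) (a b : A) {j : ℕ}
    (hj : l₁.length = 2 * j) (hi : j ≤ π.size) :
    sideDelta K (π.insBlock 1 j hi) (l₁ ++ ([a, b] ++ l₂)) = sideDelta K π (l₁ ++ l₂) := by
  refine ind_congr ((forall_insRel (r := π.rel) (f := fun x => (l₁ ++ l₂)[2 * x]?)
    (f' := fun x => (l₁ ++ ([a, b] ++ l₂))[2 * x]?) (fun x => ?_)).trans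
    (and_iff_right fun _ _ hx hy => by rw [inBlock_one hx hy]))
  rw [← getElem?_shift l₁ [a, b] l₂ (2 * x)]
  congr 1
  simp only [shift, hj, List.length_cons, List.length_nil]
  split_ifs <;> omega

/-- Spins are read on left sides: the old point at `2 * j` shows `x`, its double at `2 * j + 2`
shows `b`, and being in one block they must agree. -/
theorem sideDelta_dup {A : Type*} (π : LinePartition) (l l₂ : List A) (x b : A) {j : ℕ}
    (hj : l.length = 2 * j) (hi : j < π.size) :
    sideDelta K (π.dup j hi) (l ++ [x] ++ ([x, b] ++ l₂)) =
      ind K (x = b) * sideDelta K π (l ++ [x] ++ l₂) := by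
  have hr : ∀ y z, (π.dup j hi).rel y z ↔
    π.rel (unshift 1 (j + 1) y) (unshift 1 (j + 1) z) := fun y z => Iff.rfl
  have u1 : unshift 1 (j + 1) j = j := by simp [unshift]
  have u2 : unshift 1 (j + 1) (j + 1) = j := by simp [unshift]
  have e1 : (l ++ [x] ++ ([x, b] ++ l₂))[2 * j]? = some x := by
    rw [← hj]; simp
  have e2 : (l ++ [x] ++ ([x, b] ++ l₂))[2 * (j + 1)]? = some b := by
    rw [show 2 * (j + 1) = l.length + 2 by omega]; simp
  by_cases hxb : x = b
  · subst hxb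
    rw [ind_of rfl, one_mul]
    have hget : ∀ y, (l ++ [x] ++ ([x, x] ++ l₂))[2 * y]? =
        (l ++ [x] ++ l₂)[2 * unshift 1 (j + 1) y]? := by
      intro y
      by_cases hy : y = j + 1
      · subst hy
        rw [e2, u2, ← hj]
        simp
      · rw [← getElem?_shift (l ++ [x]) [x, x] l₂]
        congr 1
        simp only [shift, unshift, hj, List.length_cons, List.length_nil, List.length_append]
        split_ifs <;> omega
    refine ind_congr ⟨fun h y z hyz => ?_, fun h y z hyz => ?_⟩
    · have hu : ∀ y, unshift 1 (j + 1) (shift 1 (j + 1) y) = y := unshift_shift _ _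
      have := h (shift 1 (j + 1) y) (shift 1 (j + 1) z) (by rw [hr, hu, hu]; exact hyz)
      rwa [hget, hget, hu, hu] at this
    · rw [hget, hget]
      exact h _ _ hyz
  · rw [ind_of_not hxb, zero_mul]
    refine ind_of_not fun h => hxb ?_
    have := h j (j + 1) (by rw [hr, u1, u2])
    rw [e1, e2] at this
    exact Option.some.inj this

theorem pairFamily_isRealization (fl : Bool) (n : ℕ) :
    (pairFamily fl).IsRealization (vertexModel K fl n) (fun x => pairDelta K x.1) where
  empty := ind_of (by simp)
  ins := by
    intro g x (l₁ : List (Fin n)) (u : List (Fin n)) (l₂ : List (Fin n)) hg hu hlen _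
    have hi : l₁.length ≤ x.1.size := by
      rw [← LinePartition.length_pairCode]
      have h : l₁.length ≤ (l₁ ++ l₂).length := by simp
      exact h.trans_eq hlen
    change pairDelta K (pairIns fl g l₁.length x).1 _ = vertexCoef fl g u * pairDelta K x.1 _
    rw [pairIns_of_le hi hg]
    cases g
    · obtain ⟨a, rfl⟩ := List.length_eq_one_iff.mp hu
      simp only [vertexCoef, hg rfl, if_true, one_mul]
      exact pairDelta_insBlock_one _ _ _ _ _
    · obtain ⟨a, b, rfl⟩ := List.length_eq_two.mp hu
      simp only [vertexCoef, ite_eq_ind]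
      exact pairDelta_insBlock_two _ _ _ _ _ _

theorem sideFamily_isRealization (n : ℕ) :
    sideFamily.IsRealization (faceModel K n) (fun x => sideDelta K x) where
  empty := ind_of (by simp)
  ins := by
    intro g π (l₁ : List (Fin n)) (u : List (Fin n)) (l₂ : List (Fin n)) hg hu
      (hlen : _ = π.sideCode.length) (hok : IsDoubled _)
    cases g
    · simp at hg
    obtain ⟨a, b, rfl⟩ := (List.length_eq_two (α := Fin n)).mp hu
    rw [LinePartition.length_sideCode] at hlen
    replace hlen : l₁.length + l₂.length = 2 * π.size := by
      rw [← List.length_append]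
      exact hlen
    change sideDelta K (sideIns true l₁.length π) _ = faceCoef true l₁ [a, b] * sideDelta K π _
    simp only [faceCoef, ite_eq_ind]
    obtain ⟨j, hj | hj⟩ := Nat.even_or_odd' l₁.length
    · have hev : Even l₁.length := hj ▸ even_two_mul j
      have hab : a = b := ((isDoubled_append hev).mp hok).2.1
      rw [hj, sideIns_even (by omega), ind_of ⟨hab, .inl (even_two_mul j)⟩, one_mul]
      exact sideDelta_insBlock _ _ _ _ _ hj _
    · have hodd : ¬ Even l₁.length := by rw [hj]; simp
      obtain ⟨l, x, rfl, hl⟩ := exists_of_odd (A := Fin n) hodd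
      have hlj : l.length = 2 * j := by simpa using hj
      have hxa : x = a := eq_of_isDoubled hl hok
      subst hxa
      rw [hj, sideIns_odd (by omega)]
      have : (x = b ∧ (Even (2 * j + 1) ∨ (l ++ [x]).getLast? = some x)) ↔ x = b := by simp
      rw [ind_congr this]
      exact sideDelta_dup _ _ _ _ _ hlj _

end delta

open Step

/-! ### Counting paths -/

/-- The number of paths of length `m` on `ℕ` from `a` to `c`. -/
def walk (fl : Bool) : ℕ → ℕ → ℕ → ℕ
  | 0, a, c => if a = c then 1 else 0
  | m + 1, a, c => walk fl m (a + 1) c + (if 0 < a then walk fl m (a - 1) c else 0) +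
      (if fl = true then walk fl m a c else 0)

theorem walk_succ (fl : Bool) (m a c : ℕ) : walk fl (m + 1) a c =
    walk fl m (a + 1) c + (if 0 < a then walk fl m (a - 1) c else 0) +
      (if fl = true then walk fl m a c else 0) := rfl

/-- Walks are split at their last step instead of their first; the comparison of the two recurrences
yields invariance under reversal. -/
theorem walk_succ_right (fl : Bool) (m a c : ℕ) : walk fl (m + 1) a c =
    walk fl m a (c + 1) + (if 0 < c then walk fl m a (c - 1) else 0) +
      (if fl = true then walk fl m a c else 0) := by
  induction m generalizing a with
  | zero =>
    simp only [walk]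
    split_ifs <;> omega
  | succ m ih =>
    have h1 := ih (a + 1)
    have h2 := ih (a - 1)
    have h3 := ih a
    have h4 := walk_succ fl m a (c + 1)
    have h5 := walk_succ fl m a (c - 1)
    have h6 := walk_succ fl m a c
    rw [walk_succ]
    split_ifs at * <;> omega

theorem walk_comm (fl : Bool) (m a c : ℕ) : walk fl m a c = walk fl m c a := by
  induction m generalizing a c with
  | zero => simp only [walk, eq_comm]
  | succ m ih => rw [walk_succ, walk_succ_right, ih, ih (a - 1), ih a]

/-- The number of paths of length `m` from height `r` to height zero. -/
def ball (fl : Bool) (m r : ℕ) : ℕ := walk fl m r 0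

theorem ball_zero (fl : Bool) (r : ℕ) : ball fl 0 r = if r = 0 then 1 else 0 := rfl

theorem ball_succ (fl : Bool) (m r : ℕ) : ball fl (m + 1) r =
    ball fl m (r + 1) + (if 0 < r then ball fl m (r - 1) else 0) +
      (if fl = true then ball fl m r else 0) := rfl

/-- First-passage decomposition: a path from `h + t + 1` to zero first stays above height `h`, then
steps down to `h`, then runs from `h` to zero. The induction follows the first step of the part
above `h`. -/
theorem sum_ball_mul_ball (fl : Bool) (m h t : ℕ) :
    ∑ i ∈ Finset.range m, ball fl i h * ball fl (m - 1 - i) t = ball fl m (h + t + 1) := by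
  induction m generalizing t with
  | zero => simp [ball_zero]
  | succ m ih =>
    rw [Finset.sum_range_succ, ball_succ]
    have : ∀ i ∈ Finset.range m, ball fl i h * ball fl (m + 1 - 1 - i) t =
        ball fl i h * ball fl (m - 1 - i) (t + 1) +
          (if 0 < t then ball fl i h * ball fl (m - 1 - i) (t - 1) else 0) +
          (if fl = true then ball fl i h * ball fl (m - 1 - i) t else 0) := by
      intro i hi
      rw [Finset.mem_range] at hi
      rw [show m + 1 - 1 - i = (m - 1 - i) + 1 by omega, ball_succ]
      split_ifs <;> ring
    rw [Finset.sum_congr rfl this, Finset.sum_add_distrib, Finset.sum_add_distrib, ih]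
    have e1 : ∑ i ∈ Finset.range m, (if 0 < t then ball fl i h * ball fl (m - 1 - i) (t - 1)
        else 0) = if 0 < t then ball fl m (h + t) else 0 := by
      split_ifs with ht
      · rw [ih, show h + (t - 1) + 1 = h + t by omega]
      · simp
    have e2 : ∑ i ∈ Finset.range m, (if fl = true then ball fl i h * ball fl (m - 1 - i) t
        else 0) = if fl = true then ball fl m (h + t + 1) else 0 := by
      split_ifs
      · rw [ih]
      · simp
    rw [e1, e2]
    rw [if_pos (Nat.succ_pos _), show m + 1 - 1 - m = 0 by omega,
      show h + (t + 1) + 1 = h + t + 1 + 1 by omega]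
    rcases Nat.eq_zero_or_pos t with rfl | ht
    · simp [ball_zero]; ring
    · have : ¬ t = 0 := by omega
      simp [ball_zero, ht, this]

/-! ### Up-steps by height, and weights expressed through them. -/

/-- The number of up-steps from height `s` in a path from height `h`. -/
def upCount (s : ℕ) : ℕ → List Step → ℕ
  | _, [] => 0
  | h, up :: l => (if h = s then 1 else 0) + upCount s (h + 1) l
  | h, down :: l => upCount s (h - 1) l
  | h, flat :: l => upCount s h l

open Classical in
theorem sumLists_isPath_succ {fl : Bool} {m h : ℕ} (G : List Step → ℕ) :
    sumLists (m + 1) (fun l => if IsPath fl h l then G l else 0) =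
      sumLists m (fun l => if IsPath fl (h + 1) l then G (up :: l) else 0) +
        ((if 0 < h then sumLists m (fun l => if IsPath fl (h - 1) l then G (down :: l) else 0)
          else 0) +
        if fl = true then sumLists m (fun l => if IsPath fl h l then G (flat :: l) else 0)
          else 0) := by
  refine (Step.sum_univ _).trans (congrArg₂ _ rfl (congrArg₂ _ ?_ ?_))
  · split_ifs with hh
    · exact sumLists_congr fun l _ => if_congr (and_iff_right hh) rfl rfl
    · refine (sumLists_congr fun l _ => ?_).trans (sumLists_zero (A := Step) m)
      exact if_neg fun (h' : IsPath fl h (down :: l)) => hh h'.1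
  · split_ifs with hh
    · exact sumLists_congr fun l _ => if_congr (and_iff_right hh) rfl rfl
    · refine (sumLists_congr fun l _ => ?_).trans (sumLists_zero (A := Step) m)
      exact if_neg fun (h' : IsPath fl h (flat :: l)) => hh h'.1

open Classical in
theorem sumLists_ball (fl : Bool) (m r : ℕ) :
    sumLists m (fun l => if IsPath fl r l then 1 else 0) = ball fl m r := by
  induction m generalizing r with
  | zero => rw [ball_zero]; exact if_congr Iff.rfl rfl rfl
  | succ m ih => rw [sumLists_isPath_succ, ih, ih, ih, ball_succ, add_assoc]

open Classical in
-- A path with a marked up-step at time `i` is a walk to height `s` followed by a path from `s + 1`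
-- to zero.
theorem sumLists_upCount (fl : Bool) (m h s : ℕ) :
    sumLists m (fun l => if IsPath fl h l then upCount s h l else 0) =
      ∑ i ∈ Finset.range m, walk fl i h s * ball fl (m - 1 - i) (s + 1) := by
  induction m generalizing h with
  | zero => simp [sumLists, upCount]
  | succ m ih =>
    rw [sumLists_isPath_succ]
    simp only [upCount, ih]
    have hadd : ∀ (F G : List Step → ℕ), sumLists m (fun l => F l + G l) =
        sumLists m F + sumLists m G := by
      intro F G
      rw [sumLists_eq_sum, sumLists_eq_sum, sumLists_eq_sum, Finset.sum_add_distrib]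
    have e1 : sumLists m (fun l => if IsPath fl (h + 1) l then
        (if h = s then 1 else 0) + upCount s (h + 1) l else 0) =
        (if h = s then ball fl m (s + 1) else 0) +
          ∑ i ∈ Finset.range m, walk fl i (h + 1) s * ball fl (m - 1 - i) (s + 1) := by
      rw [← ih, ← sumLists_ball]
      split_ifs with hs
      · subst hs
        rw [← hadd]
        exact sumLists_congr fun l _ => by split_ifs <;> rfl
      · rw [zero_add]
        exact sumLists_congr fun l _ => by split_ifs <;> simp
    rw [e1, Finset.sum_range_succ']
    have e3 : ∀ i ∈ Finset.range m, walk fl (i + 1) h s * ball fl (m + 1 - 1 - (i + 1)) (s + 1) =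
        walk fl i (h + 1) s * ball fl (m - 1 - i) (s + 1) +
        ((if 0 < h then walk fl i (h - 1) s * ball fl (m - 1 - i) (s + 1) else 0) +
        (if fl = true then walk fl i h s * ball fl (m - 1 - i) (s + 1) else 0)) := by
      intro i _
      rw [show m + 1 - 1 - (i + 1) = m - 1 - i by omega, walk_succ]
      split_ifs <;> ring
    rw [Finset.sum_congr rfl e3, Finset.sum_add_distrib, Finset.sum_add_distrib]
    have e0 : walk fl 0 h s * ball fl (m + 1 - 1 - 0) (s + 1) =
        if h = s then ball fl m (s + 1) else 0 := by
      simp [walk]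
    rw [e0]
    by_cases h1 : 0 < h <;> by_cases h2 : fl = true <;> simp only [h1, h2, if_true, if_false,
      Finset.sum_const_zero, Bool.false_eq_true] <;> ring

open Classical in
/-- The total number of up-steps from height `s` in all paths. -/
theorem sumLists_upCount_zero (fl : Bool) (m s : ℕ) :
    sumLists m (fun l => if IsPath fl 0 l then upCount s 0 l else 0) = ball fl m (2 * s + 2) := by
  rw [sumLists_upCount]
  -- By reversal, walks from zero to `s` are counted by ballot numbers too, so the convolution
  -- identity applies.
  have h : ∀ i ∈ Finset.range m, walk fl i 0 s * ball fl (m - 1 - i) (s + 1) =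
      ball fl i s * ball fl (m - 1 - i) (s + 1) := fun i _ => by rw [walk_comm]; rfl
  rw [Finset.sum_congr rfl h, sum_ball_mul_ball]
  congr 1; ring

theorem ball_eq_zero {fl : Bool} {m r : ℕ} (h : m < r) : ball fl m r = 0 := by
  induction m generalizing r with
  | zero => simp [ball_zero]; omega
  | succ m ih =>
    rw [ball_succ]
    have h1 := ih (r := r + 1) (by omega)
    have h2 := ih (r := r - 1) (by omega)
    have h3 := ih (r := r) (by omega)
    simp [h1, h2, h3]

/-- Alternating sums of ballot numbers telescope. -/
theorem sum_neg_one_pow_mul_ball (m N : ℕ) :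
    ∑ r ∈ Finset.range (N + 1), (-1 : ℤ) ^ r * ball false (m + 1) (2 * r) =
      (-1) ^ N * ball false m (2 * N + 1) := by
  induction N with
  | zero => simp [ball_succ]
  | succ N ih =>
    rw [Finset.sum_range_succ, ih, ball_succ, if_pos (by omega),
      show 2 * (N + 1) - 1 = 2 * N + 1 by omega]
    simp
    ring

/-- The signed number of up-steps. -/
def signedUps : ℕ → List Step → ℤ
  | _, [] => 0
  | h, up :: l => (-1) ^ h + signedUps (h + 1) l
  | h, down :: l => signedUps (h - 1) l
  | h, flat :: l => signedUps h l

theorem prod_pow_upCount {K : Type*} [CommMonoid K] (ρ : ℕ → K) (N : ℕ) {h : ℕ} {l : List Step}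
    (hN : h + l.length ≤ N) :
    pathWeight ρ 1 h l = ∏ s ∈ Finset.range N, ρ s ^ upCount s h l := by
  induction l generalizing h with
  | nil => simp [pathWeight, upCount]
  | cons a l ih =>
    simp only [List.length_cons] at hN
    cases a
    · simp only [pathWeight, upCount, pow_add]
      rw [ih (by omega), Finset.prod_mul_distrib]
      congr 1
      rw [Finset.prod_eq_single h]
      · simp
      · intro b _ hb
        rw [if_neg hb.symm, pow_zero]
      · intro hh
        exact absurd (Finset.mem_range.mpr (by omega)) hh
    · exact ih (by omega)
    · rw [pathWeight, one_mul]
      exact ih (by omega)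

theorem pathWeight_eq_mul {K : Type*} [CommMonoid K] (ρ : ℕ → K) (w : K) (h : ℕ) (l : List Step) :
    pathWeight ρ w h l = w ^ l.count flat * pathWeight ρ 1 h l := by
  induction l generalizing h with
  | nil => simp [pathWeight]
  | cons a l ih =>
    cases a <;> simp only [pathWeight, ih] <;> simp
    · rw [mul_left_comm]
    · rw [pow_succ', mul_assoc]

theorem pathWeight_zpow {K : Type*} [Field K] (ρ : ℕ → K) {n : K} (hn : n ≠ 0) (h : ℕ)
    (l : List Step) :
    pathWeight (fun h => n ^ ((-1 : ℤ) ^ h) * ρ h) 1 h l =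
      n ^ signedUps h l * pathWeight ρ 1 h l := by
  induction l generalizing h with
  | nil => simp [pathWeight, signedUps]
  | cons a l ih =>
    cases a <;> simp only [pathWeight, signedUps, ih, one_mul]
    rw [zpow_add₀ hn]
    ring

theorem signedUps_append (h : ℕ) (l₁ l₂ : List Step) :
    signedUps h (l₁ ++ l₂) = signedUps h l₁ + signedUps (level h l₁) l₂ := by
  induction l₁ generalizing h with
  | nil => simp [signedUps, level]
  | cons a l ih => cases a <;> simp [signedUps, level, ih, add_assoc]

theorem signedUps_eq_sum (N : ℕ) {h : ℕ} {l : List Step} (hN : h + l.length ≤ N) :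
    signedUps h l = ∑ s ∈ Finset.range N, (-1 : ℤ) ^ s * upCount s h l := by
  induction l generalizing h with
  | nil => simp [signedUps, upCount]
  | cons a l ih =>
    simp only [List.length_cons] at hN
    cases a
    · simp only [signedUps, upCount, Nat.cast_add, mul_add]
      rw [ih (by omega), Finset.sum_add_distrib]
      congr 1
      rw [Finset.sum_eq_single h]
      · simp
      · intro b _ hb
        rw [if_neg hb.symm, Nat.cast_zero, mul_zero]
      · intro hh
        exact absurd (Finset.mem_range.mpr (by omega)) hh
    · exact ih (by omega)
    · exact ih (by omega)

/-! ### Up-step statistics summed over a coded family. -/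

namespace CodedFamily

variable {fl : Bool} {X : Type*} (F : CodedFamily fl X) {ι : Type*} [Fintype ι] {m : ℕ}
  {e : ι → X} (he : Function.Injective e) (hrange : ∀ x, (∃ i, e i = x) ↔ (F.code x).length = m)

include he hrange

theorem sum_upCount (s : ℕ) : ∑ i, upCount s 0 (F.code (e i)) = ball fl m (2 * s + 2) := by
  classical
  rw [← sumLists_upCount_zero, sumLists_isPath (F.code_injective.comp he)
    (fun i => (hrange _).mp ⟨i, rfl⟩)
    (fun p hp hpm => by
      obtain ⟨x, hx⟩ := F.exists_code hp
      obtain ⟨k, hk⟩ := (hrange x).mpr (by rw [hx, hpm])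
      exact ⟨k, by simp [hk, hx]⟩) _ (fun l hl => if_neg hl)]
  exact Finset.sum_congr rfl fun i _ => (if_pos (F.isPath_code (e i))).symm

theorem card_eq_ball : Fintype.card ι = ball fl m 0 := by
  classical
  rw [← sumLists_ball, sumLists_isPath (F.code_injective.comp he)
    (fun i => (hrange _).mp ⟨i, rfl⟩)
    (fun p hp hpm => by
      obtain ⟨x, hx⟩ := F.exists_code hp
      obtain ⟨k, hk⟩ := (hrange x).mpr (by rw [hx, hpm])
      exact ⟨k, by simp [hk, hx]⟩) _ (fun l hl => if_neg hl)]
  have : ∀ i, (if IsPath fl 0 ((F.code ∘ e) i) then 1 else 0) = 1 := fun i =>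
    if_pos (F.isPath_code (e i))
  rw [Finset.sum_congr rfl fun i _ => this i]
  simp

theorem prod_pathWeight {K : Type*} [CommMonoid K] (ρ : ℕ → K) :
    ∏ i, pathWeight ρ 1 0 (F.code (e i)) =
      ∏ s ∈ Finset.range m, ρ s ^ ball fl m (2 * s + 2) := by
  have h : ∀ i, 0 + (F.code (e i)).length ≤ m := fun i => by
    rw [zero_add, (hrange _).mp ⟨i, rfl⟩]
  rw [Finset.prod_congr rfl fun i _ => prod_pow_upCount ρ m (h i), Finset.prod_comm]
  refine Finset.prod_congr rfl fun s _ => ?_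
  rw [Finset.prod_pow_eq_pow_sum, F.sum_upCount he hrange]

theorem sum_signedUps : ∑ i, signedUps 0 (F.code (e i)) =
    ∑ s ∈ Finset.range m, (-1 : ℤ) ^ s * ball fl m (2 * s + 2) := by
  have h : ∀ i, 0 + (F.code (e i)).length ≤ m := fun i => by
    rw [zero_add, (hrange _).mp ⟨i, rfl⟩]
  rw [Finset.sum_congr rfl fun i _ => signedUps_eq_sum m (h i), Finset.sum_comm]
  refine Finset.sum_congr rfl fun s _ => ?_
  rw [← Finset.mul_sum, ← F.sum_upCount he hrange, Nat.cast_sum]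

end CodedFamily

/-- The alternating sum over all even heights, zero included, telescopes to 0. For positive `m` what
remains is the number of paths from zero to zero. This sum is `a_k` for thickened blocks; its sign
makes `n ^ a_k` a polynomial. -/
theorem sum_signed_ball_nonneg (m : ℕ) :
    0 ≤ ∑ s ∈ Finset.range m, (-1 : ℤ) ^ s * ball false m (2 * s + 2) := by
  cases m with
  | zero => simp
  | succ m =>
    have h := sum_neg_one_pow_mul_ball m (m + 1)
    rw [ball_eq_zero (show m < 2 * (m + 1) + 1 by omega), Finset.sum_range_succ'] at h
    have e : ∑ s ∈ Finset.range (m + 1), (-1 : ℤ) ^ s * ball false (m + 1) (2 * s + 2) =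
        ball false (m + 1) 0 := by
      rw [← sub_eq_zero]
      simp only [pow_succ, mul_neg, mul_one, neg_mul, Finset.sum_neg_distrib, pow_zero, one_mul,
        Nat.cast_zero, mul_zero] at h
      have : ∀ s, 2 * (s + 1) = 2 * s + 2 := fun s => by ring
      simp only [this] at h
      linarith
    rw [e]
    positivity

open Step

/-! ### Two-row partitions as partitions of an initial segment -/

theorem position_injective {r k : ℕ} : Function.Injective (position : Fin r ⊕ Fin k → ℕ) := by
  rintro (⟨i, hi⟩ | ⟨i, hi⟩) (⟨j, hj⟩ | ⟨j, hj⟩) h <;>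
    simp only [position, Sum.inl.injEq, Sum.inr.injEq, Fin.mk.injEq, reduceCtorEq] at h ⊢ <;> omega

theorem position_lt {r k : ℕ} (a : Fin r ⊕ Fin k) : position a < r + k := by
  rcases a with ⟨i, hi⟩ | ⟨i, hi⟩ <;> simp only [position] <;> omega

theorem exists_position {r k x : ℕ} (h : x < r + k) : ∃ a : Fin r ⊕ Fin k, position a = x := by
  by_cases hx : x < r
  · exact ⟨Sum.inl ⟨x, hx⟩, rfl⟩
  · exact ⟨Sum.inr ⟨k - 1 - (x - r), by omega⟩, by simp only [position]; omega⟩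

/-- The points of the two rows in the order of their positions. -/
noncomputable def positionEquiv (r k : ℕ) : Fin r ⊕ Fin k ≃ Fin (r + k) :=
  Equiv.ofBijective (fun a => ⟨position a, position_lt a⟩)
    ⟨fun _ _ h => position_injective (Fin.mk.inj h),
      fun x => (exists_position x.2).imp fun _ h => Fin.ext h⟩

namespace RowPartition

variable {r k : ℕ}

/-- The partition of the positions. -/
def line (σ : RowPartition r k) (h : IsNoncrossing σ) : LinePartition where
  size := r + k
  rel :=
    { r := fun x y => x = y ∨ ∃ a b, position a = x ∧ position b = y ∧ σ a b
      iseqv := by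
        refine ⟨fun x => .inl rfl, ?_, ?_⟩
        · rintro x y (rfl | ⟨a, b, h1, h2, h3⟩)
          · exact .inl rfl
          · exact .inr ⟨b, a, h2, h1, σ.symm' h3⟩
        · rintro x y z (rfl | ⟨a, b, h1, h2, h3⟩)
          · exact id
          · rintro (rfl | ⟨b', c, h4, h5, h6⟩)
            · exact .inr ⟨a, b, h1, h2, h3⟩
            · obtain rfl := position_injective (h4.trans h2.symm)
              exact .inr ⟨a, c, h1, h5, σ.trans' h3 h6⟩ }
  lt_of_rel := by
    rintro x y (rfl | ⟨a, b, rfl, -, -⟩) hxy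
    · exact absurd rfl hxy
    · exact position_lt a
  noncrossing := by
    rintro x y z t hxy hyz hzt (rfl | ⟨a, c, rfl, rfl, h1⟩) h'
    · omega
    rcases h' with rfl | ⟨b, d, rfl, rfl, h2⟩
    · omega
    exact .inr ⟨a, b, rfl, rfl, h a b c d hxy hyz hzt h1 h2⟩

theorem line_rel {σ : RowPartition r k} {h : IsNoncrossing σ} {x y : ℕ} :
    (line σ h).rel x y ↔ x = y ∨ ∃ a b, position a = x ∧ position b = y ∧ σ a b := Iff.rfl

theorem line_rel_position {σ : RowPartition r k} {h : IsNoncrossing σ} {a b : Fin r ⊕ Fin k} :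
    (line σ h).rel (position a) (position b) ↔ σ a b := by
  rw [line_rel]
  constructor
  · rintro (e | ⟨a', b', h1, h2, h3⟩)
    · rw [position_injective e]
    · rwa [← position_injective h1, ← position_injective h2]
  · exact fun h => .inr ⟨a, b, rfl, rfl, h⟩

theorem line_injective {σ τ : RowPartition r k} {h : IsNoncrossing σ} {h' : IsNoncrossing τ}
    (e : line σ h = line τ h') : σ = τ := by
  ext a b
  rw [← line_rel_position (h := h), ← line_rel_position (h := h'), e]

theorem exists_line {π : LinePartition} (hπ : π.size = r + k) :
    ∃ (σ : RowPartition r k) (h : IsNoncrossing σ), line σ h = π := by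
  refine ⟨π.rel.comap position, fun a b c d h1 h2 h3 => π.noncrossing _ _ _ _ h1 h2 h3, ?_⟩
  ext1
  · exact hπ.symm
  · ext x y
    refine line_rel.trans ?_
    constructor
    · rintro (rfl | ⟨a, b, rfl, rfl, h⟩)
      · exact π.rel.refl' _
      · exact h
    · intro h
      by_cases hxy : x = y
      · exact .inl hxy
      · obtain ⟨a, rfl⟩ := exists_position ((π.lt_of_rel x y h hxy).trans_eq hπ)
        obtain ⟨b, rfl⟩ := exists_position
          ((π.lt_of_rel y _ (π.rel.symm' h) (Ne.symm hxy)).trans_eq hπ)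
        exact .inr ⟨a, b, rfl, rfl, h⟩

end RowPartition

/-- Noncrossing partitions into pairs and (if `fl` holds) singletons. -/
def ncPairingsOrDots (fl : Bool) : PartitionFamily := fun _ _ =>
  {π | IsNoncrossing π ∧ ∀ x, (fl = true ∧ Set.ncard {y | π x y} = 1) ∨ Set.ncard {y | π x y} = 2}

theorem ncPairings_eq : ncPairings = ncPairingsOrDots false := by
  funext r k
  simp [ncPairings, ncPairingsOrDots]

theorem ncSingletonsPairings_eq : ncSingletonsPairings = ncPairingsOrDots true := by
  funext r k
  simp [ncSingletonsPairings, ncPairingsOrDots]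

theorem RowPartition.isPairing_line_iff {r k : ℕ} {fl : Bool} {σ : RowPartition r k}
    (h : IsNoncrossing σ) : (line σ h).IsPairing fl ↔ σ ∈ ncPairingsOrDots fl r k := by
  constructor
  · refine fun H => ⟨h, fun x => ?_⟩
    by_cases hx : ∃ y, x ≠ y ∧ σ x y
    · obtain ⟨y, hne, hxy⟩ := hx
      refine .inr ((congrArg Set.ncard (Set.ext fun z => ?_)).trans (Set.ncard_pair hne))
      simp only [Set.mem_ofPred_eq, Set.mem_insert_iff, Set.mem_singleton_iff]
      constructor
      · intro hxz
        by_cases hzx : z = x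
        · exact .inl hzx
        · exact .inr (position_injective (H.eq_of_rel _ _ _ (line_rel_position.mpr hxz)
            (line_rel_position.mpr hxy) (position_injective.ne (Ne.symm hzx))
            (position_injective.ne hne)))
      · rintro (rfl | rfl)
        · exact σ.refl' _
        · exact hxy
    · push Not at hx
      refine .inl ⟨?_, ?_⟩
      · by_contra hfl
        obtain ⟨y, hne, hy⟩ := H.exists_rel (by simpa using hfl) (position x) (position_lt x)
        rcases line_rel.mp hy with e | ⟨a, b, ha, rfl, hab⟩
        · exact hne e
        · obtain rfl := position_injective ha
          exact hx b (fun e => hne (by rw [e])) hab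
      · rw [Set.ncard_eq_one]
        refine ⟨x, Set.ext fun z => ?_⟩
        simp only [Set.mem_ofPred_eq, Set.mem_singleton_iff]
        constructor
        · intro hz
          by_contra hne
          exact hx z (Ne.symm hne) hz
        · rintro rfl
          exact σ.refl' _
  · rintro ⟨-, H⟩
    constructor
    · rintro x y z hxy hxz hy hz
      rcases line_rel.mp hxy with e | ⟨a, b, rfl, rfl, hab⟩
      · exact absurd e hy
      rcases line_rel.mp hxz with e | ⟨a', c, ha, rfl, hac⟩
      · exact absurd e hz
      obtain rfl := position_injective ha
      have hab' : a' ≠ b := fun e => hy (by rw [e])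
      have hac' : a' ≠ c := fun e => hz (by rw [e])
      have ma : a' ∈ {y | σ a' y} := σ.refl' _
      have mb : b ∈ {y | σ a' y} := hab
      have mc : c ∈ {y | σ a' y} := hac
      rcases H a' with ⟨-, h1⟩ | h2
      · obtain ⟨p, hp⟩ := Set.ncard_eq_one.mp h1
        rw [hp] at ma mb
        exact absurd (ma.trans mb.symm) hab'
      · obtain ⟨p, q, -, hp⟩ := Set.ncard_eq_two.mp h2
        rw [hp] at ma mb mc
        simp only [Set.mem_insert_iff, Set.mem_singleton_iff] at ma mb mc
        congr 1
        rcases ma with rfl | rfl <;> rcases mb with rfl | rfl <;> rcases mc with rfl | rfl <;>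
          first | rfl | exact absurd rfl hab' | exact absurd rfl hac'
    · intro hfl x hx
      obtain ⟨a, rfl⟩ := exists_position hx
      have h2 := (H a).resolve_left (by simp [hfl])
      obtain ⟨p, q, hpq, hp⟩ := Set.ncard_eq_two.mp h2
      have ma : a ∈ {y | σ a y} := σ.refl' _
      have mp : p ∈ {y | σ a y} := by rw [hp]; simp
      have mq : q ∈ {y | σ a y} := by rw [hp]; simp
      rw [hp] at ma
      rcases ma with rfl | rfl
      · exact ⟨position q, position_injective.ne hpq, line_rel_position.mpr mq⟩
      · exact ⟨position p, position_injective.ne hpq.symm, line_rel_position.mpr mp⟩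

/-! ### The Gram matrix entries -/

section gram

variable {K : Type} [Field K]

open RowPartition

theorem pairDelta_ofFn {A : Type*} {r k : ℕ} {σ : RowPartition r k} (h : IsNoncrossing σ)
    (f : Fin (r + k) → A) : pairDelta K (line σ h) (List.ofFn f) =
      ind K (∀ a b, σ a b → f (positionEquiv r k a) = f (positionEquiv r k b)) := by
  have hf : ∀ a, (List.ofFn f)[position a]? = some (f (positionEquiv r k a)) := fun a =>
    (List.getElem?_ofFn).trans (dif_pos (position_lt a))
  refine ind_congr ⟨fun H a b hab => ?_, ?_⟩
  · exact Option.some_injective _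
      (by rw [← hf a, ← hf b]; exact H _ _ (line_rel_position.mpr hab))
  · rintro H x y (rfl | ⟨a, b, rfl, rfl, hab⟩)
    · rfl
    · rw [hf, hf, H a b hab]

/-- The product of the indicators selects the functions constant on the blocks of `σ ⊔ τ`; these are
the functions on its quotient. -/
theorem sumLists_pairDelta (n : ℕ) {r k : ℕ} {σ τ : RowPartition r k} (h : IsNoncrossing σ)
    (h' : IsNoncrossing τ) :
    sumLists (r + k) (fun l : List (Fin n) => pairDelta K (line σ h) l * pairDelta K (line τ h') l) =
      (n : K) ^ numBlocks (σ ⊔ τ) := by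
  classical
  rw [sumLists_eq_sum, ← ((positionEquiv r k).arrowCongr (Equiv.refl (Fin n))).sum_comp]
  have e : ∀ c : Fin r ⊕ Fin k → Fin n,
      pairDelta K (line σ h) (List.ofFn ((positionEquiv r k).arrowCongr (Equiv.refl _) c)) *
      pairDelta K (line τ h') (List.ofFn ((positionEquiv r k).arrowCongr (Equiv.refl _) c)) =
      if σ ⊔ τ ≤ Setoid.ker c then 1 else 0 := by
    intro c
    rw [ite_eq_ind, pairDelta_ofFn, pairDelta_ofFn, ← ind_and]
    refine ind_congr ?_
    rw [sup_le_iff]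
    simp [Setoid.le_def, Setoid.ker_def]
  rw [Finset.sum_congr rfl fun c _ => e c, Finset.sum_boole, ← Fintype.card_subtype,
    Fintype.card_congr (Setoid.liftEquiv (σ ⊔ τ)), ← Nat.card_eq_fintype_card, Nat.card_fun,
    numBlocks]
  simp

theorem form_pairDelta (fl : Bool) (n : ℕ) {r k : ℕ} {σ τ : RowPartition r k}
    (h : IsNoncrossing σ) (h' : IsNoncrossing τ) :
    (vertexModel K fl n).form (r + k) (pairDelta K (line σ h)) (pairDelta K (line τ h')) =
      (n : K) ^ numBlocks (σ ⊔ τ) := by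
  classical
  rw [← sumLists_pairDelta n h h']
  refine sumLists_congr fun l _ => ?_
  refine (if_pos trivial).trans ?_
  exact congrArg (· * _) (one_mul _)

/-- Doubling of all entries of a list. -/
def doubling {A : Type*} : List A → List A
  | [] => []
  | a :: l => a :: a :: doubling l

theorem getElem?_doubling {A : Type*} (l : List A) (x : ℕ) : (doubling l)[2 * x]? = l[x]? := by
  induction l generalizing x with
  | nil => simp [doubling]
  | cons a l ih =>
    cases x with
    | zero => rfl
    | succ x => simpa [doubling, mul_add] using ih x

theorem sideDelta_doubling {A : Type*} (π : LinePartition) (l : List A) :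
    sideDelta K π (doubling l) = pairDelta K π l := by
  simp only [sideDelta, pairDelta, getElem?_doubling]

open Classical in
theorem sumLists_isDoubled {A : Type*} [Fintype A] (m : ℕ) (F : List A → K) :
    sumLists (2 * m) (fun l => if IsDoubled l then F l else 0) =
      sumLists m (fun l => F (doubling l)) := by
  induction m generalizing F with
  | zero => exact if_pos trivial
  | succ m ih =>
    refine Finset.sum_congr rfl fun a _ => ?_
    have e : ∀ b, sumLists (2 * m) (fun l => if IsDoubled (a :: b :: l) then F (a :: b :: l)
        else 0) = if b = a then sumLists m (fun l => F (a :: a :: doubling l)) else 0 := by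
      intro b
      split_ifs with hab
      · subst hab
        rw [← ih fun l => F (b :: b :: l)]
        exact sumLists_congr fun l _ => if_congr (and_iff_right rfl) rfl rfl
      · refine (sumLists_congr fun l _ => ?_).trans (sumLists_zero (A := A) (2 * m))
        exact if_neg fun h => hab h.1.symm
    refine (Finset.sum_congr rfl fun b _ => e b).trans ?_
    simp [doubling]

theorem form_sideDelta (n : ℕ) {r k : ℕ} {σ τ : RowPartition r k}
    (h : IsNoncrossing σ) (h' : IsNoncrossing τ) :
    (faceModel K n).form (2 * (r + k)) (sideDelta K (line σ h)) (sideDelta K (line τ h')) =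
      (n : K) ^ numBlocks (σ ⊔ τ) := by
  classical
  rw [← sumLists_pairDelta n h h']
  refine (sumLists_isDoubled (A := Fin n) (r + k) _).trans (sumLists_congr fun l _ => ?_)
  exact congrArg₂ (· * ·) ((one_mul _).trans (sideDelta_doubling _ l)) (sideDelta_doubling _ l)

end gram

/-! ### The number of blocks -/

namespace CodedFamily.IsRealization

variable {K : Type} [Field K] {loop : ℕ → K} {z : K} {fl : Bool} {X : Type*}
  {F : CodedFamily fl X} {M : TLModel K loop z} {δ : X → List M.A → K}

theorem eq_insOp (hδ : F.IsRealization M δ) {g : Bool} (hg : g = false → fl = true) (x : X) {i : ℕ}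
    (hi : i ≤ (F.code x).length) {l : List M.A} (hok : M.ok l)
    (hl : l.length = (F.code x).length + arity g) :
    δ (F.ins g i x) l = M.insOp g i (δ x) l := by
  obtain ⟨l₁, l₂, rfl, rfl⟩ := TLModel.exists_append (i := i) (l := l) (by omega)
  obtain ⟨u, l₂, rfl, hu⟩ := TLModel.exists_append (i := arity g) (l := l₂) (by simp at hl; omega)
  rw [TLModel.insOp_append M _ _ rfl hu]
  exact hδ.ins g x l₁ u l₂ hg hu (by simp at hl ⊢; omega) hok

/-- By adjointness an insertion is undone by the matching removal, which leaves a loop or a closed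
dot. -/
theorem form_ins (hδ : F.IsRealization M δ) {g : Bool} (hg : g = false → fl = true) (x : X) {i : ℕ}
    (hi : i ≤ (F.code x).length) {m : ℕ} (hm : m = (F.code x).length + arity g) :
    M.form m (δ (F.ins g i x)) (δ (F.ins g i x)) =
      (if g = true then loop i else z) * M.form (F.code x).length (δ x) (δ x) := by
  subst hm
  rw [TLModel.form_congr_left M fun l h1 h2 => hδ.eq_insOp hg x hi h1 h2,
    TLModel.form_congr_right M fun l h1 h2 => hδ.eq_insOp hg x hi h1 h2, TLModel.form_insOp M hi,
    ← TLModel.form_mul_right]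
  refine TLModel.form_congr_right M fun l h1 h2 => ?_
  cases g
  · exact TLModel.delOp_insOp_dot M _ h1 (by omega)
  · exact TLModel.delOp_insOp_loop M _ h1 (by omega)

theorem form_empty (hδ : F.IsRealization M δ) :
    M.form (F.code F.empty).length (δ F.empty) (δ F.empty) = 1 := by
  classical
  rw [F.code_empty]
  refine (if_pos M.ok_nil).trans ?_
  rw [hδ.empty, M.wt_nil]
  ring

/-- Norms are multiplied up along the construction of the code. The power `e` clears the
denominators that arise when the number of blocks is written through statistics of the code. -/
theorem form_pow (hδ : F.IsRealization M δ) {e : ℕ} {V : List Step → K} (h0 : V [] = 1)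
    (hcup : ∀ l₁ l₂, IsPath fl 0 (l₁ ++ l₂) →
      V (l₁ ++ up :: down :: l₂) = loop l₁.length ^ e * V (l₁ ++ l₂))
    (hdot : fl = true → ∀ l₁ l₂, V (l₁ ++ flat :: l₂) = z ^ e * V (l₁ ++ l₂)) (x : X) {m : ℕ}
    (hm : (F.code x).length = m) : M.form m (δ x) (δ x) ^ e = V (F.code x) := by
  subst hm
  induction x using F.induction with
  | empty => rw [hδ.form_empty, F.code_empty, h0, one_pow]
  | cup x l₁ l₂ hx ih =>
    rw [hδ.form_ins (by simp) x (by simp [hx]) (m := _)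
      (by rw [F.code_cup x l₁ l₂ hx, hx]; simp [arity, add_assoc]), mul_pow, ih, F.code_cup x l₁ l₂ hx, hx, hcup _ _ (hx ▸ F.isPath_code x), if_pos rfl]
  | dot hfl x l₁ l₂ hx ih =>
    rw [hδ.form_ins (fun _ => hfl) x (by simp [hx]) (m := _)
      (by rw [F.code_dot hfl x l₁ l₂ hx, hx]; simp [arity, add_assoc]), mul_pow, ih, F.code_dot hfl x l₁ l₂ hx, hx, hdot hfl,
      if_neg (by simp)]

end CodedFamily.IsRealization

/-- With two spins the squared norm is 2 to the number of blocks. Its square gains a factor 4 for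
each pair and each singleton, which is what one more flat step or two more points amount to in `V`;
exponents of 2 are then compared. -/
theorem two_mul_numBlocks_pair {fl : Bool} {r k : ℕ} {σ : RowPartition r k}
    (h : σ ∈ ncPairingsOrDots fl r k) : 2 * (numBlocks σ : ℤ) - ((r + k : ℕ) : ℤ) =
      ((RowPartition.line σ h.1).pairCode.count flat : ℤ) := by
  have hσ := (RowPartition.isPairing_line_iff h.1).mpr h
  have h1 := (pairFamily_isRealization (K := ℚ) fl 2).form_pow (e := 2)
    (V := fun l => (2 : ℚ) ^ (l.count flat + l.length)) (by simp)
    (fun l₁ l₂ _ => by simp [List.count_append]; ring)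
    (fun hfl l₁ l₂ => by simp [List.count_append, hfl]; ring) ⟨RowPartition.line σ h.1, hσ⟩
    (m := r + k) (LinePartition.length_pairCode _)
  have h2 := form_pairDelta (K := ℚ) fl 2 h.1 h.1
  rw [sup_idem] at h2
  have h3 : (2 : ℚ) ^ (numBlocks σ * 2) = 2 ^ ((RowPartition.line σ h.1).pairCode.count flat +
      (RowPartition.line σ h.1).pairCode.length) := by
    rw [pow_mul]
    exact_mod_cast h2 ▸ h1
  have h4 := pow_right_injective₀ (by norm_num) (by norm_num) h3
  rw [LinePartition.length_pairCode] at h4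
  change _ = _ + (r + k) at h4
  push_cast
  omega

theorem neg_one_pow_level {l₁ l₂ : List Step} (h : IsPath false 0 (l₁ ++ l₂)) :
    (-1 : ℤ) ^ level 0 l₁ = (-1) ^ l₁.length := by
  rw [loop_level (loop := fun i => (-1 : ℤ) ^ i) (fun _ i => by simp [pow_succ]) (by simp) h,
    zero_add]

/-- The same comparison with the fourth power: a peak at an even place makes a new block (factor `2
^ 4`), one at an odd place makes none (factor 1). The sign of the up-step in `signedUps` records
which. -/
theorem two_mul_numBlocks_side {r k : ℕ} {σ : RowPartition r k} (h : IsNoncrossing σ) :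
    2 * (numBlocks σ : ℤ) - ((r + k : ℕ) : ℤ) = signedUps 0 (RowPartition.line σ h).sideCode := by
  have h1 := (sideFamily_isRealization (K := ℚ) 2).form_pow (e := 4)
    (V := fun l => (2 : ℚ) ^ (2 * signedUps 0 l + l.length)) (by simp [signedUps])
    (fun l₁ l₂ hl => by
      rw [signedUps_append, signedUps_append, signedUps, signedUps, Nat.add_sub_cancel,
        neg_one_pow_level hl]
      split_ifs with he
      · rw [he.neg_one_pow, Nat.cast_ofNat, ← zpow_natCast (2 : ℚ) 4,
          ← zpow_add₀ (by norm_num)]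
        congr 1
        simp
        ring
      · rw [(Nat.not_even_iff_odd.mp he).neg_one_pow, one_pow, one_mul]
        congr 1
        simp
        ring)
    (by simp) (RowPartition.line σ h) (m := 2 * (r + k)) (LinePartition.length_sideCode _)
  have h2 := form_sideDelta (K := ℚ) 2 h h
  rw [sup_idem] at h2
  have h3 : (2 : ℚ) ^ ((numBlocks σ * 4 : ℕ) : ℤ) =
      2 ^ (2 * signedUps 0 (RowPartition.line σ h).sideCode +
        (RowPartition.line σ h).sideCode.length) := by
    rw [zpow_natCast, pow_mul]
    exact_mod_cast h2 ▸ h1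
  have h4 := zpow_right_injective₀ (by norm_num) (by norm_num) h3
  rw [LinePartition.length_sideCode] at h4
  change _ = _ + ((2 * (r + k) : ℕ) : ℤ) at h4
  push_cast at h4 ⊢
  omega

open Step

/-! ### Counting epi partitions -/

theorem isPath_replicate_append {fl : Bool} {h t : ℕ} {l : List Step} :
    IsPath fl h (List.replicate t up ++ l) ↔ IsPath fl (h + t) l := by
  induction t generalizing h with
  | zero => rfl
  | succ t ih =>
    rw [List.replicate_succ, List.cons_append, show h + (t + 1) = h + 1 + t by ring, ← ih]
    rfl

/-- After `t` prescribed up-steps the rest is an arbitrary path from height `t`. -/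
theorem CodedFamily.card_eq_ball_of_prefix {fl : Bool} {X : Type*} (F : CodedFamily fl X)
    {ι : Type*} [Fintype ι] {t m : ℕ} {e : ι → X} (he : Function.Injective e)
    (hrange : ∀ x, (∃ i, e i = x) ↔ ∃ l : List Step, l.length = m ∧
      F.code x = List.replicate t up ++ l) : Fintype.card ι = ball fl m t := by
  classical
  choose g hgm hg using fun i => (hrange (e i)).mp ⟨i, rfl⟩
  have hpath : ∀ i, IsPath fl t (g i) := fun i => by
    have := F.isPath_code (e i)
    rwa [hg, isPath_replicate_append, zero_add] at this
  rw [← sumLists_ball, sumLists_isPath (code := g)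
    (fun i j hij => he (F.code_injective (by rw [hg, hg, hij]))) hgm
    (fun p hp hpm => by
      obtain ⟨x, hx⟩ := F.exists_code
        (isPath_replicate_append.mpr (by rwa [zero_add]) : IsPath fl 0 (List.replicate t up ++ p))
      obtain ⟨k, rfl⟩ := (hrange x).mpr ⟨p, hpm, hx⟩
      exact ⟨k, List.append_cancel_left ((hg k).symm.trans hx)⟩) _ (fun l hl => if_neg hl)]
  rw [Finset.sum_congr rfl fun i _ => if_pos (hpath i)]
  simp

theorem map_range_eq_replicate_append {f : ℕ → Step} {t m : ℕ} :
    (∃ l : List Step, l.length = m ∧ (List.range (t + m)).map f = List.replicate t up ++ l) ↔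
      ∀ x < t, f x = up := by
  rw [List.range_add, List.map_append, List.map_map]
  have h : (List.range t).map f = List.replicate t up ↔ ∀ x < t, f x = up := by
    rw [List.eq_replicate_iff]
    simp
  rw [← h]
  constructor
  · rintro ⟨l, -, e⟩
    exact (List.append_inj e (by simp)).1
  · intro e
    exact ⟨(List.range m).map (f ∘ fun x => t + x), by simp, by rw [e]⟩

namespace RowPartition

variable {r k : ℕ}

/-- The upper points come first in the order of positions. A pair inside the upper row would have a
down-step at its right end and a singleton a flat step, so all steps are up exactly when every pair
reaches the lower row. -/
theorem isEpi_iff_pairStep {fl : Bool} {σ : RowPartition r k} (h : σ ∈ ncPairingsOrDots fl r k) :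
    IsEpi σ ↔ ∀ x < r, pairStep (line σ h.1).rel x = up := by
  have hσ := (isPairing_line_iff h.1).mpr h
  constructor
  · intro H x hx
    obtain ⟨j, hj⟩ := (H ⟨x, hx⟩).2
    refine pairStep_eq_up.mpr ⟨_, ?_, line_rel_position.mpr hj⟩
    simp only [position]; omega
  · intro H i
    have key : ∀ y, (line σ h.1).rel i y → y ≠ i → r ≤ y := by
      intro y hy hne
      by_contra hyr
      obtain ⟨z, hz, hiz⟩ := pairStep_eq_up.mp (H i i.2)
      obtain rfl := hσ.eq_of_rel _ _ _ hy hiz (Ne.symm hne) (by omega)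
      obtain ⟨t, ht, hyt⟩ := pairStep_eq_up.mp (H y (by omega))
      have := hσ.eq_of_rel _ _ _ ((line σ h.1).rel.symm' hy) hyt (by omega) (by omega)
      omega
    constructor
    · intro j hj
      by_contra hne
      have := key j (line_rel_position.mpr hj) (fun e => hne (Fin.ext e))
      omega
    · obtain ⟨z, hz, hiz⟩ := pairStep_eq_up.mp (H i i.2)
      have hr := key z hiz (by omega)
      rcases line_rel.mp hiz with e | ⟨a, b, ha, rfl, hab⟩
      · omega
      obtain rfl : a = Sum.inl i := position_injective ha
      rcases b with b | b
      · simp only [position] at hr; omega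
      · exact ⟨b, hab⟩

/-- Up on the left side means no earlier partner, up on the right side a later one. If this holds at
all upper points, no two of them are related and the later partner lies below. -/
theorem isEpi_iff_sideStep {σ : RowPartition r k} (h : IsNoncrossing σ) :
    IsEpi σ ↔ ∀ x < 2 * r, sideStep (line σ h).rel x = up := by
  have hlr : (∀ x < 2 * r, sideStep (line σ h).rel x = up) ↔ ∀ x < r,
      (∀ y < x, ¬ (line σ h).rel x y) ∧ ∃ y, x < y ∧ (line σ h).rel x y := by
    constructor
    · intro H x hx
      exact ⟨leftStep_eq_up.mp (by rw [← sideStep_even]; exact H _ (by omega)),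
        rightStep_eq_up.mp (by rw [← sideStep_odd]; exact H _ (by omega))⟩
    · intro H x hx
      obtain ⟨y, rfl | rfl⟩ := Nat.even_or_odd' x
      · rw [sideStep_even, leftStep_eq_up]; exact (H y (by omega)).1
      · rw [sideStep_odd, rightStep_eq_up]; exact (H y (by omega)).2
  rw [hlr]
  constructor
  · intro H x hx
    constructor
    · intro y hy hxy
      have := (H ⟨x, hx⟩).1 ⟨y, hy.trans hx⟩
        ((line_rel_position (h := h) (a := Sum.inl ⟨x, hx⟩) (b := Sum.inl ⟨y, hy.trans hx⟩)).mp hxy)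
      simp only [Fin.mk.injEq] at this
      omega
    · obtain ⟨j, hj⟩ := (H ⟨x, hx⟩).2
      refine ⟨_, ?_, line_rel_position.mpr hj⟩
      simp only [position]; omega
  · intro H i
    have key : ∀ j : Fin r, σ (Sum.inl i) (Sum.inl j) → j = i := by
      intro j hj
      have hj' : (line σ h).rel i j := line_rel_position.mpr hj
      rcases lt_trichotomy (i : ℕ) j with hij | hij | hij
      · exact absurd ((line σ h).rel.symm' hj') ((H j j.2).1 i hij)
      · exact Fin.ext hij.symm
      · exact absurd hj' ((H i i.2).1 j hij)
    refine ⟨key, ?_⟩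
    obtain ⟨z, hz, hiz⟩ := (H i i.2).2
    rcases line_rel.mp hiz with e | ⟨a, b, ha, rfl, hab⟩
    · omega
    obtain rfl : a = Sum.inl i := position_injective ha
    rcases b with b | b
    · rw [key b hab] at hz
      exact absurd hz (lt_irrefl _)
    · exact ⟨b, hab⟩

end RowPartition

open RowPartition

/-- A partition into pairs and singletons, as a partition of the positions. -/
def pairLine {fl : Bool} {r k : ℕ} {p : RowPartition r k → Prop}
    (hp : ∀ σ, p σ → σ ∈ ncPairingsOrDots fl r k) (σ : {σ : RowPartition r k // p σ}) :
    {π : LinePartition // π.IsPairing fl} :=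
  ⟨line σ.1 (hp _ σ.2).1, (isPairing_line_iff _).mpr (hp _ σ.2)⟩

theorem pairLine_injective {fl : Bool} {r k : ℕ} {p : RowPartition r k → Prop}
    (hp : ∀ σ, p σ → σ ∈ ncPairingsOrDots fl r k) : Function.Injective (pairLine hp) :=
  fun σ τ h => Subtype.ext (line_injective (h := (hp _ σ.2).1) (h' := (hp _ τ.2).1)
    (Subtype.ext_iff.mp h))

theorem exists_pairLine {fl : Bool} {r k : ℕ} (x : {π : LinePartition // π.IsPairing fl})
    (hx : x.1.size = r + k) : ∃ (σ : RowPartition r k) (h : σ ∈ ncPairingsOrDots fl r k),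
      line σ h.1 = x.1 := by
  obtain ⟨σ, h, hσ⟩ := exists_line hx
  exact ⟨σ, (isPairing_line_iff h).mp (hσ ▸ x.2), hσ⟩

theorem exists_pairLine_iff_length {fl : Bool} {k : ℕ} (x : {π : LinePartition // π.IsPairing fl}) :
    (∃ σ : Diagram (ncPairingsOrDots fl) k, pairLine (fun _ => id) σ = x) ↔
      ((pairFamily fl).code x).length = k := by
  refine Iff.trans ⟨?_, ?_⟩ (by rw [← LinePartition.length_pairCode x.1]; rfl :
    x.1.size = k ↔ _)
  · rintro ⟨σ, rfl⟩
    exact zero_add k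
  · intro hx
    obtain ⟨σ, h, hσ⟩ := exists_pairLine (r := 0) (k := k) x (by rw [hx, zero_add])
    exact ⟨⟨σ, h⟩, Subtype.ext hσ⟩

theorem card_epi_pair (fl : Bool) (r k : ℕ) :
    Nat.card {σ : RowPartition r k // σ ∈ ncPairingsOrDots fl r k ∧ IsEpi σ} = ball fl k r := by
  let _ : Fintype {σ : RowPartition r k // σ ∈ ncPairingsOrDots fl r k ∧ IsEpi σ} :=
    Fintype.ofFinite _
  rw [Nat.card_eq_fintype_card]
  refine (pairFamily fl).card_eq_ball_of_prefix (pairLine_injective fun σ h => h.1) fun x => ?_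
  constructor
  · rintro ⟨σ, rfl⟩
    exact map_range_eq_replicate_append.mpr ((isEpi_iff_pairStep σ.2.1).mp σ.2.2)
  · rintro ⟨l, hl, hx⟩
    have hs : x.1.size = r + k := by
      rw [← LinePartition.length_pairCode]
      exact (congrArg List.length hx).trans (by simp [hl])
    obtain ⟨σ, h, hσ⟩ := exists_pairLine (r := r) (k := k) x hs
    refine ⟨⟨σ, h, (isEpi_iff_pairStep h).mpr (map_range_eq_replicate_append.mp ⟨l, hl, ?_⟩)⟩,
      Subtype.ext hσ⟩
    rw [hσ, ← hs]
    exact hx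

theorem exists_line_iff_length {k : ℕ} (x : LinePartition) :
    (∃ σ : Diagram ncPartitions k, line σ.1 σ.2 = x) ↔
      (sideFamily.code x).length = 2 * k := by
  refine Iff.trans ⟨?_, ?_⟩ (by
    rw [show (sideFamily.code x).length = 2 * x.size from x.length_sideCode]; omega :
    x.size = k ↔ _)
  · rintro ⟨σ, rfl⟩
    exact zero_add k
  · intro hx
    obtain ⟨σ, h, hσ⟩ := exists_line (r := 0) (k := k) (π := x) (by rw [hx, zero_add])
    exact ⟨⟨σ, h⟩, hσ⟩

theorem card_epi_side (r k : ℕ) :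
    Nat.card {σ : RowPartition r k // σ ∈ ncPartitions r k ∧ IsEpi σ} =
      ball false (2 * k) (2 * r) := by
  let _ : Fintype {σ : RowPartition r k // σ ∈ ncPartitions r k ∧ IsEpi σ} := Fintype.ofFinite _
  rw [Nat.card_eq_fintype_card]
  refine sideFamily.card_eq_ball_of_prefix (e := fun σ => line σ.1 σ.2.1)
    (fun σ τ h => Subtype.ext (line_injective h)) fun x => ?_
  constructor
  · rintro ⟨σ, rfl⟩
    obtain ⟨l, hl, e⟩ := map_range_eq_replicate_append (m := 2 * k).mpr
      ((isEpi_iff_sideStep σ.2.1).mp σ.2.2)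
    exact ⟨l, hl, by rw [← e, ← mul_add]; rfl⟩
  · rintro ⟨l, hl, hx⟩
    have hs : x.size = r + k := by
      have := x.length_sideCode.symm.trans (congrArg List.length hx)
      simp [hl] at this
      omega
    obtain ⟨σ, h, hσ⟩ := exists_line (r := r) (k := k) hs
    refine ⟨⟨σ, h, (isEpi_iff_sideStep h).mpr (map_range_eq_replicate_append.mp ⟨l, hl, ?_⟩)⟩, hσ⟩
    rw [hσ, ← mul_add, ← hs]
    exact hx

/-! ### Cardinalities, exponents and determinants -/

theorem card_diagram_pair (fl : Bool) (k : ℕ) :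
    Fintype.card (Diagram (ncPairingsOrDots fl) k) = ball fl k 0 :=
  (pairFamily fl).card_eq_ball (pairLine_injective _) exists_pairLine_iff_length

theorem line_diagram_injective (k : ℕ) :
    Function.Injective fun σ : Diagram ncPartitions k => line σ.1 σ.2 :=
  fun _ _ h => Subtype.ext (line_injective h)

theorem card_diagram_side (k : ℕ) :
    Fintype.card (Diagram ncPartitions k) = ball false (2 * k) 0 :=
  sideFamily.card_eq_ball (line_diagram_injective k) exists_line_iff_length

theorem gramExponent_pair (fl : Bool) (k : ℕ) : gramExponent (ncPairingsOrDots fl) k =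
    ((∑ σ : Diagram (ncPairingsOrDots fl) k, (line σ.1 σ.2.1).pairCode.count flat : ℕ) : ℤ) := by
  rw [Nat.cast_sum]
  refine Finset.sum_congr rfl fun σ _ => ?_
  rw [← two_mul_numBlocks_pair σ.2, zero_add]

theorem gramExponent_side (k : ℕ) : gramExponent ncPartitions k =
    ∑ σ : Diagram ncPartitions k, signedUps 0 (line σ.1 σ.2).sideCode := by
  refine Finset.sum_congr rfl fun σ _ => ?_
  rw [← two_mul_numBlocks_side σ.2, zero_add]

theorem gramExponent_pair_nonneg (fl : Bool) (k : ℕ) :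
    0 ≤ gramExponent (ncPairingsOrDots fl) k := by
  rw [gramExponent_pair]
  exact Int.natCast_nonneg _

theorem gramExponent_side_nonneg (k : ℕ) : 0 ≤ gramExponent ncPartitions k := by
  rw [gramExponent_side]
  exact (sum_signed_ball_nonneg (2 * k)).trans_eq
    (sideFamily.sum_signedUps (line_diagram_injective k) exists_line_iff_length).symm

theorem prod_zpow_eq_zpow_sum {K ι : Type*} [Field K] {n : K} (hn : n ≠ 0) (s : Finset ι)
    (f : ι → ℤ) : ∏ i ∈ s, n ^ f i = n ^ ∑ i ∈ s, f i := by
  classical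
  induction s using Finset.induction_on with
  | empty => simp
  | insert a s ha ih => rw [Finset.prod_insert ha, Finset.sum_insert ha, zpow_add₀ hn, ih]

section det

variable {K : Type} [Field K]

theorem det_gramMatrix_pair (fl : Bool) (k n : ℕ) (hn : (n : K) ≠ 0) {ρ : ℕ → K}
    (hρ : ∀ h, ρ h ≠ 0) (h0 : ρ 0 + (if fl = true then 1 else 0) = n)
    (hs : ∀ h, ρ (h + 1) + (ρ h)⁻¹ + (if fl = true then 1 else 0) = n) :
    (gramMatrix (ncPairingsOrDots fl) k (n : K)).det =
      (n : K) ^ gramExponent (ncPairingsOrDots fl) k *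
        ∏ s ∈ Finset.range k, ρ s ^ ball fl k (2 * s + 2) := by
  have h := (pairFamily_isRealization (K := K) fl n).det_form hρ hn h0 hs (fun _ _ => rfl)
    (fun _ _ => rfl) rfl (pairLine_injective (r := 0) (k := k) fun _ => id)
    exists_pairLine_iff_length
  have e : gramMatrix (ncPairingsOrDots fl) k (n : K) = Matrix.of fun i j =>
      (vertexModel K fl n).form k (pairDelta K (pairLine (fun _ => id) i).1)
        (pairDelta K (pairLine (fun _ => id) j).1) := by
    ext i j
    have := form_pairDelta (K := K) fl n i.2.1 j.2.1
    rw [zero_add] at this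
    exact this.symm
  rw [e]
  refine h.trans ?_
  -- A flat step has weight `n`, and the flat steps of all diagrams add up to `a_k`.
  rw [← (pairFamily fl).prod_pathWeight (pairLine_injective fun _ => id) exists_pairLine_iff_length,
    gramExponent_pair, zpow_natCast, ← Finset.prod_pow_eq_pow_sum, ← Finset.prod_mul_distrib]
  exact Finset.prod_congr rfl fun σ _ => pathWeight_eq_mul ρ _ 0 _

theorem det_gramMatrix_side (k n : ℕ) (hn : (n : K) ≠ 0) {ρ : ℕ → K}
    (hρ : ∀ h, ρ h ≠ 0) (h0 : (n : K) * ρ 0 = n)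
    (hs : ∀ h, (n : K) ^ ((-1 : ℤ) ^ (h + 1)) * ρ (h + 1) + ((n : K) ^ ((-1 : ℤ) ^ h) * ρ h)⁻¹ =
      if Even (h + 1) then (n : K) else 1) :
    (gramMatrix ncPartitions k (n : K)).det = (n : K) ^ gramExponent ncPartitions k *
      ∏ s ∈ Finset.range (2 * k), ρ s ^ ball false (2 * k) (2 * s + 2) := by
  -- The alternating factor `n ^ (±1)` adapts the ratios to the loop values `n` and 1; over all
  -- paths it accumulates to `n ^ a_k` through `signedUps`.
  have h := (sideFamily_isRealization (K := K) n).det_form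
    (ρ := fun h => (n : K) ^ ((-1 : ℤ) ^ h) * ρ h) (w := 1)
    (fun h => mul_ne_zero (zpow_ne_zero _ hn) (hρ h)) one_ne_zero (by simpa using h0)
    (fun h => by simpa using hs h) (fun _ i => by simp [Nat.even_add])
    (by simp) (by simp) (line_diagram_injective k) exists_line_iff_length
  have e : gramMatrix ncPartitions k (n : K) = Matrix.of fun i j : Diagram ncPartitions k =>
      (faceModel K n).form (2 * k) (sideDelta K (line i.1 i.2)) (sideDelta K (line j.1 j.2)) := by
    ext i j
    have := form_sideDelta (K := K) n i.2 j.2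
    rw [zero_add] at this
    exact this.symm
  rw [e]
  refine h.trans ?_
  rw [← sideFamily.prod_pathWeight (line_diagram_injective k) exists_line_iff_length,
    gramExponent_side]
  rw [Finset.prod_congr rfl fun σ _ => pathWeight_zpow ρ hn 0 _, Finset.prod_mul_distrib]
  congr 1
  exact prod_zpow_eq_zpow_sum hn _ _

end det

/-! ### Products over epi partitions -/

theorem prod_epiDiagram {K : Type*} [CommMonoid K] (P : PartitionFamily) (k : ℕ) (g : ℕ → K) :
    ∏ σ : EpiDiagram P k, g σ.legs = ∏ r ∈ Finset.range (k + 1),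
      g r ^ Nat.card {σ : RowPartition r k // σ ∈ P r k ∧ IsEpi σ} := by
  classical
  let _ : ∀ r : Fin (k + 1), Fintype {σ : RowPartition r k // σ ∈ P r k ∧ IsEpi σ} :=
    fun _ => Fintype.ofFinite _
  rw [← Fin.prod_univ_eq_prod_range
    (fun r => g r ^ Nat.card {σ : RowPartition r k // σ ∈ P r k ∧ IsEpi σ}) (k + 1)]
  have h : (Finset.univ : Finset (EpiDiagram P k)) = Finset.univ.sigma fun _ => Finset.univ := by
    ext σ
    simp
  rw [h, Finset.prod_sigma]
  refine Finset.prod_congr rfl fun r _ => ?_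
  simp [EpiDiagram.legs]

theorem prod_range_even {K : Type*} [CommMonoid K] (f : ℕ → K) (h0 : f 0 = 1) (c : ℕ → ℕ) (k : ℕ)
    (hc : ∀ r, k < r → c r = 0) :
    ∏ r ∈ Finset.range (k + 1), (if Even r then f (r / 2) else 1) ^ c r =
      ∏ s ∈ Finset.range k, f (s + 1) ^ c (2 * s + 2) := by
  -- Extending the range to an even length is harmless as the multiplicities vanish beyond `k`; the
  -- factor of index zero is dropped at the end because `f 0 = 1`.
  have h1 : ∏ r ∈ Finset.range (k + 1), (if Even r then f (r / 2) else 1) ^ c r =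
      ∏ r ∈ Finset.range (2 * (k + 1)), (if Even r then f (r / 2) else 1) ^ c r := by
    refine Finset.prod_subset (Finset.range_subset_range.mpr (by omega)) fun r _ hr => ?_
    rw [hc r (by simp at hr; omega), pow_zero]
  have h2 : ∀ N, ∏ r ∈ Finset.range (2 * N), (if Even r then f (r / 2) else 1) ^ c r =
      ∏ s ∈ Finset.range N, f s ^ c (2 * s) := by
    intro N
    induction N with
    | zero => rfl
    | succ N ih =>
      rw [show 2 * (N + 1) = 2 * N + 1 + 1 by ring, Finset.prod_range_succ, Finset.prod_range_succ,
        Finset.prod_range_succ, ih]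
      simp
  rw [h1, h2, Finset.prod_range_succ', h0, one_pow, mul_one]
  rfl

theorem prod_epiDiagram_pair {K : Type*} [CommMonoid K] (fl : Bool) (k : ℕ) (f : ℕ → K)
    (h0 : f 0 = 1) :
    ∏ σ : EpiDiagram (ncPairingsOrDots fl) k with Even σ.legs, f (σ.legs / 2) =
      ∏ s ∈ Finset.range k, f (s + 1) ^ ball fl k (2 * s + 2) := by
  rw [Finset.prod_filter,
    prod_epiDiagram (ncPairingsOrDots fl) k fun r => if Even r then f (r / 2) else 1,
    ← prod_range_even f h0 (ball fl k) k fun r hr => ball_eq_zero hr]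
  simp only [card_epi_pair]

theorem prod_epiDiagram_side {K : Type*} [CommMonoid K] (k : ℕ) (f : ℕ → K) (h0 : f 0 = 1) :
    ∏ σ : EpiDiagram ncPartitions k, f σ.legs =
      ∏ s ∈ Finset.range (2 * k), f (s + 1) ^ ball false (2 * k) (2 * s + 2) := by
  rw [prod_epiDiagram ncPartitions k f]
  simp only [card_epi_side]
  rw [Finset.prod_range_succ', h0, one_pow, mul_one]
  refine Finset.prod_subset (Finset.range_subset_range.mpr (by omega)) fun s _ hs => ?_
  rw [ball_eq_zero (by simp at hs; omega), pow_zero]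

/-! ### From natural numbers to arbitrary parameters -/

theorem map_det_gramMatrix (P : PartitionFamily) (k : ℕ) {R : Type*} [CommRing R] (x : R) :
    aeval x (gramMatrix P k (X : ℤ[X])).det = (gramMatrix P k x).det := by
  rw [AlgHom.map_det]
  congr 1
  ext i j
  simp [gramMatrix]

/-- Infinitely many values suffice. The bound 5 lies above the thresholds 2, 3 and 4 from which
`polyP`, `polyQ` and `polyR` are known to be positive. -/
theorem eq_of_forall_natCast {p q : ℤ[X]}
    (h : ∀ n : ℕ, 5 ≤ n → aeval (n : ℝ) p = aeval (n : ℝ) q) : p = q := by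
  refine Polynomial.eq_of_infinite_eval_eq p q (Set.Infinite.mono ?_
    ((Set.Ici_infinite 5).image (Nat.cast_injective (R := ℤ)).injOn))
  rintro _ ⟨n, hn, rfl⟩
  have e : ∀ p : ℤ[X], aeval (n : ℝ) p = ((p.eval (n : ℤ) : ℤ) : ℝ) := fun p => by
    have := aeval_algebraMap_apply ℝ (n : ℤ) p
    simpa using this
  have := h n hn
  rw [e, e] at this
  exact_mod_cast this

theorem prod_stepRatio (F : ℕ → ℤ[X]) {K : Type*} [Field K] (x : K) (N : ℕ) (c : ℕ → ℕ) :
    ∏ s ∈ Finset.range N, stepRatio F x (s + 1) ^ c s =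
      (∏ s ∈ Finset.range N, aeval x (F (s + 1)) ^ c s) /
        ∏ s ∈ Finset.range N, aeval x (F s) ^ c s := by
  rw [← Finset.prod_div_distrib]
  exact Finset.prod_congr rfl fun s _ => div_pow _ _ _

/-- With denominators cleared and a nonnegative exponent, both sides are integer polynomials, so the
identity passes to every field. Only denominators with nonzero multiplicity have to be invertible
there. -/
theorem det_gramMatrix_of_forall_natCast {P : PartitionFamily} {k : ℕ} {F : ℕ → ℤ[X]} {N : ℕ}
    {c : ℕ → ℕ} (ha : 0 ≤ gramExponent P k)
    (hF : ∀ n : ℕ, 5 ≤ n → ∀ s, aeval (n : ℝ) (F s) ≠ 0)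
    (h : ∀ n : ℕ, 5 ≤ n → (gramMatrix P k (n : ℝ)).det = (n : ℝ) ^ gramExponent P k *
      ∏ s ∈ Finset.range N, stepRatio F (n : ℝ) (s + 1) ^ c s)
    {K : Type*} [Field K] (x : K) (hx : ∀ s < N, c s ≠ 0 → aeval x (F s) ≠ 0) :
    (gramMatrix P k x).det =
      x ^ gramExponent P k * ∏ s ∈ Finset.range N, stepRatio F x (s + 1) ^ c s := by
  obtain ⟨a, ha⟩ := Int.eq_ofNat_of_zero_le ha
  have key : (gramMatrix P k (X : ℤ[X])).det * ∏ s ∈ Finset.range N, F s ^ c s =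
      X ^ a * ∏ s ∈ Finset.range N, F (s + 1) ^ c s := by
    refine eq_of_forall_natCast fun n hn => ?_
    have hne : ∏ s ∈ Finset.range N, aeval (n : ℝ) (F s) ^ c s ≠ 0 :=
      Finset.prod_ne_zero_iff.mpr fun s _ => pow_ne_zero _ (hF n hn s)
    have h1 := h n hn
    rw [ha, zpow_natCast, prod_stepRatio] at h1
    simp only [map_mul, map_prod, map_pow, aeval_X, map_det_gramMatrix, h1]
    field_simp
  have hne : ∏ s ∈ Finset.range N, aeval x (F s) ^ c s ≠ 0 :=
    Finset.prod_ne_zero_iff.mpr fun s hs => by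
      by_cases hc : c s = 0
      · rw [hc, pow_zero]; exact one_ne_zero
      · exact pow_ne_zero _ (hx s (Finset.mem_range.mp hs) hc)
  have := congrArg (aeval x) key
  simp only [map_mul, map_prod, map_pow, aeval_X, map_det_gramMatrix] at this
  rw [ha, zpow_natCast, prod_stepRatio, ← mul_div_assoc, eq_div_iff hne, this]

theorem aeval_map_X_ne_zero {K : Type*} [Field K] {f : ℚ[X] →+* K} (hf : Function.Injective f)
    {p : ℤ[X]} (hp : p ≠ 0) : aeval (f X) p ≠ 0 := by
  have h : algebraMap ℤ K = f.comp (algebraMap ℤ ℚ[X]) := RingHom.ext_int _ _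
  rw [aeval_def, h, ← hom_eval₂, ← aeval_def, aeval_X_left_eq_map, Ne, map_eq_zero_iff _ hf,
    Polynomial.map_eq_zero_iff (algebraMap ℤ ℚ).injective_int]
  exact hp

theorem aeval_ratFunc_ne_zero {p : ℤ[X]} (hp : p ≠ 0) :
    @aeval ℤ (RatFunc ℚ) _ _ (Ring.toIntAlgebra _) RatFunc.X p ≠ 0 := by
  rw [← RatFunc.algebraMap_X]
  exact aeval_map_X_ne_zero (RatFunc.algebraMap_injective ℚ) hp

/-! ### The polynomials -/

/-- Monotonicity is carried along: for `x ≥ 2` the recurrence makes each increment at least the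
previous one. -/
theorem pos_of_recurrence {a : ℕ → ℝ} {x : ℝ} (hx : 2 ≤ x) (h0 : 0 < a 0) (h1 : a 0 ≤ a 1)
    (h : ∀ j, a (j + 2) = x * a (j + 1) - a j) (j : ℕ) : 0 < a j := by
  suffices H : 0 < a j ∧ a j ≤ a (j + 1) from H.1
  induction j with
  | zero => exact ⟨h0, h1⟩
  | succ j ih =>
    refine ⟨by linarith, ?_⟩
    rw [h]
    nlinarith

/-- Splitting off the line of the dot lowers the loop value by one. -/
theorem polyQ_eq_comp (r : ℕ) : polyQ r = (polyP r).comp (X - 1) := by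
  induction r using polyQ.induct with
  | case1 => simp [polyQ, polyP]
  | case2 => simp [polyQ, polyP]
  | case3 r ih1 ih2 => simp [polyQ, polyP, ih1, ih2]

theorem aeval_polyQ {A : Type*} [CommRing A] (x : A) (r : ℕ) :
    aeval x (polyQ r) = aeval (x - 1) (polyP r) := by
  simp [polyQ_eq_comp, aeval_comp]

theorem aeval_polyP_add_two {A : Type*} [CommRing A] (x : A) (r : ℕ) :
    aeval x (polyP (r + 2)) = x * aeval x (polyP (r + 1)) - aeval x (polyP r) := by
  simp [polyP]

theorem aeval_polyP_pos {x : ℝ} (hx : 2 ≤ x) (r : ℕ) : 0 < aeval x (polyP r) :=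
  pos_of_recurrence (a := fun r => aeval x (polyP r)) hx (by simp [polyP])
    (by simp [polyP]; linarith) (aeval_polyP_add_two x) r

theorem aeval_polyR_add_four {A : Type*} [CommRing A] (x : A) (r : ℕ) :
    aeval x (polyR (r + 4)) = (x - 2) * aeval x (polyR (r + 2)) - aeval x (polyR r) := by
  have : aeval x (2 : ℤ[X]) = 2 := map_ofNat _ 2
  simp [polyR, this]

theorem aeval_polyR_pos {x : ℝ} (hx : 4 ≤ x) (r : ℕ) : 0 < aeval x (polyR r) := by
  have h2 : aeval x (2 : ℤ[X]) = 2 := map_ofNat _ 2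
  obtain ⟨j, rfl | rfl⟩ := Nat.even_or_odd' r
  · exact pos_of_recurrence (a := fun j => aeval x (polyR (2 * j))) (x := x - 2) (by linarith)
      (by simp [polyR]) (by simp [polyR]; linarith) (fun j => aeval_polyR_add_four x (2 * j)) j
  · exact pos_of_recurrence (a := fun j => aeval x (polyR (2 * j + 1))) (x := x - 2) (by linarith)
      (by simp [polyR]) (by simp [polyR, h2]; linarith)
      (fun j => aeval_polyR_add_four x (2 * j + 1)) j

/-- The defining recurrence skips every other index; these one-step relations reflect the
alternation of the loop values. -/
theorem polyR_recurrence (j : ℕ) :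
    polyR (2 * j + 2) + polyR (2 * j) = X * polyR (2 * j + 1) ∧
      polyR (2 * j + 3) + polyR (2 * j + 1) = polyR (2 * j + 2) := by
  induction j with
  | zero => constructor <;> simp [polyR]; ring
  | succ j ih =>
    have e1 : polyR (2 * (j + 1) + 2) = (X - 2) * polyR (2 * j + 2) - polyR (2 * j) := by
      rw [show 2 * (j + 1) + 2 = 2 * j + 4 by ring]; simp [polyR]
    have e2 : polyR (2 * (j + 1) + 3) = (X - 2) * polyR (2 * j + 3) - polyR (2 * j + 1) := by
      rw [show 2 * (j + 1) + 3 = 2 * j + 1 + 4 by ring]; simp [polyR]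
    rw [show 2 * (j + 1) + 1 = 2 * j + 3 by ring, show 2 * (j + 1) = 2 * j + 2 by ring] at *
    rw [e1, e2]
    constructor
    · linear_combination (-X) * ih.2 - ih.1
    · linear_combination (X - 1) * ih.2 + ih.1

/-! ### The determinants -/

theorem ratio_recurrence {a b c x : ℝ} (hb : b ≠ 0) (h : c = x * b - a) :
    c / b + (b / a)⁻¹ = x := by
  rw [inv_div, ← add_div, h, sub_add_cancel, mul_div_cancel_right₀ _ hb]

/-- The determinant formula for partitions into pairs and (if `fl` holds) singletons. -/
theorem det_gramMatrix_pairFamily {fl : Bool} {F : ℕ → ℤ[X]}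
    (hpos : ∀ n : ℕ, 5 ≤ n → ∀ s, 0 < aeval (n : ℝ) (F s)) (hF0 : F 0 = 1)
    (hF1 : F 1 = X - if fl = true then 1 else 0)
    (hF : ∀ r, F (r + 2) = (X - if fl = true then 1 else 0) * F (r + 1) - F r) (k : ℕ)
    {K : Type*} [Field K] (x : K)
    (hx : ∀ σ : EpiDiagram (ncPairingsOrDots fl) k, Even σ.legs → σ.legs ≠ 0 →
      aeval x (F (σ.legs / 2 - 1)) ≠ 0) :
    (gramMatrix (ncPairingsOrDots fl) k x).det = x ^ gramExponent (ncPairingsOrDots fl) k *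
      ∏ σ : EpiDiagram (ncPairingsOrDots fl) k with Even σ.legs, stepRatio F x (σ.legs / 2) := by
  rw [prod_epiDiagram_pair fl k (stepRatio F x) rfl]
  refine det_gramMatrix_of_forall_natCast (gramExponent_pair_nonneg fl k)
    (fun n hn s => (hpos n hn s).ne') (fun n hn => ?_) x fun s hs hc => ?_
  · have hne := fun s => (hpos n hn s).ne'
    refine det_gramMatrix_pair (K := ℝ) fl k n (by positivity)
      (ρ := fun h => stepRatio F (n : ℝ) (h + 1)) (fun h => div_ne_zero (hne _) (hne _)) ?_ fun h => ?_
    · cases fl <;> simp [stepRatio, hF0, hF1]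
    · have := ratio_recurrence (a := aeval (n : ℝ) (F h)) (hne (h + 1)) (c := aeval (n : ℝ) (F (h + 2)))
        (x := n - if fl = true then 1 else 0) (by rw [hF]; cases fl <;> simp)
      simp only [stepRatio]
      rw [this, sub_add_cancel]
  -- A nonzero multiplicity exhibits an epi partition with `2 * s + 2` legs, whose denominator is
  -- the one required to be nonzero.
  · have hk : 2 * s + 2 ≤ k := by
      by_contra h
      exact hc (ball_eq_zero (by omega))
    rw [← card_epi_pair] at hc
    obtain ⟨σ⟩ := (Nat.card_ne_zero.mp hc).1
    have := hx ⟨⟨2 * s + 2, by omega⟩, σ⟩ (by simp [EpiDiagram.legs, Nat.even_add])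
      (by simp [EpiDiagram.legs])
    have e : (2 * s + 2) / 2 - 1 = s := by omega
    simpa [EpiDiagram.legs, e] using this

/-- The determinant formula for all noncrossing partitions. -/
theorem det_gramMatrix_ncPartitions (k : ℕ) {K : Type*} [Field K] (x : K)
    (hx : ∀ σ : EpiDiagram ncPartitions k, σ.legs ≠ 0 → aeval x (polyR (σ.legs - 1)) ≠ 0) :
    (gramMatrix ncPartitions k x).det = x ^ gramExponent ncPartitions k *
      ∏ σ : EpiDiagram ncPartitions k, stepRatio polyR x σ.legs := by
  have hpos : ∀ n : ℕ, 5 ≤ n → ∀ s, 0 < aeval (n : ℝ) (polyR s) := fun n hn =>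
    aeval_polyR_pos (by exact_mod_cast (by omega : 4 ≤ n))
  rw [prod_epiDiagram_side k (stepRatio polyR x) rfl]
  refine det_gramMatrix_of_forall_natCast (gramExponent_side_nonneg k)
    (fun n hn s => (hpos n hn s).ne') (fun n hn => ?_) x fun s hs hc => ?_
  · have hne := fun s => (hpos n hn s).ne'
    have hn0 : (n : ℝ) ≠ 0 := by positivity
    refine det_gramMatrix_side (K := ℝ) k n hn0
      (ρ := fun h => stepRatio polyR (n : ℝ) (h + 1)) (fun h => div_ne_zero (hne _) (hne _)) ?_
      fun h => ?_
    · simp [stepRatio, polyR]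
    · obtain ⟨j, rfl | rfl⟩ := Nat.even_or_odd' h
      -- At the odd height `2 * j + 1` the ratios add up to `n`, and the factor `n⁻¹` gives the loop
      -- value 1.
      · have := ratio_recurrence (a := aeval (n : ℝ) (polyR (2 * j))) (hne (2 * j + 1))
          (c := aeval (n : ℝ) (polyR (2 * j + 2))) (x := n)
          (by have := congrArg (aeval (n : ℝ)) (polyR_recurrence j).1
              simp at this; linarith)
        simp only [inv_div] at this
        simp [stepRatio, pow_succ, mul_comm (_ / _ : ℝ)]
        rw [← mul_add]
        exact (congrArg ((n : ℝ)⁻¹ * ·) this).trans (inv_mul_cancel₀ hn0)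
      -- At the even height `2 * j + 2` the ratios add up to 1, and the factor `n` gives the loop
      -- value `n`.
      · have := ratio_recurrence (a := aeval (n : ℝ) (polyR (2 * j + 1))) (hne (2 * j + 2))
          (c := aeval (n : ℝ) (polyR (2 * j + 3))) (x := 1)
          (by have := congrArg (aeval (n : ℝ)) (polyR_recurrence j).2
              simp at this; linarith)
        simp only [inv_div] at this
        simp [stepRatio, pow_succ, Nat.even_add_one, mul_comm (_ / _ : ℝ)]
        rw [← mul_add]
        exact (congrArg ((n : ℝ) * ·) this).trans (mul_one _)
  · have hk : s + 1 ≤ k := by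
      by_contra h
      exact hc (ball_eq_zero (by omega))
    rw [show 2 * s + 2 = 2 * (s + 1) by ring, ← card_epi_side] at hc
    obtain ⟨σ⟩ := (Nat.card_ne_zero.mp hc).1
    have := hx ⟨⟨s + 1, by omega⟩, σ⟩ (by simp [EpiDiagram.legs])
    simpa [EpiDiagram.legs] using this

/-! ### Orthogonality -/

/-- The semicircle law in the angular coordinate. -/
noncomputable def angularMeasure : Measure ℝ :=
  (volume.restrict (Set.Ioc 0 Real.pi)).withDensity
    fun θ => ENNReal.ofReal (2 / Real.pi * Real.sin θ ^ 2)

/-- The expectation of a function of the angular coordinate. -/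
noncomputable def angularIntegral (f : ℝ → ℝ) : ℝ :=
  ∫ θ in (0 : ℝ)..Real.pi, 2 / Real.pi * Real.sin θ ^ 2 * f θ

theorem angular_density_nonneg (θ : ℝ) : 0 ≤ 2 / Real.pi * Real.sin θ ^ 2 := by
  have := Real.pi_pos
  positivity

theorem measurable_angular_density :
    Measurable fun θ => ENNReal.ofReal (2 / Real.pi * Real.sin θ ^ 2) := by fun_prop

theorem integrable_angularMeasure {f : ℝ → ℝ} (hf : Continuous f) :
    Integrable f angularMeasure := by
  rw [angularMeasure, integrable_withDensity_iff_integrable_smul' measurable_angular_density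
    (Filter.Eventually.of_forall fun _ => ENNReal.ofReal_lt_top)]
  simp only [ENNReal.toReal_ofReal (angular_density_nonneg _), smul_eq_mul]
  rw [← IntegrableOn, ← intervalIntegrable_iff_integrableOn_Ioc_of_le Real.pi_pos.le]
  exact Continuous.intervalIntegrable (by fun_prop) _ _

theorem integral_angularMeasure (f : ℝ → ℝ) : ∫ θ, f θ ∂angularMeasure = angularIntegral f := by
  rw [angularMeasure, integral_withDensity_eq_integral_toReal_smul measurable_angular_density
    (Filter.Eventually.of_forall fun _ => ENNReal.ofReal_lt_top), angularIntegral,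
    intervalIntegral.integral_of_le Real.pi_pos.le]
  simp only [ENNReal.toReal_ofReal (angular_density_nonneg _), smul_eq_mul]

theorem integrable_map_angularMeasure {f g : ℝ → ℝ} (hg : Continuous g) (hf : Continuous f) :
    Integrable f (angularMeasure.map g) :=
  (integrable_map_measure hf.aestronglyMeasurable hg.aemeasurable).mpr
    (integrable_angularMeasure (hf.comp hg))

theorem integral_map_angularMeasure {f g : ℝ → ℝ} (hg : Continuous g) (hf : Continuous f) :
    ∫ x, f x ∂angularMeasure.map g = angularIntegral fun θ => f (g θ) := by
  rw [integral_map hg.aemeasurable hf.aestronglyMeasurable, integral_angularMeasure]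

theorem angularIntegral_add {f g : ℝ → ℝ} (hf : Continuous f) (hg : Continuous g) :
    angularIntegral (fun θ => f θ + g θ) = angularIntegral f + angularIntegral g := by
  simp only [angularIntegral, mul_add]
  exact intervalIntegral.integral_add (Continuous.intervalIntegrable (by fun_prop) _ _)
    (Continuous.intervalIntegrable (by fun_prop) _ _)

/-- These are Chebyshev polynomials of the second kind: the recurrence is the addition formula for
the sine. -/
theorem aeval_polyP_mul_sin (r : ℕ) (θ : ℝ) :
    aeval (2 * Real.cos θ) (polyP r) * Real.sin θ = Real.sin ((r + 1) * θ) := by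
  induction r using polyP.induct with
  | case1 => simp [polyP]
  | case2 => simp [polyP, one_add_one_eq_two, Real.sin_two_mul]; ring
  | case3 r ih1 ih2 =>
    rw [aeval_polyP_add_two, sub_mul, mul_assoc, ih1, ih2]
    have h1 : ((r + 2 : ℕ) + 1 : ℝ) * θ = ((r + 1 : ℕ) + 1) * θ + θ := by push_cast; ring
    have h2 : ((r : ℝ) + 1) * θ = ((r + 1 : ℕ) + 1) * θ - θ := by push_cast; ring
    rw [h1, h2, Real.sin_add, Real.sin_sub]
    ring

theorem integral_cos_intCast_mul {m : ℤ} (hm : m ≠ 0) :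
    ∫ θ in (0 : ℝ)..Real.pi, Real.cos (m * θ) = 0 := by
  rw [intervalIntegral.integral_comp_mul_left (fun x => Real.cos x) (by exact_mod_cast hm)]
  simp [Real.sin_int_mul_pi]

/-- The density supplies one sine for each factor, and a product of two sines is a difference of
cosines whose integrals vanish except at frequency zero. -/
theorem angularIntegral_polyP_mul (i j : ℕ) :
    angularIntegral (fun θ => aeval (2 * Real.cos θ) (polyP i) * aeval (2 * Real.cos θ) (polyP j)) =
      if i = j then 1 else 0 := by
  have e : ∀ θ : ℝ, 2 / Real.pi * Real.sin θ ^ 2 *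
      (aeval (2 * Real.cos θ) (polyP i) * aeval (2 * Real.cos θ) (polyP j)) =
      1 / Real.pi * (Real.cos (((i - j : ℤ) : ℝ) * θ) - Real.cos (((i + j + 2 : ℤ) : ℝ) * θ)) := by
    intro θ
    have h1 : (((i - j : ℤ) : ℝ) * θ) = (i + 1) * θ - (j + 1) * θ := by push_cast; ring
    have h2 : (((i + j + 2 : ℤ) : ℝ) * θ) = (i + 1) * θ + (j + 1) * θ := by push_cast; ring
    rw [h1, h2, Real.cos_sub, Real.cos_add, ← aeval_polyP_mul_sin, ← aeval_polyP_mul_sin]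
    ring
  rw [angularIntegral]
  simp only [e]
  rw [intervalIntegral.integral_const_mul, intervalIntegral.integral_sub
    (Continuous.intervalIntegrable (by fun_prop) _ _)
    (Continuous.intervalIntegrable (by fun_prop) _ _),
    integral_cos_intCast_mul (m := i + j + 2) (by omega)]
  split_ifs with h
  · simp [h, Real.pi_ne_zero]
  · rw [integral_cos_intCast_mul (by omega)]
    simp

theorem continuous_aeval_comp (p : ℤ[X]) {g : ℝ → ℝ} (hg : Continuous g) :
    Continuous fun θ => aeval (g θ) p :=
  (Polynomial.continuous_aeval p).comp hg

/-- Multiplication by `2 cos θ` sends `polyP r` to the sum of its neighbours, and the added 1 fixes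
it: one step of a lattice path. -/
theorem angularIntegral_pow_mul (fl : Bool) (k r : ℕ) :
    angularIntegral (fun θ => ((if fl = true then 1 else 0) + 2 * Real.cos θ) ^ k *
      aeval (2 * Real.cos θ) (polyP r)) = ball fl k r := by
  have hc : ∀ r, Continuous fun θ => aeval (2 * Real.cos θ) (polyP r) := fun r =>
    continuous_aeval_comp _ (by fun_prop)
  have hk : ∀ k r, Continuous fun θ => ((if fl = true then 1 else 0) + 2 * Real.cos θ) ^ k *
      aeval (2 * Real.cos θ) (polyP r) := fun k r =>
    Continuous.mul (by fun_prop) (hc r)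
  induction k generalizing r with
  | zero =>
    have := angularIntegral_polyP_mul 0 r
    simp only [polyP, map_one, one_mul] at this
    simp only [pow_zero, one_mul, this, ball_zero, eq_comm]
    split_ifs <;> simp
  | succ k ih =>
    have e : ∀ θ : ℝ, ((if fl = true then 1 else 0) + 2 * Real.cos θ) ^ (k + 1) *
        aeval (2 * Real.cos θ) (polyP r) =
        ((if fl = true then 1 else 0) + 2 * Real.cos θ) ^ k *
            aeval (2 * Real.cos θ) (polyP (r + 1)) +
          (if 0 < r then ((if fl = true then 1 else 0) + 2 * Real.cos θ) ^ k *
            aeval (2 * Real.cos θ) (polyP (r - 1)) else 0) +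
          (if fl = true then ((if fl = true then 1 else 0) + 2 * Real.cos θ) ^ k *
            aeval (2 * Real.cos θ) (polyP r) else 0) := by
      intro θ
      cases r with
      | zero => cases fl <;> simp [polyP] <;> ring
      | succ r =>
        rw [if_pos (Nat.succ_pos r), aeval_polyP_add_two]
        cases fl <;> simp <;> ring
    simp only [e]
    have h1 : Continuous fun θ => if 0 < r then
        ((if fl = true then 1 else 0) + 2 * Real.cos θ) ^ k *
          aeval (2 * Real.cos θ) (polyP (r - 1)) else 0 := by
      by_cases h0 : 0 < r
      · simpa only [h0, if_true] using hk k (r - 1)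
      · simpa only [h0, if_false] using continuous_const
    have h2 : Continuous fun θ => if fl = true then
        ((if fl = true then 1 else 0) + 2 * Real.cos θ) ^ k *
          aeval (2 * Real.cos θ) (polyP r) else 0 := by
      split_ifs with hfl
      · simpa [hfl] using hk k r
      · exact continuous_const
    refine (angularIntegral_add ((hk k (r + 1)).add h1) h2).trans ?_
    refine (congrArg (· + _) (angularIntegral_add (hk k (r + 1)) h1)).trans ?_
    rw [ih, ball_succ]
    push_cast
    congr 1
    · congr 1
      by_cases h0 : 0 < r
      · simpa only [h0, if_true] using ih (r - 1)
      · simp [h0, angularIntegral]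
    · split_ifs with h
      · simpa [h] using ih r
      · simp [angularIntegral]

theorem angularIntegral_pow (fl : Bool) (k : ℕ) :
    angularIntegral (fun θ => ((if fl = true then 1 else 0) + 2 * Real.cos θ) ^ k) =
      ball fl k 0 := by
  simpa [polyP] using angularIntegral_pow_mul fl k 0

/-- At `n = 1` every diagonal Gram entry is 1, so the trace counts diagrams. -/
theorem isMainCharacterLaw_map {P : PartitionFamily} {g : ℝ → ℝ} (hg : Continuous g)
    (h : ∀ k, angularIntegral (fun θ => g θ ^ k) = Fintype.card (Diagram P k)) :
    IsMainCharacterLaw P (angularMeasure.map g) := by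
  refine ⟨?_, fun k => ⟨integrable_map_angularMeasure hg (by fun_prop), ?_⟩⟩
  · have h1 : ∫ _, (1 : ℝ) ∂angularMeasure = 1 := by
      have := angularIntegral_pow false 0
      exact (integral_angularMeasure _).trans (by simpa [ball_zero] using this)
    have h2 : IsProbabilityMeasure angularMeasure := ⟨by
      rw [integral_const, smul_eq_mul, mul_one] at h1
      exact (ENNReal.toReal_eq_one_iff _).mp h1⟩
    exact Measure.isProbabilityMeasure_map hg.aemeasurable
  · rw [integral_map_angularMeasure hg (by fun_prop), h]
    simp [Matrix.trace, gramMatrix]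

theorem monic_of_recurrence {F : ℕ → ℤ[X]} {G : ℤ[X]} (hG : G.Monic) (hG1 : G.natDegree = 1)
    (h0 : F 0 = 1) (h1 : (F 1).Monic ∧ (F 1).natDegree = 1)
    (h : ∀ r, F (r + 2) = G * F (r + 1) - F r) (r : ℕ) : (F r).Monic ∧ (F r).natDegree = r := by
  induction r using Nat.twoStepInduction with
  | zero => simp [h0]
  | one => exact h1
  | more r ih1 ih2 =>
    have hm : (G * F (r + 1)).Monic := hG.mul ih2.1
    have hd : (G * F (r + 1)).natDegree = r + 2 := by
      rw [hG.natDegree_mul ih2.1, hG1, ih2.2]; ring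
    have hlt : (F r).natDegree < (G * F (r + 1)).natDegree := by rw [hd, ih1.2]; omega
    rw [h]
    exact ⟨hm.sub_of_left (degree_lt_degree hlt),
      (natDegree_sub_eq_left_of_natDegree_lt hlt).trans hd⟩

theorem areOrthogonalPolynomials_map {F : ℕ → ℤ[X]} {g : ℝ → ℝ} (hg : Continuous g) {t : ℕ → ℕ}
    (ht : Function.Injective t) (hF : ∀ r, (F r).Monic ∧ (F r).natDegree = r)
    (h : ∀ r θ, aeval (g θ) (F r) = aeval (2 * Real.cos θ) (polyP (t r))) :
    AreOrthogonalPolynomials F (angularMeasure.map g) := by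
  refine ⟨hF, fun i j hij => ?_⟩
  have hc : Continuous fun x : ℝ => aeval x (F i) * aeval x (F j) :=
    (Polynomial.continuous_aeval _).mul (Polynomial.continuous_aeval _)
  refine ⟨integrable_map_angularMeasure hg hc, ?_⟩
  rw [integral_map_angularMeasure hg hc]
  simp only [h]
  rw [angularIntegral_polyP_mul, if_neg (ht.ne hij)]

/-- Two steps of the recurrence of `polyP` make one step in `x ^ 2` with shift 2. Hence squaring the
semicircular variable turns even-indexed `polyP` into even-indexed `polyR`. -/
theorem aeval_polyR_sq (x : ℝ) (l : ℕ) : aeval (x ^ 2) (polyR (2 * l)) = aeval x (polyP (2 * l)) := by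
  induction l using Nat.twoStepInduction with
  | zero => simp [polyR, polyP]
  | one => simp [polyR, polyP]; ring
  | more l ih1 ih2 =>
    rw [show 2 * (l + 1) = 2 * l + 2 by ring] at ih2
    rw [show 2 * (l + 1 + 1) = 2 * l + 4 by ring, aeval_polyR_add_four, ih1, ih2,
      aeval_polyP_add_two x (2 * l + 2), aeval_polyP_add_two x (2 * l + 1)]
    have := aeval_polyP_add_two x (2 * l)
    linear_combination (-1 : ℝ) * this

theorem exists_law_ncPairings : ∃ μ : Measure ℝ, IsMainCharacterLaw ncPairings μ ∧
    AreOrthogonalPolynomials polyP μ := by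
  have hg : Continuous fun θ => 2 * Real.cos θ := by fun_prop
  refine ⟨_, isMainCharacterLaw_map hg fun k => ?_, areOrthogonalPolynomials_map hg
    Function.injective_id (monic_of_recurrence (G := X) monic_X natDegree_X rfl
    ⟨monic_X, natDegree_X⟩ fun r => rfl) fun r θ => rfl⟩
  rw [ncPairings_eq, card_diagram_pair, ← angularIntegral_pow]
  simp

theorem monic_X_sub_natCast (n : ℕ) :
    (X - (n : ℤ[X])).Monic ∧ (X - (n : ℤ[X])).natDegree = 1 :=
  ⟨by simpa using monic_X_sub_C (n : ℤ), by simpa using natDegree_X_sub_C (n : ℤ)⟩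

theorem exists_law_ncSingletonsPairings :
    ∃ μ : Measure ℝ, IsMainCharacterLaw ncSingletonsPairings μ ∧
      AreOrthogonalPolynomials polyQ μ := by
  have hg : Continuous fun θ => 1 + 2 * Real.cos θ := by fun_prop
  have h1 := monic_X_sub_natCast 1
  rw [Nat.cast_one] at h1
  refine ⟨_, isMainCharacterLaw_map hg fun k => ?_, areOrthogonalPolynomials_map hg
    Function.injective_id (monic_of_recurrence h1.1 h1.2 rfl h1 fun r => rfl) fun r θ => ?_⟩
  · rw [ncSingletonsPairings_eq, card_diagram_pair, ← angularIntegral_pow]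
    simp
  · rw [aeval_polyQ, add_sub_cancel_left]
    rfl

theorem exists_law_ncPartitions : ∃ μ : Measure ℝ, IsMainCharacterLaw ncPartitions μ ∧
    AreOrthogonalPolynomials (fun l => polyR (2 * l)) μ := by
  have hg : Continuous fun θ => (2 * Real.cos θ) ^ 2 := by fun_prop
  have h1 := monic_X_sub_natCast 1
  have h2 := monic_X_sub_natCast 2
  rw [Nat.cast_one] at h1
  rw [Nat.cast_ofNat] at h2
  refine ⟨_, isMainCharacterLaw_map hg fun k => ?_, areOrthogonalPolynomials_map hg
    (t := fun l => 2 * l) (fun a b h => by simpa using h)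
    (monic_of_recurrence h2.1 h2.2 rfl h1 fun r => ?_)
    fun r θ => aeval_polyR_sq _ r⟩
  · rw [card_diagram_side, ← angularIntegral_pow]
    simp [pow_mul]
  · rw [show 2 * (r + 2) = 2 * r + 4 by ring]
    rfl

/-! ### Nonvanishing of the polynomials and determinant formulas over any field. -/

theorem polyP_ne_zero (r : ℕ) : polyP r ≠ 0 := by
  rintro h
  have := aeval_polyP_pos (le_refl (2 : ℝ)) r
  rw [h, map_zero] at this
  exact lt_irrefl _ this

theorem polyQ_ne_zero (r : ℕ) : polyQ r ≠ 0 := by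
  rintro h
  have := aeval_polyP_pos (le_refl (2 : ℝ)) r
  rw [show (2 : ℝ) = 3 - 1 by norm_num, ← aeval_polyQ, h, map_zero] at this
  exact lt_irrefl _ this

theorem polyR_ne_zero (r : ℕ) : polyR r ≠ 0 := by
  rintro h
  have := aeval_polyR_pos (le_refl (4 : ℝ)) r
  rw [h, map_zero] at this
  exact lt_irrefl _ this

theorem det_gramMatrix_ncPairings (k : ℕ) {K : Type*} [Field K] (x : K)
    (hx : ∀ σ : EpiDiagram ncPairings k, Even σ.legs → σ.legs ≠ 0 →
      aeval x (polyP (σ.legs / 2 - 1)) ≠ 0) :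
    (gramMatrix ncPairings k x).det = x ^ gramExponent ncPairings k *
      ∏ σ : EpiDiagram ncPairings k with Even σ.legs, stepRatio polyP x (σ.legs / 2) := by
  revert hx
  rw [ncPairings_eq]
  refine det_gramMatrix_pairFamily (fun n hn s => aeval_polyP_pos ?_ s) rfl ?_ (fun r => ?_) k x
  · exact_mod_cast (by omega : 2 ≤ n)
  · simp [polyP]
  · simp [polyP]

theorem det_gramMatrix_ncSingletonsPairings (k : ℕ) {K : Type*} [Field K] (x : K)
    (hx : ∀ σ : EpiDiagram ncSingletonsPairings k, Even σ.legs → σ.legs ≠ 0 →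
      aeval x (polyQ (σ.legs / 2 - 1)) ≠ 0) :
    (gramMatrix ncSingletonsPairings k x).det = x ^ gramExponent ncSingletonsPairings k *
      ∏ σ : EpiDiagram ncSingletonsPairings k with Even σ.legs,
        stepRatio polyQ x (σ.legs / 2) := by
  revert hx
  rw [ncSingletonsPairings_eq]
  refine det_gramMatrix_pairFamily (fun n hn s => ?_) rfl ?_ (fun r => ?_) k x
  · rw [aeval_polyQ]
    refine aeval_polyP_pos ?_ s
    have : (5 : ℝ) ≤ n := by exact_mod_cast hn
    linarith
  · simp [polyQ]
  · simp [polyQ]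

end EasyGram

theorem theorem8p2 :
    -- the case of `O_n^+`
    ((∃ μ : Measure ℝ, IsMainCharacterLaw ncPairings μ ∧ AreOrthogonalPolynomials polyP μ) ∧
      ∀ k : ℕ,
        ((gramMatrix ncPairings k (RatFunc.X : RatFunc ℚ)).det =
          RatFunc.X ^ gramExponent ncPairings k *
            ∏ σ : EpiDiagram ncPairings k with Even σ.legs,
              stepRatio polyP (RatFunc.X : RatFunc ℚ) (σ.legs / 2)) ∧
        ∀ n : ℝ,
          (∀ σ : EpiDiagram ncPairings k, Even σ.legs → σ.legs ≠ 0 →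
            aeval n (polyP (σ.legs / 2 - 1)) ≠ 0) →
          (gramMatrix ncPairings k n).det =
            n ^ gramExponent ncPairings k *
              ∏ σ : EpiDiagram ncPairings k with Even σ.legs,
                stepRatio polyP n (σ.legs / 2)) ∧
    -- the case of `B_n^+`
    ((∃ μ : Measure ℝ, IsMainCharacterLaw ncSingletonsPairings μ ∧
        AreOrthogonalPolynomials polyQ μ) ∧
      ∀ k : ℕ,
        ((gramMatrix ncSingletonsPairings k (RatFunc.X : RatFunc ℚ)).det =
          RatFunc.X ^ gramExponent ncSingletonsPairings k *
            ∏ σ : EpiDiagram ncSingletonsPairings k with Even σ.legs,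
              stepRatio polyQ (RatFunc.X : RatFunc ℚ) (σ.legs / 2)) ∧
        ∀ n : ℝ,
          (∀ σ : EpiDiagram ncSingletonsPairings k, Even σ.legs → σ.legs ≠ 0 →
            aeval n (polyQ (σ.legs / 2 - 1)) ≠ 0) →
          (gramMatrix ncSingletonsPairings k n).det =
            n ^ gramExponent ncSingletonsPairings k *
              ∏ σ : EpiDiagram ncSingletonsPairings k with Even σ.legs,
                stepRatio polyQ n (σ.legs / 2)) ∧
    -- the case of `S_n^+`
    ((∃ μ : Measure ℝ, IsMainCharacterLaw ncPartitions μ ∧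
        AreOrthogonalPolynomials (fun l => polyR (2 * l)) μ) ∧
      ∀ k : ℕ,
        ((gramMatrix ncPartitions k (RatFunc.X : RatFunc ℚ)).det =
          RatFunc.X ^ gramExponent ncPartitions k *
            ∏ σ : EpiDiagram ncPartitions k,
              stepRatio polyR (RatFunc.X : RatFunc ℚ) σ.legs) ∧
        ∀ n : ℝ,
          (∀ σ : EpiDiagram ncPartitions k, σ.legs ≠ 0 →
            aeval n (polyR (σ.legs - 1)) ≠ 0) →
          (gramMatrix ncPartitions k n).det =
            n ^ gramExponent ncPartitions k *
              ∏ σ : EpiDiagram ncPartitions k, stepRatio polyR n σ.legs) := by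
  refine ⟨⟨exists_law_ncPairings, fun k => ⟨?_, fun n => det_gramMatrix_ncPairings k n⟩⟩,
    ⟨exists_law_ncSingletonsPairings, fun k =>
      ⟨?_, fun n => det_gramMatrix_ncSingletonsPairings k n⟩⟩,
    ⟨exists_law_ncPartitions, fun k => ⟨?_, fun n => det_gramMatrix_ncPartitions k n⟩⟩⟩
  · exact det_gramMatrix_ncPairings k _ fun _ _ _ => aeval_ratFunc_ne_zero (polyP_ne_zero _)
  · exact det_gramMatrix_ncSingletonsPairings k _ fun _ _ _ =>
      aeval_ratFunc_ne_zero (polyQ_ne_zero _)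
  · exact det_gramMatrix_ncPartitions k _ fun _ _ => aeval_ratFunc_ne_zero (polyR_ne_zero _)
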